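/- For a connected graph $G$ and a set $C$ of cycles of $G$ (identified with their edge sets), let $T(G,C)$ be the graph whose vertices are the spanning trees of $G$, two trees $R,S$ being adjacent if $R\cup S$ contains exactly one cycle and this cycle lies in $C$. The set $C$ is \emph{arboreal} if every spanning tree of $G$ has a fundamental cycle in $C$; it \emph{cyclically spans} the cycle space of $G$ if each cycle $\sigma$ of $G$ can be written $\sigma=\alpha_1\Delta\cdots\Delta\alpha_m$ with all $\alpha_i\in C$ and with $\alpha_1\Delta\cdots\Delta\alpha_i$ a cycle of $G$ for $2\le i\le m$. For $n\ge 0$ let $G_n$ be the graph of $n+1$ nested octahedra: its vertices are the pairs $(k,i)$ with $0\le k\le n+1$ (the layer) and $i\in\mathbb Z/3$, and $(k,i)$, $(l,j)$ are adjacent if and only if $i\ne j$ and $|k-l|\le 1$. Call $\{(k_0,0),(k_1,1),(k_2,2)\}$ an \emph{internal triangle} if $k_0=k_1=k_2=0$, or if for some $0\le k\le n$ all $k_i$ lie in $\{k,k+1\}$ and they are not all equal. Write $x,y,z$ for $(1,0),(1,1),(1,2)$ and $b,c,a$ for $(0,0),(0,1),(0,2)$. Let $\alpha=xac$, let $\beta$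 be either of the triangles $abc$ and $xya$, and let $\rho=byz$. Let $C_n$ be the set of internal triangles with $\alpha$ replaced by $\alpha\,\Delta\,\beta$. Let $T_n,S_n,R_n$ be the spanning subgraphs of $G_n$ that each contain the edges $ca,\ ax,\ xz$ and, for every $1\le k\le n$, the edges of the path $(k,k+2),\,(k+1,k+1),\,(k+1,k+2),\,(k+1,k)$ (second coordinates modulo $3$), and in addition the two edges of $\rho$ at $b$, at $y$ and at $z$ respectively, and no other edges. Then for every $n\ge0$ and each of the two choices of $\beta$: (1) $G_n$ has $3(n+2)$ vertices, is $2$-connected, and has a plane drawing (with straight edges) in which every face is bounded by a triangle, the bounded faces are exactly those bounded by the internal triangles, and the unbounded face is bounded by the triangle on layer $n+1$; (2) $\alpha$ and $\beta$ are internal triangles with exactly one common edge, all members of $C_n$ are cycles of $G_n$, and $C_n$ is arboreal and cyclically spans the cycle space of $G_n$; (3) $T(G_n,C_n)$ is disconnected; $T_n,S_n,R_n$ are three distinct spanning trees of $G_n$ whose set is the vertex set of a connected component of $T(G_n,C_n)$, and $\rho$ is the only cycle in $C_n$ that is a fundamental cycle of $T_n$, of $S_n$ or of $R_n$ (and it is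 one of each). -/

import Mathlib

open scoped symmDiff

namespace TreeGraphs

section General

variable {V : Type*}

/-- `σ` is the edge set of a cycle of `G`. -/
def IsCycleOf (G : SimpleGraph V) (σ : Set (Sym2 V)) : Prop :=
  ∃ (v : V) (w : G.Walk v v), w.IsCycle ∧ σ = {e | e ∈ w.edges}

/-- A spanning tree of `G`: a subgraph of `G` on all the vertices of `G` which is a tree. -/
def IsSpanningTree (G T : SimpleGraph V) : Prop := T ≤ G ∧ T.IsTree

/-- The type of spanning trees of `G`. -/
abbrev SpanningTree (G : SimpleGraph V) : Type _ := {T : SimpleGraph V // IsSpanningTree G T}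

/-- `σ` is a fundamental cycle of `T` in `G`: the cycle that appears when some edge `e` of `G`
outside `T` is added to `T`. -/
def IsFundamentalCycle (G T : SimpleGraph V) (σ : Set (Sym2 V)) : Prop :=
  ∃ e ∈ G.edgeSet, e ∉ T.edgeSet ∧ IsCycleOf (T ⊔ SimpleGraph.fromEdgeSet {e}) σ

/-- The tree graph `T(G, C)`: its vertices are the spanning trees of `G`, and `R`, `S` are adjacent
when `R ∪ S` contains exactly one cycle and this cycle lies in `C`. -/
def treeGraph (G : SimpleGraph V) (C : Set (Set (Sym2 V))) : SimpleGraph (SpanningTree G) where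
  Adj R S := ∃ σ ∈ C, {τ | IsCycleOf (R.1 ⊔ S.1) τ} = {σ}
  symm := ⟨fun R S h => by rwa [sup_comm] at h⟩
  loopless := ⟨by
    rintro R ⟨σ, -, h⟩
    have hσ : IsCycleOf (R.1 ⊔ R.1) σ := by
      have : σ ∈ {τ | IsCycleOf (R.1 ⊔ R.1) τ} := by rw [h]; rfl
      exact this
    rw [sup_idem] at hσ
    obtain ⟨v, w, hw, -⟩ := hσ
    exact R.2.2.isAcyclic w hw⟩

/-- `C` is arboreal with respect to `G`: every spanning tree has a fundamental cycle in `C`. -/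
def IsArboreal (G : SimpleGraph V) (C : Set (Set (Sym2 V))) : Prop :=
  ∀ T : SimpleGraph V, IsSpanningTree G T → ∃ σ ∈ C, IsFundamentalCycle G T σ

/-- The partial sums `a 0 ∆ a 1 ∆ ⋯ ∆ a i`. -/
def partialSum (a : ℕ → Set (Sym2 V)) : ℕ → Set (Sym2 V)
  | 0 => a 0
  | i + 1 => partialSum a i ∆ a (i + 1)

/-- `C` cyclically spans the cycle space of `G`: each cycle of `G` is a sum
`a 0 ∆ ⋯ ∆ a m` of members of `C` all of whose partial sums are cycles of `G`. -/
def CyclicallySpans (G : SimpleGraph V) (C : Set (Set (Sym2 V))) : Prop :=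
  ∀ σ, IsCycleOf G σ → ∃ (m : ℕ) (a : ℕ → Set (Sym2 V)),
    (∀ i ≤ m, a i ∈ C) ∧ (∀ i, 1 ≤ i → i ≤ m → IsCycleOf G (partialSum a i)) ∧
      partialSum a m = σ

/-- `G` has at least three vertices, is connected, and stays connected when any single vertex is
deleted. -/
def IsTwoConnected (G : SimpleGraph V) : Prop :=
  3 ≤ Nat.card V ∧ G.Connected ∧ ∀ v : V, (G.induce {v}ᶜ).Connected

/-- A drawing of `G` in the plane without crossings, with straight edges. -/
structure PlaneDrawing (G : SimpleGraph V) where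
  /-- the position of a vertex -/
  pos : V → EuclideanSpace ℝ (Fin 2)
  pos_injective : Function.Injective pos
  /-- no edge passes through a vertex -/
  vertex_off_edge : ∀ u v w, G.Adj u v → pos w ∉ openSegment ℝ (pos u) (pos v)
  /-- distinct edges do not cross -/
  edges_disjoint : ∀ u v u' v', G.Adj u v → G.Adj u' v' → s(u, v) ≠ s(u', v') →
    Disjoint (openSegment ℝ (pos u) (pos v)) (openSegment ℝ (pos u') (pos v'))

namespace PlaneDrawing

variable {G : SimpleGraph V} (D : PlaneDrawing G)

/-- The union of the drawn edges belonging to `E`; each edge is the segment joining its ends. -/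
def carrier (E : Set (Sym2 V)) : Set (EuclideanSpace ℝ (Fin 2)) :=
  ⋃ e ∈ E, convexHull ℝ (D.pos '' {v | v ∈ e})

/-- The points of the plane covered by the drawing. -/
def support : Set (EuclideanSpace ℝ (Fin 2)) := Set.range D.pos ∪ D.carrier G.edgeSet

/-- The faces of the drawing: the connected components of the complement of the drawing. -/
def IsFace (F : Set (EuclideanSpace ℝ (Fin 2))) : Prop :=
  ∃ p ∈ D.supportᶜ, F = connectedComponentIn D.supportᶜ p

/-- The plane graph is triangulated: every face, the outer one included, is bounded by a cycle of
length three. -/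
def IsTriangulated : Prop :=
  ∀ F, D.IsFace F → ∃ σ, IsCycleOf G σ ∧ σ.ncard = 3 ∧ frontier F = D.carrier σ

/-- The cycles of `G` that bound an internal (that is, bounded) face. -/
def internalFaceCycles : Set (Set (Sym2 V)) :=
  {σ | IsCycleOf G σ ∧ ∃ F, D.IsFace F ∧ Bornology.IsBounded F ∧ frontier F = D.carrier σ}

/-- The cycles of `G` that bound an outer (that is, unbounded) face. -/
def outerFaceCycles : Set (Set (Sym2 V)) :=
  {σ | IsCycleOf G σ ∧ ∃ F, D.IsFace F ∧ ¬ Bornology.IsBounded F ∧ frontier F = D.carrier σ}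

end PlaneDrawing

end General

/-! The family of nested octahedra. The graph `G n` has `n + 2` layers of three vertices each, layer
`0` being the innermost triangle and layer `n + 1` the outermost. -/

/-- The vertex `(k, i)` is the vertex of layer `k` with index `i`. -/
abbrev Vert (n : ℕ) : Type := Fin (n + 2) × Fin 3

/-- Each layer is a triangle, and two consecutive layers `k`, `k + 1` span the skeleton of an
octahedron, in which `(k, i)` and `(k + 1, i)` are opposite vertices. Thus `G 0` is the octahedron,
and `G (n + 1)` is an octahedron (on the layers `n + 1`, `n + 2`) with a copy of `G n`
(on the layers `0, …, n + 1`) placed in its inner face. -/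
def nestedOctahedra (n : ℕ) : SimpleGraph (Vert n) where
  Adj u v := u.2 ≠ v.2 ∧ u.1.val ≤ v.1.val + 1 ∧ v.1.val ≤ u.1.val + 1
  symm := ⟨fun _ _ h => ⟨h.1.symm, h.2.2, h.2.1⟩⟩
  loopless := ⟨fun _ h => h.1 rfl⟩

variable {n : ℕ}

/-- The edge set of the triangle with vertices `(f 0, 0)`, `(f 1, 1)`, `(f 2, 2)`. -/
def triangle (f : Fin 3 → Fin (n + 2)) : Set (Sym2 (Vert n)) :=
  {e | ∃ i j, i ≠ j ∧ e = s((f i, i), (f j, j))}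

/-- The internal faces of `G n`: the innermost triangle, and, for each `k ≤ n`, the six faces
between layer `k` and layer `k + 1`. -/
def internalFaces (n : ℕ) : Set (Set (Sym2 (Vert n))) :=
  {σ | ∃ f : Fin 3 → Fin (n + 2), σ = triangle f ∧
    ((∀ i, f i = 0) ∨
      (∃ k : Fin (n + 1), ∀ i, f i = k.castSucc ∨ f i = k.succ) ∧ ∃ i j, f i ≠ f j)}

/-- The outer face of `G n`. -/
def outerFace (n : ℕ) : Set (Sym2 (Vert n)) := triangle fun _ => Fin.last (n + 1)

/-! The innermost octahedron has outer vertices `x = (1, 0)`, `y = (1, 1)`, `z = (1, 2)` and inner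
vertices `(0, 0)`, `(0, 1)`, `(0, 2)` opposite to `x`, `y`, `z` respectively. -/

/-- The face at `x` that contains the edge joining `(0, 1)` and `(0, 2)`. -/
def faceAlpha (n : ℕ) : Set (Sym2 (Vert n)) := triangle ![1, 0, 0]

/-- The face on the edge `yz`. -/
def faceRho (n : ℕ) : Set (Sym2 (Vert n)) := triangle ![0, 1, 1]

/-- The internal faces with `α` replaced by `α ∆ β`. -/
def faceFamily (n : ℕ) (β : Set (Sym2 (Vert n))) : Set (Set (Sym2 (Vert n))) :=
  insert (faceAlpha n ∆ β) (internalFaces n \ {faceAlpha n})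

/-- The edges outside the innermost octahedron that the three trees have in common. For each
`k = 1, …, n` they form a path of length three which starts in layer `k` and then visits the three
vertices of layer `k + 1`; indices are modulo three. -/
def spiral (n : ℕ) : Set (Sym2 (Vert n)) :=
  {e | ∃ k : Fin (n + 1), k ≠ 0 ∧
    (e = s((k.castSucc, Fin.ofNat 3 (k.val + 2)), (k.succ, Fin.ofNat 3 (k.val + 1))) ∨
     e = s((k.succ, Fin.ofNat 3 (k.val + 1)), (k.succ, Fin.ofNat 3 (k.val + 2))) ∨
     e = s((k.succ, Fin.ofNat 3 (k.val + 2)), (k.succ, Fin.ofNat 3 k.val)))}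

/-- The edges of the innermost octahedron outside `ρ` that the three trees have in common: the path
from `(0, 1)` through `(0, 2)` and `x` to `z`. -/
def innerPath (n : ℕ) : Set (Sym2 (Vert n)) :=
  {s((0, 1), (0, 2)), s((0, 2), (1, 0)), s((1, 0), (1, 2))}

/-- The tree `T n`: it contains the edges of `ρ` at the vertex `(0, 0)`. -/
def treeT (n : ℕ) : SimpleGraph (Vert n) :=
  SimpleGraph.fromEdgeSet ({s((0, 0), (1, 1)), s((0, 0), (1, 2))} ∪ innerPath n ∪ spiral n)

/-- The tree `S n`: it contains the edges of `ρ` at the vertex `y`. -/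
def treeS (n : ℕ) : SimpleGraph (Vert n) :=
  SimpleGraph.fromEdgeSet ({s((1, 1), (0, 0)), s((1, 1), (1, 2))} ∪ innerPath n ∪ spiral n)

/-- The tree `R n`: it contains the edges of `ρ` at the vertex `z`. -/
def treeR (n : ℕ) : SimpleGraph (Vert n) :=
  SimpleGraph.fromEdgeSet ({s((1, 2), (0, 0)), s((1, 2), (1, 1))} ∪ innerPath n ∪ spiral n)

end TreeGraphs

open TreeGraphs

/-! A cycle is a minimal nonempty edge set with all degrees even (`isCycleOf_iff_minimal`). So being
a cycle does not depend on the surrounding graph, and a fundamental cycle of a tree is a cycle with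
exactly one edge outside it.

Cyclic spanning: the faces of `G n`, the outer one included, form a combinatorial sphere
(`isFaceSystem_bdry`), and its cycles are the boundaries of nontrivial face sets that are connected
together with their complements. From the side of a cycle that avoids the outer face, faces can be
removed one at a time so that the boundary stays a cycle (`exists_removable`). Read backwards, this
builds the cycle through cycles. If `α` occurs, it is kept to the very end, where `α = (α ∆ β) ∆ β`.

Arboreality is a count: `3n + 4` internal faces, `α` not among them, partition the edges
(`evenFace`), while a spanning tree has `3n + 5` edges. So some such face contains two tree edges,
and its boundary is a fundamental cycle.

Disconnectedness: the union of the three trees is `ρ` together with their common edges. The spiral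
is wound so that the only internal faces with two edges in this union are `α` and `ρ`
(`eq_of_hubEdges`). The triangle `α` is no longer in the family, and `α ∆ β` has two edges outside
the union. Hence `ρ` is the only usable cycle, every move in the tree graph takes place inside `ρ`,
and it leads to another of the three trees (`IsHub.of_adj`). A spanning tree that avoids the edge
`ca` lies in a different component.

Drawing: the vertex `(k, i)` is placed at `(-4) ^ k` times the `i`-th unit vector, modulo constant
vectors. A piecewise linear gauge shows that barycentric coordinates with respect to the faces are
unique (`IsShellWeight.unique_of_proper`) and, by the intermediate value theorem, that the faces
fill the outer triangle (`InLayerTriangle.exists_isShellWeight`). -/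

namespace TreeGraphs

/-! ### Even edge sets, cycles, and exchange between spanning trees. -/

section EvenSets

variable {V : Type*}

/-- Every vertex is incident with an even number of edges of `τ`. -/
def IsEven (τ : Set (Sym2 V)) : Prop := ∀ v, Even {w | s(v, w) ∈ τ}.ncard

theorem isEven_empty : IsEven (∅ : Set (Sym2 V)) := fun v => by simp

theorem even_ncard_symmDiff {α : Type*} [Finite α] {A B : Set α} (hA : Even A.ncard)
    (hB : Even B.ncard) : Even (A ∆ B).ncard := by
  have h1 := Set.ncard_inter_add_ncard_sdiff_eq_ncard A B
  have h2 := Set.ncard_inter_add_ncard_sdiff_eq_ncard B A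
  have h3 : (A ∆ B).ncard = (A \ B).ncard + (B \ A).ncard := by
    rw [Set.symmDiff_def]
    exact Set.ncard_union_eq (disjoint_sdiff_sdiff)
  rw [Set.inter_comm] at h2
  grind

theorem IsEven.symmDiff [Finite V] {σ τ : Set (Sym2 V)} (hσ : IsEven σ) (hτ : IsEven τ) :
    IsEven (σ ∆ τ) := fun v => even_ncard_symmDiff (hσ v) (hτ v)

theorem IsEven.exists_ne [Finite V] {τ : Set (Sym2 V)} (hτ : IsEven τ) {v u : V}
    (h : s(v, u) ∈ τ) : ∃ w, w ≠ u ∧ s(v, w) ∈ τ := by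
  by_contra! hc
  have : {w | s(v, w) ∈ τ} = {u} := by
    ext w
    simp only [Set.mem_ofPred_eq, Set.mem_singleton_iff]
    exact ⟨fun hw => by_contra fun hne => hc w hne hw, fun hw => hw ▸ h⟩
  have h2 := hτ v
  rw [this] at h2
  simp at h2

variable {G H T S : SimpleGraph V} {σ τ : Set (Sym2 V)}

/-- A path in a forest can always be prolonged: evenness gives a second edge at its last vertex, and
that edge cannot return to the path without closing a cycle. In a finite graph this is absurd, so a
nonempty even set contains a cycle. -/
theorem IsEven.exists_path [Finite V] (hτ : IsEven τ) (hne : τ.Nonempty) (hG : τ ⊆ G.edgeSet)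
    (hac : (SimpleGraph.fromEdgeSet τ).IsAcyclic) (n : ℕ) :
    ∃ (u v : V) (p : (SimpleGraph.fromEdgeSet τ).Walk u v), p.IsPath ∧ p.length = n + 1 := by
  have hadj : ∀ u v, (SimpleGraph.fromEdgeSet τ).Adj u v ↔ s(u, v) ∈ τ := fun u v => by
    rw [SimpleGraph.fromEdgeSet_adj]
    exact ⟨fun h => h.1, fun h => ⟨h, (hG h : G.Adj u v).ne⟩⟩
  induction n with
  | zero =>
    obtain ⟨e, he⟩ := hne
    induction e with | _ u v
    exact ⟨u, v, ((hadj u v).2 he).toWalk, by simpa using ((hadj u v).2 he).ne, by simp⟩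
  | succ n ih =>
    obtain ⟨u, v, p, hp, hl⟩ := ih
    have hnil : ¬ p.Nil := fun h => by
      rw [← SimpleGraph.Walk.length_eq_zero_iff] at h; omega
    have h1 := (hadj _ _).1 (p.adj_penultimate hnil).symm
    obtain ⟨w, hw, hvw⟩ := hτ.exists_ne h1
    have hvw' := (hadj _ _).2 hvw
    refine ⟨u, w, p.concat hvw', ?_, by simp [hl]⟩
    rw [SimpleGraph.Walk.concat_isPath_iff]
    refine ⟨hp, fun hmem => hw ?_⟩
    exact hac.eq_penultimate_of_adj_end hp hvw' hmem

theorem IsCycleOf.mono (h : IsCycleOf G σ) (hGH : G ≤ H) : IsCycleOf H σ := by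
  obtain ⟨v, w, hw, rfl⟩ := h
  exact ⟨v, w.mapLe hGH, hw.mapLe hGH, by simp⟩

theorem IsCycleOf.subset_edgeSet (h : IsCycleOf G σ) : σ ⊆ G.edgeSet := by
  obtain ⟨v, w, hw, rfl⟩ := h
  exact fun e he => w.edges_subset_edgeSet he

theorem IsEven.exists_cycle [Finite V] (hτ : IsEven τ) (hne : τ.Nonempty) (hG : τ ⊆ G.edgeSet) :
    ∃ σ ⊆ τ, IsCycleOf G σ := by
  have : ¬ (SimpleGraph.fromEdgeSet τ).IsAcyclic := fun hac => by
    have := Fintype.ofFinite V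
    obtain ⟨u, v, p, hp, hl⟩ := hτ.exists_path hne hG hac (Fintype.card V)
    have := hp.length_lt
    omega
  simp only [SimpleGraph.IsAcyclic, not_forall, not_not] at this
  obtain ⟨v, w, hw⟩ := this
  have hc : IsCycleOf (SimpleGraph.fromEdgeSet τ) {e | e ∈ w.edges} := ⟨v, w, hw, rfl⟩
  refine ⟨{e | e ∈ w.edges}, ?_, hc.mono ?_⟩
  · refine hc.subset_edgeSet.trans ?_
    rw [SimpleGraph.edgeSet_fromEdgeSet]
    exact Set.sdiff_subset
  · intro a b hab
    exact hG ((SimpleGraph.fromEdgeSet_adj _).1 hab).1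

theorem IsCycleOf.nonempty (h : IsCycleOf G σ) : σ.Nonempty := by
  obtain ⟨v, w, hw, rfl⟩ := h
  obtain ⟨e, he⟩ := List.exists_mem_of_ne_nil w.edges
    (by rw [Ne, SimpleGraph.Walk.edges_eq_nil]; exact hw.not_nil)
  exact ⟨e, he⟩

theorem ncard_cycle_neighbors {v : V} {w : G.Walk v v} (hw : w.IsCycle) {x : V}
    (hx : x ∈ w.support) : {y | s(x, y) ∈ w.edges}.ncard = 2 := by
  rw [← hw.ncard_neighborSet_toSubgraph_eq_two hx]
  congr 1
  ext y
  rw [SimpleGraph.Subgraph.mem_neighborSet, ← SimpleGraph.Subgraph.mem_edgeSet,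
    SimpleGraph.Walk.mem_edges_toSubgraph]
  rfl

theorem IsCycleOf.isEven (h : IsCycleOf G σ) : IsEven σ := by
  obtain ⟨v, w, hw, rfl⟩ := h
  intro x
  by_cases hx : x ∈ w.support
  · have := ncard_cycle_neighbors hw hx
    simp only [Set.mem_ofPred_eq]
    rw [this]
    exact even_two
  · have : {y | s(x, y) ∈ w.edges} = ∅ := by
      ext y
      simp only [Set.mem_ofPred_eq, Set.mem_empty_iff_false, iff_false]
      exact fun hy => hx (w.fst_mem_support_of_mem_edges hy)
    simp [this]

/-- A vertex met by `τ` has at least two edges in `τ` and exactly two in the cycle, so `τ` contains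
all cycle edges there. This spreads along the connected cycle. -/
theorem IsCycleOf.minimal [Finite V] (h : IsCycleOf G σ) (hτ : IsEven τ) (hne : τ.Nonempty)
    (hs : τ ⊆ σ) : τ = σ := by
  obtain ⟨v, w, hw, rfl⟩ := h
  have key : ∀ x y, s(x, y) ∈ τ → {z | s(x, z) ∈ w.edges} = {z | s(x, z) ∈ τ} := by
    intro x y hxy
    have h2 := ncard_cycle_neighbors hw (w.fst_mem_support_of_mem_edges (hs hxy))
    refine (Set.eq_of_subset_of_ncard_le (s := {z | s(x, z) ∈ τ})
      (t := {z | s(x, z) ∈ w.edges}) (fun z hz => hs hz) ?_ (Set.toFinite _)).symm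
    obtain ⟨z, hz, hxz⟩ := hτ.exists_ne hxy
    rw [h2, ← Set.ncard_pair hz.symm]
    refine Set.ncard_le_ncard ?_ (Set.toFinite _)
    rintro a (rfl | rfl) <;> assumption
  obtain ⟨e, he⟩ := hne
  induction e with | _ a b
  have hconn := w.toSubgraph_connected
  have hall : ∀ x : w.toSubgraph.verts, ∃ y, s(x.1, y) ∈ τ := by
    intro x
    have ha : a ∈ w.toSubgraph.verts :=
      (w.mem_verts_toSubgraph).2 (w.fst_mem_support_of_mem_edges (hs he))
    obtain ⟨q⟩ := hconn.preconnected ⟨a, ha⟩ x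
    have : ∀ {x y : w.toSubgraph.verts} (q : w.toSubgraph.coe.Walk x y),
        (∃ z, s(x.1, z) ∈ τ) → ∃ z, s(y.1, z) ∈ τ := by
      intro x y q
      induction q with
      | nil => exact id
      | @cons u v' t had q ih =>
        rintro ⟨z, hz⟩
        refine ih ⟨u.1, ?_⟩
        have h1 : v'.1 ∈ {z | s(u.1, z) ∈ w.edges} := by
          have : w.toSubgraph.Adj u.1 v'.1 := had
          rwa [← SimpleGraph.Subgraph.mem_edgeSet, SimpleGraph.Walk.mem_edges_toSubgraph] at this
        rw [key _ _ hz] at h1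
        rw [Sym2.eq_swap]
        exact h1
    exact this q ⟨b, he⟩
  refine hs.antisymm fun e he' => ?_
  induction e with | _ x y
  obtain ⟨z, hz⟩ := hall ⟨x, (w.mem_verts_toSubgraph).2 (w.fst_mem_support_of_mem_edges he')⟩
  have : y ∈ {z | s(x, z) ∈ w.edges} := he'
  rw [key _ _ hz] at this
  exact this

/-- Only the first condition mentions `G`, which allows a cycle to be moved to any other graph
containing its edges. -/
theorem isCycleOf_iff_minimal [Finite V] : IsCycleOf G σ ↔ σ ⊆ G.edgeSet ∧ IsEven σ ∧ σ.Nonempty ∧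
    ∀ τ ⊆ σ, IsEven τ → τ.Nonempty → τ = σ := by
  refine ⟨fun h => ⟨h.subset_edgeSet, h.isEven, h.nonempty, fun τ hs h1 h2 => h.minimal h1 h2 hs⟩,
    fun ⟨hG, he, hne, hm⟩ => ?_⟩
  obtain ⟨τ, hs, hτ⟩ := he.exists_cycle hne hG
  rw [← hm τ hs hτ.isEven hτ.nonempty]
  exact hτ

theorem IsCycleOf.of_subset [Finite V] (h : IsCycleOf G σ) (hs : σ ⊆ H.edgeSet) :
    IsCycleOf H σ := by
  rw [isCycleOf_iff_minimal] at h ⊢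
  exact ⟨hs, h.2⟩

theorem not_isCycleOf_of_isAcyclic (hT : T.IsAcyclic) : ¬ IsCycleOf T σ := by
  rintro ⟨v, w, hw, -⟩
  exact hT w hw

theorem IsEven.eq_empty_of_isAcyclic [Finite V] (hτ : IsEven τ) (hT : T.IsAcyclic)
    (hs : τ ⊆ T.edgeSet) : τ = ∅ := by
  by_contra hne
  obtain ⟨σ, -, hσ⟩ := hτ.exists_cycle (Set.nonempty_iff_ne_empty.2 hne) hs
  exact not_isCycleOf_of_isAcyclic hT hσ

theorem edgeSet_sup_singleton {e : Sym2 V} (he : ¬ e.IsDiag) :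
    (T ⊔ SimpleGraph.fromEdgeSet {e}).edgeSet = insert e T.edgeSet := by
  rw [SimpleGraph.edgeSet_sup, SimpleGraph.edgeSet_fromEdgeSet]
  ext x
  simp only [Set.mem_union, Set.mem_sdiff, Set.mem_singleton_iff, Set.mem_insert_iff]
  constructor
  · rintro (h | ⟨h, -⟩) <;> simp [h]
  · rintro (rfl | h)
    · exact Or.inr ⟨rfl, he⟩
    · exact Or.inl h

theorem IsCycleOf.sdiff_eq_singleton [Finite V] {e : Sym2 V} (hT : T.IsAcyclic)
    (h : IsCycleOf H σ) (hs : σ ⊆ insert e T.edgeSet) (he : e ∉ T.edgeSet) :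
    σ \ T.edgeSet = {e} := by
  have hne : ¬ σ ⊆ T.edgeSet := fun hsub => not_isCycleOf_of_isAcyclic hT (h.of_subset hsub)
  obtain ⟨x, hx, hxT⟩ := Set.not_subset.1 hne
  have hxe : x = e := (hs hx).resolve_right hxT
  subst hxe
  ext y
  simp only [Set.mem_sdiff, Set.mem_singleton_iff]
  exact ⟨fun ⟨h1, h2⟩ => (hs h1).resolve_right h2, fun h => h ▸ ⟨hx, hxT⟩⟩

theorem isFundamentalCycle_iff [Finite V] (hT : T.IsAcyclic) (hTG : T ≤ G) :
    IsFundamentalCycle G T σ ↔ IsCycleOf G σ ∧ ∃ e, σ \ T.edgeSet = {e} := by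
  constructor
  · rintro ⟨e, heG, heT, h⟩
    refine ⟨h.mono (sup_le hTG ?_), e, ?_⟩
    · rw [SimpleGraph.fromEdgeSet_le]
      · rintro x ⟨rfl, -⟩
        exact heG
    · refine h.sdiff_eq_singleton hT ?_ heT
      rw [← edgeSet_sup_singleton (G.not_isDiag_of_mem_edgeSet heG)]
      exact h.subset_edgeSet
  · rintro ⟨h, e, he⟩
    have h1 : e ∈ σ \ T.edgeSet := by rw [he]; rfl
    have heG := h.subset_edgeSet h1.1
    refine ⟨e, heG, h1.2, h.of_subset ?_⟩
    rw [edgeSet_sup_singleton (G.not_isDiag_of_mem_edgeSet heG)]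
    intro x hx
    by_cases hxT : x ∈ T.edgeSet
    · exact Or.inr hxT
    · have : x ∈ σ \ T.edgeSet := ⟨hx, hxT⟩
      rw [he] at this
      exact Or.inl this

/-- Both cycles use `e`, so it cancels in their sum; what remains is an even set inside a forest,
hence empty. -/
theorem IsCycleOf.unique_of_subset_insert [Finite V] {e : Sym2 V} (hT : T.IsAcyclic)
    (hσ : IsCycleOf H σ) (hτ : IsCycleOf G τ) (hs : σ ⊆ insert e T.edgeSet)
    (ht : τ ⊆ insert e T.edgeSet) (he : e ∉ T.edgeSet) : σ = τ := by
  have h1 : e ∈ σ \ T.edgeSet := by rw [hσ.sdiff_eq_singleton hT hs he]; rfl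
  have h2 : e ∈ τ \ T.edgeSet := by rw [hτ.sdiff_eq_singleton hT ht he]; rfl
  have h3 := (hσ.isEven.symmDiff hτ.isEven).eq_empty_of_isAcyclic hT (by
    rintro x (⟨hx, hx'⟩ | ⟨hx, hx'⟩)
    · exact (hs hx).resolve_left fun h => hx' (h ▸ h2.1)
    · exact (ht hx).resolve_left fun h => hx' (h ▸ h1.1))
  exact symmDiff_eq_bot.1 h3

theorem isTree_eq_of_le (hT : T.IsTree) (hS : S.IsTree) (h : T ≤ S) : T = S := by
  have := (SimpleGraph.isTree_iff_maximal_isAcyclic.1 hT).2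
  exact le_antisymm h (this.2 hS.isAcyclic h)

theorem exists_cycle_of_isTree {e : Sym2 V} (hT : T.IsTree) (he : ¬ e.IsDiag)
    (heT : e ∉ T.edgeSet) : ∃ σ, IsCycleOf (T ⊔ SimpleGraph.fromEdgeSet {e}) σ := by
  have hmax := (SimpleGraph.isTree_iff_maximal_isAcyclic.1 hT).2
  have hnot : ¬ (T ⊔ SimpleGraph.fromEdgeSet {e}).IsAcyclic := fun hac => by
    have h1 := hmax.2 hac le_sup_left
    have h2 : e ∈ (T ⊔ SimpleGraph.fromEdgeSet {e}).edgeSet := by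
      rw [edgeSet_sup_singleton he]; exact Or.inl rfl
    exact heT (SimpleGraph.edgeSet_mono h1 h2)
  simp only [SimpleGraph.IsAcyclic, not_forall, not_not] at hnot
  obtain ⟨v, w, hw⟩ := hnot
  exact ⟨_, v, w, hw, rfl⟩

/-- Adding `e` to `T` closes a cycle inside `T ∪ S`, which can only be `σ`. Since `σ` does not
depend on `e`, no other edge of `S` lies outside `T`. -/
theorem exchange_mem [Finite V] (hT : T.IsTree) (hσ : {τ | IsCycleOf (T ⊔ S) τ} = {σ})
    {e : Sym2 V} (heS : e ∈ S.edgeSet) (heT : e ∉ T.edgeSet) : σ \ T.edgeSet = {e} := by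
  have hd := S.not_isDiag_of_mem_edgeSet heS
  obtain ⟨τ, hτ⟩ := exists_cycle_of_isTree hT hd heT
  have hle : T ⊔ SimpleGraph.fromEdgeSet {e} ≤ T ⊔ S := by
    refine sup_le_sup_left ?_ _
    rw [SimpleGraph.fromEdgeSet_le]
    rintro x ⟨rfl, -⟩
    exact heS
  have : τ ∈ {τ | IsCycleOf (T ⊔ S) τ} := hτ.mono hle
  rw [hσ] at this
  cases this
  refine hτ.sdiff_eq_singleton hT.isAcyclic ?_ heT
  rw [← edgeSet_sup_singleton hd]
  exact hτ.subset_edgeSet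

/-- Adjacent vertices of the tree graph differ only inside a common fundamental cycle. -/
theorem treeGraph_adj_exchange [Finite V] {C : Set (Set (Sym2 V))} {T S : SpanningTree G}
    (h : (treeGraph G C).Adj T S) : ∃ σ ∈ C, IsFundamentalCycle G T.1 σ ∧
      T.1.edgeSet \ S.1.edgeSet ⊆ σ ∧ S.1.edgeSet \ T.1.edgeSet ⊆ σ := by
  have hne := h.ne
  obtain ⟨σ, hσC, hσ⟩ := h
  have hσ' : {τ | IsCycleOf (S.1 ⊔ T.1) τ} = {σ} := by rw [sup_comm]; exact hσ
  have hcyc : IsCycleOf (T.1 ⊔ S.1) σ := by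
    have : σ ∈ {τ | IsCycleOf (T.1 ⊔ S.1) τ} := by rw [hσ]; rfl
    exact this
  refine ⟨σ, hσC, ?_, ?_, ?_⟩
  · rw [isFundamentalCycle_iff T.2.2.isAcyclic T.2.1]
    refine ⟨hcyc.mono (sup_le T.2.1 S.2.1), ?_⟩
    have : ¬ S.1 ≤ T.1 := fun hle => hne (Subtype.ext (isTree_eq_of_le S.2.2 T.2.2 hle).symm)
    rw [← SimpleGraph.edgeSet_subset_edgeSet] at this
    obtain ⟨e, heS, heT⟩ := Set.not_subset.1 this
    exact ⟨e, exchange_mem T.2.2 hσ heS heT⟩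
  · rintro e ⟨heT, heS⟩
    have : e ∈ σ \ S.1.edgeSet := by rw [exchange_mem S.2.2 hσ' heT heS]; rfl
    exact this.1
  · rintro e ⟨heS, heT⟩
    have : e ∈ σ \ T.1.edgeSet := by rw [exchange_mem T.2.2 hσ heS heT]; rfl
    exact this.1

end EvenSets

/-! ### Combinatorial spheres: cycles as boundaries of face sets, removal of faces, cyclic spanning.
-/

section Dual

variable {V F : Type*}

/-- `A` is a union of components of the part of the dual graph induced on the set of faces `D`. -/
def IsClosedIn (bd : F → Set (Sym2 V)) (D A : Set F) : Prop :=
  A ⊆ D ∧ ∀ f ∈ A, ∀ g ∈ D, (bd f ∩ bd g).Nonempty → g ∈ A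

/-- The set of faces `D` is connected in the dual graph. -/
def DualConnected (bd : F → Set (Sym2 V)) (D : Set F) : Prop :=
  ∀ A, IsClosedIn bd D A → A.Nonempty → A = D

/-- The edges that separate a face in `D` from a face outside `D`. -/
def cut (G : SimpleGraph V) (bd : F → Set (Sym2 V)) (D : Set F) : Set (Sym2 V) :=
  {e | e ∈ G.edgeSet ∧ ∃ f g, f ∈ D ∧ g ∉ D ∧ e ∈ bd f ∧ e ∈ bd g}

/-- Faces bounded by cycles such that every edge lies on exactly two faces. -/
structure IsDoubleCover (G : SimpleGraph V) (bd : F → Set (Sym2 V)) : Prop where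
  two : ∀ e ∈ G.edgeSet, ∃ f g, f ≠ g ∧ ∀ h, e ∈ bd h ↔ h = f ∨ h = g
  cycle : ∀ f, IsCycleOf G (bd f)

/-- A combinatorial sphere: a double cover for which every even edge set bounds a set of faces,
and the dual graph is connected. -/
structure IsFaceSystem (G : SimpleGraph V) (bd : F → Set (Sym2 V)) : Prop
    extends IsDoubleCover G bd where
  span : ∀ τ ⊆ G.edgeSet, IsEven τ → ∃ D, τ = cut G bd D
  conn : DualConnected bd Set.univ

variable {G : SimpleGraph V} {bd : F → Set (Sym2 V)} {A B D : Set F}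

theorem IsClosedIn.sdiff (h : IsClosedIn bd D A) : IsClosedIn bd D (D \ A) := by
  refine ⟨Set.sdiff_subset, fun f hf g hg hfg => ⟨hg, fun hgA => hf.2 ?_⟩⟩
  rw [Set.inter_comm] at hfg
  exact h.2 g hgA f hf.1 hfg

theorem cut_compl : cut G bd Dᶜ = cut G bd D := by
  ext e
  constructor
  · rintro ⟨he, f, g, hf, hg, h1, h2⟩
    exact ⟨he, g, f, not_not.1 hg, hf, h2, h1⟩
  · rintro ⟨he, f, g, hf, hg, h1, h2⟩
    exact ⟨he, g, f, hg, not_not.2 hf, h2, h1⟩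

theorem cut_empty : cut G bd ∅ = ∅ := by
  ext e
  simp [cut]

theorem mem_cut_iff {e : Sym2 V} {f g : F} (he : e ∈ G.edgeSet)
    (h : ∀ x, e ∈ bd x ↔ x = f ∨ x = g) : e ∈ cut G bd D ↔ ¬ (f ∈ D ↔ g ∈ D) := by
  constructor
  · rintro ⟨-, x, y, hx, hy, h1, h2⟩ hiff
    rw [h] at h1 h2
    rcases h1 with rfl | rfl <;> rcases h2 with rfl | rfl <;> tauto
  · intro hn
    have hf := (h f).2 (Or.inl rfl)
    have hg := (h g).2 (Or.inr rfl)
    by_cases hfD : f ∈ D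
    · exact ⟨he, f, g, hfD, fun hgD => hn (by tauto), hf, hg⟩
    · exact ⟨he, g, f, by tauto, hfD, hg, hf⟩

namespace IsDoubleCover

variable (hS : IsDoubleCover G bd)
include hS

theorem cut_symmDiff : cut G bd (A ∆ B) = cut G bd A ∆ cut G bd B := by
  ext e
  by_cases he : e ∈ G.edgeSet
  · obtain ⟨f, g, -, h⟩ := hS.two e he
    rw [Set.mem_symmDiff, mem_cut_iff he h, mem_cut_iff he h, mem_cut_iff he h,
      Set.mem_symmDiff, Set.mem_symmDiff]
    tauto
  · rw [Set.mem_symmDiff]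
    exact ⟨fun h => absurd h.1 he, fun h => by rcases h with h | h <;> exact absurd h.1.1 he⟩

theorem cut_singleton (f : F) : cut G bd {f} = bd f := by
  ext e
  constructor
  · rintro ⟨-, x, y, rfl, -, h, -⟩
    exact h
  · intro h
    have he := (hS.cycle f).subset_edgeSet h
    obtain ⟨x, y, hxy, hh⟩ := hS.two e he
    rcases (hh f).1 h with rfl | rfl
    · exact ⟨he, f, y, rfl, hxy.symm, h, (hh y).2 (Or.inr rfl)⟩
    · exact ⟨he, f, x, rfl, hxy, h, (hh x).2 (Or.inl rfl)⟩

theorem isEven_cut [Finite V] [Finite F] (D : Set F) : IsEven (cut G bd D) := by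
  induction D, D.toFinite using Set.Finite.induction_on with
  | empty => rw [cut_empty]; exact isEven_empty
  | @insert f D hf _ ih =>
    have : insert f D = {f} ∆ D := by
      ext x
      simp only [Set.mem_insert_iff, Set.mem_symmDiff, Set.mem_singleton_iff]
      grind
    rw [this, hS.cut_symmDiff, hS.cut_singleton]
    exact (hS.cycle f).isEven.symmDiff ih

end IsDoubleCover

namespace IsFaceSystem

variable (hS : IsFaceSystem G bd)
include hS

theorem eq_of_cut_eq_empty (h : cut G bd D = ∅) : D = ∅ ∨ D = Set.univ := by
  by_cases hne : D.Nonempty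
  · refine Or.inr (hS.conn D ⟨Set.subset_univ _, fun f hf g _ hfg => ?_⟩ hne)
    by_contra hg
    obtain ⟨e, he1, he2⟩ := hfg
    have : e ∈ cut G bd D := ⟨(hS.cycle f).subset_edgeSet he1, f, g, hf, hg, he1, he2⟩
    rw [h] at this
    exact this
  · exact Or.inl (Set.not_nonempty_iff_eq_empty.1 hne)

omit hS in
theorem cut_subset_of_isClosedIn (h : IsClosedIn bd D A) : cut G bd A ⊆ cut G bd D := by
  rintro e ⟨he, f, g, hf, hg, h1, h2⟩
  exact ⟨he, f, g, h.1 hf, fun hgD => hg (h.2 f hf g hgD ⟨e, h1, h2⟩), h1, h2⟩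

/-- A closed part `A` of `D` has its boundary inside that of `D`, so the two boundaries agree by
minimality of cycles. Then `A ∆ D` has empty boundary and is empty or everything; the latter is
impossible because `A` is a nonempty part of `D`. -/
theorem dualConnected_of_isCycleOf [Finite V] [Finite F] (h : IsCycleOf G (cut G bd D)) :
    DualConnected bd D := by
  intro A hA hne
  by_contra hAD
  have h1 : cut G bd A = cut G bd D := by
    refine h.minimal (hS.isEven_cut A) ?_ (cut_subset_of_isClosedIn hA)
    rw [Set.nonempty_iff_ne_empty]
    intro h0
    rcases hS.eq_of_cut_eq_empty h0 with rfl | rfl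
    · exact Set.not_nonempty_empty hne
    · exact hAD (hA.1.antisymm (Set.subset_univ _))
  have h2 : cut G bd (A ∆ D) = ∅ := by rw [hS.cut_symmDiff, h1, symmDiff_self]; rfl
  rcases hS.eq_of_cut_eq_empty h2 with h0 | h0
  · exact hAD (symmDiff_eq_bot.1 h0)
  · obtain ⟨a, ha⟩ := hne
    have : a ∈ A ∆ D := h0 ▸ Set.mem_univ a
    rcases this with ⟨-, h⟩ | ⟨-, h⟩
    · exact h (hA.1 ha)
    · exact h ha

-- An edge between two faces of `D` is not in the boundary of `D`, hence not in that of `A`. So `A`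
-- cannot split the connected set `D`.
omit hS in
theorem inter_eq_of_cut_subset (hD : DualConnected bd D) (hs : cut G bd A ⊆ cut G bd D)
    (hG : ∀ f, bd f ⊆ G.edgeSet) (htwo : ∀ e ∈ G.edgeSet, ∃ f g, f ≠ g ∧ ∀ h, e ∈ bd h ↔
      h = f ∨ h = g) : A ∩ D = ∅ ∨ A ∩ D = D := by
  by_cases hne : (A ∩ D).Nonempty
  · refine Or.inr (hD _ ⟨Set.inter_subset_right, fun f hf g hg hfg => ⟨?_, hg⟩⟩ hne)
    by_contra hgA
    obtain ⟨e, he1, he2⟩ := hfg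
    have he := hG f he1
    have : e ∈ cut G bd D := hs ⟨he, f, g, hf.1, hgA, he1, he2⟩
    obtain ⟨x, y, hxy, hh⟩ := htwo e he
    have hfg : f ≠ g := fun h => hgA (h ▸ hf.1)
    rw [mem_cut_iff he hh] at this
    have hf2 := hf.2
    rcases (hh f).1 he1 with rfl | rfl <;> rcases (hh g).1 he2 with rfl | rfl <;> tauto
  · exact Or.inl (Set.not_nonempty_iff_eq_empty.1 hne)

/-- A smaller even set is the boundary of some `A` that splits neither `D` nor its complement. This
leaves `∅`, `D`, `Dᶜ` and everything, of which only `D` and `Dᶜ` have nonempty boundary. -/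
theorem isCycleOf_cut [Finite V] [Finite F] (hne : D.Nonempty) (hne' : Dᶜ.Nonempty)
    (hD : DualConnected bd D) (hD' : DualConnected bd Dᶜ) : IsCycleOf G (cut G bd D) := by
  have hG : ∀ f, bd f ⊆ G.edgeSet := fun f => (hS.cycle f).subset_edgeSet
  rw [isCycleOf_iff_minimal]
  refine ⟨fun e he => he.1, hS.isEven_cut D, ?_, fun τ hs he hτ => ?_⟩
  · rw [Set.nonempty_iff_ne_empty]
    intro h0
    rcases hS.eq_of_cut_eq_empty h0 with rfl | rfl
    · exact Set.not_nonempty_empty hne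
    · simp at hne'
  · obtain ⟨A, rfl⟩ := hS.span τ (fun e h => (hs h).1) he
    have h1 := inter_eq_of_cut_subset hD hs hG hS.two
    have h2 := inter_eq_of_cut_subset (A := A) (D := Dᶜ) hD' (by rw [cut_compl]; exact hs) hG hS.two
    have hA : A = (A ∩ D) ∪ (A ∩ Dᶜ) := (Set.inter_union_compl A D).symm
    rcases h1 with h1 | h1 <;> rcases h2 with h2 | h2 <;> rw [h1, h2] at hA
    · rw [hA, Set.union_empty, cut_empty] at hτ
      exact absurd hτ Set.not_nonempty_empty
    · rw [hA, Set.empty_union, cut_compl]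
    · rw [hA, Set.union_empty]
    · rw [hA, Set.union_compl_self, ← cut_compl, Set.compl_univ, cut_empty] at hτ
      exact absurd hτ Set.not_nonempty_empty

theorem dualConnected_compl_singleton [Finite V] [Finite F] (f : F) : DualConnected bd {f}ᶜ := by
  refine hS.dualConnected_of_isCycleOf ?_
  rw [cut_compl, hS.cut_singleton]
  exact hS.cycle f

/-- A connected set of faces can be made smaller by a face on its boundary, different from a
prescribed face, without becoming disconnected. -/
theorem exists_removable [Finite V] [Finite F] {t₀ : F} (hD : DualConnected bd D) (ht₀ : t₀ ∈ D)
    (hne : (D \ {t₀}).Nonempty) (hne' : Dᶜ.Nonempty) :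
    ∃ t ∈ D, t ≠ t₀ ∧ (∃ g ∉ D, (bd t ∩ bd g).Nonempty) ∧ DualConnected bd (D \ {t}) := by
  by_contra! hcon
  -- Descent on the size of a piece `K` that is separated from `t₀` by the removal of `t`. Some `t'`
  -- in `K` lies on the boundary of `D`, and if its removal disconnects `D`, it cuts off a strictly
  -- smaller piece within `K`.
  have key : ∀ m : ℕ, ∀ t ∈ D, ∀ K : Set F, IsClosedIn bd (D \ {t}) K → K.Nonempty → t₀ ∉ K →
      K.ncard = m → False := by
    intro m
    induction m using Nat.strong_induction_on with
    | _ m ih =>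
    intro t ht K hK hKne hKt₀ hcard
    have hbdry : ∃ t' ∈ K, ∃ g ∉ D, (bd t' ∩ bd g).Nonempty := by
      by_contra! hno
      obtain ⟨o, ho⟩ := hne'
      -- If `K` did not touch the outside of `D`, it would be a proper closed part of the sphere
      -- minus the face `t`, which is connected.
      have hcl : IsClosedIn bd {t}ᶜ K := by
        refine ⟨fun x hx => (hK.1 hx).2, fun f hf g hg hfg => ?_⟩
        by_cases hgD : g ∈ D
        · exact hK.2 f hf g ⟨hgD, hg⟩ hfg
        · rw [hno f hf g hgD] at hfg
          exact absurd hfg Set.not_nonempty_empty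
      have h1 := hS.dualConnected_compl_singleton t K hcl hKne
      have : o ∈ K := by
        rw [h1]
        rintro rfl
        exact ho ht
      exact ho (hK.1 this).1
    obtain ⟨t', ht'K, g, hg, htg⟩ := hbdry
    have ht'D : t' ∈ D := (hK.1 ht'K).1
    have hnc := hcon t' ht'D (fun h => hKt₀ (h ▸ ht'K)) ⟨g, hg, htg⟩
    have hexA : ∃ A, IsClosedIn bd (D \ {t'}) A ∧ A.Nonempty ∧ t ∉ A := by
      unfold DualConnected at hnc
      push Not at hnc
      obtain ⟨A, hA, hAne, hAD⟩ := hnc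
      by_cases htA : t ∈ A
      · refine ⟨(D \ {t'}) \ A, hA.sdiff, ?_, fun h => h.2 htA⟩
        rw [Set.nonempty_iff_ne_empty]
        intro h0
        rw [Set.sdiff_eq_empty] at h0
        exact hAD (hA.1.antisymm h0)
      · exact ⟨A, hA, hAne, htA⟩
    obtain ⟨A, hA, hAne, htA⟩ := hexA
    have hAK : A ⊆ K := by
      by_contra hns
      -- Since `t ∉ A`, a face of `A \ K` has no neighbour in `K`, in particular not `t'`. So `A \
      -- K` would be closed in the connected set `D` and would contain `t`.
      have hcl : IsClosedIn bd D (A \ K) := by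
        refine ⟨fun x hx => (hA.1 hx.1).1, fun f hf g hg hfg => ?_⟩
        have hgK : g ∉ K := fun hgK => by
          rw [Set.inter_comm] at hfg
          exact hf.2 (hK.2 g hgK f ⟨(hA.1 hf.1).1, fun h => htA (h ▸ hf.1)⟩ hfg)
        exact ⟨hA.2 f hf.1 g ⟨hg, fun h => hgK (h ▸ ht'K)⟩ hfg, hgK⟩
      have h1 := hD _ hcl (by
        obtain ⟨x, hx, hxK⟩ := Set.not_subset.1 hns
        exact ⟨x, hx, hxK⟩)
      rw [← h1] at ht
      exact htA ht.1
    have hlt : A.ncard < m := by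
      rw [← hcard]
      refine Set.ncard_lt_ncard ⟨hAK, fun h => ?_⟩ (Set.toFinite _)
      exact (hA.1 (h ht'K)).2 rfl
    exact ih _ hlt t' ht'D A hA hAne (fun h => hKt₀ (hAK h)) rfl
  exact key _ t₀ ht₀ (D \ {t₀}) ⟨subset_rfl, fun _ _ g hg _ => hg⟩ hne (fun h => h.2 rfl) rfl

omit hS in
theorem dualConnected_insert {t : F} (hD : DualConnected bd D)
    (h : ∃ g ∈ D, (bd t ∩ bd g).Nonempty) : DualConnected bd (insert t D) := by
  obtain ⟨g, hg, hgt⟩ := h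
  intro A hA hne
  have hcl : IsClosedIn bd D (A ∩ D) :=
    ⟨Set.inter_subset_right, fun x hx y hy hxy => ⟨hA.2 x hx.1 y (Or.inr hy) hxy, hy⟩⟩
  have hAD : (A ∩ D).Nonempty := by
    obtain ⟨x, hx⟩ := hne
    rcases hA.1 hx with rfl | hxD
    · exact ⟨g, hA.2 x hx g (Or.inr hg) hgt, hg⟩
    · exact ⟨x, hx, hxD⟩
  have hDA : D ⊆ A := by
    have := hD _ hcl hAD
    rw [← this]
    exact Set.inter_subset_left
  refine hA.1.antisymm ?_
  rintro x (rfl | hx)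
  · refine hA.2 g (hDA hg) x (Or.inl rfl) ?_
    rwa [Set.inter_comm]
  · exact hDA hx

end IsFaceSystem

/-- `σ` is a sum of members of `C` in which the partial sums after the first are cycles. -/
inductive IsCyclicSum (G : SimpleGraph V) (C : Set (Set (Sym2 V))) : Set (Sym2 V) → Prop
  | base {σ} : σ ∈ C → IsCyclicSum G C σ
  | step {σ τ} : IsCyclicSum G C σ → τ ∈ C → IsCycleOf G (σ ∆ τ) → IsCyclicSum G C (σ ∆ τ)

theorem partialSum_congr {a b : ℕ → Set (Sym2 V)} {m : ℕ} (h : ∀ i ≤ m, a i = b i) :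
    partialSum a m = partialSum b m := by
  induction m with
  | zero => exact h 0 le_rfl
  | succ m ih => rw [partialSum, partialSum, ih fun i hi => h i (by omega), h (m + 1) le_rfl]

theorem IsCyclicSum.exists_partialSum {C : Set (Set (Sym2 V))} {σ : Set (Sym2 V)}
    (h : IsCyclicSum G C σ) : ∃ (m : ℕ) (a : ℕ → Set (Sym2 V)), (∀ i ≤ m, a i ∈ C) ∧
      (∀ i, 1 ≤ i → i ≤ m → IsCycleOf G (partialSum a i)) ∧ partialSum a m = σ := by
  induction h with
  | @base σ hσ => exact ⟨0, fun _ => σ, fun _ _ => hσ, fun i h1 h2 => by omega, rfl⟩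
  | @step σ τ _ hτ hc ih =>
    obtain ⟨m, a, h1, h2, h3⟩ := ih
    have hlow : ∀ i ≤ m, partialSum (fun j => if j ≤ m then a j else τ) i = partialSum a i :=
      fun i hi => partialSum_congr fun j hj => if_pos (hj.trans hi)
    have htop : partialSum (fun j => if j ≤ m then a j else τ) (m + 1) = σ ∆ τ := by
      rw [partialSum, hlow m le_rfl, h3]
      simp
    refine ⟨m + 1, fun j => if j ≤ m then a j else τ, fun i _ => ?_, fun i hi1 hi2 => ?_, htop⟩
    · beta_reduce
      split_ifs with hi
      · exact h1 i hi
      · exact hτ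
    · rcases hi2.lt_or_eq with hi | rfl
      · rw [hlow i (by omega)]
        exact h2 i hi1 (by omega)
      · rw [htop]
        exact hc

/-- The cycles bounding the faces other than `o`, with one of them, `a`, replaced by its sum with
another, cyclically span the cycle space. -/
theorem IsFaceSystem.cyclicallySpans [Finite V] [Finite F] (hS : IsFaceSystem G bd) {o a b : F}
    {C : Set (Set (Sym2 V))} (hC : ∀ f, f ≠ o → f ≠ a → bd f ∈ C) (hab : bd a ∆ bd b ∈ C)
    (hbo : b ≠ o) (hba : b ≠ a) : CyclicallySpans G C := by
  classical
  have key : ∀ m : ℕ, ∀ D : Set F, D.ncard = m → D.Nonempty → o ∉ D → DualConnected bd D →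
      DualConnected bd Dᶜ → IsCyclicSum G C (cut G bd D) := by
    intro m
    induction m with
    | zero =>
      intro D h0 hne
      rw [Set.ncard_eq_zero] at h0
      exact absurd hne (Set.not_nonempty_iff_eq_empty.2 h0)
    | succ m ih =>
    intro D hcard hne ho hD hD'
    have hDc : Dᶜ.Nonempty := ⟨o, ho⟩
    -- The protected face is `a` whenever `a` is present, so `a` is never the face removed in the
    -- inductive step.
    obtain ⟨t₀, ht₀, hat⟩ : ∃ t₀ ∈ D, a ∈ D → t₀ = a := by
      by_cases ha : a ∈ D
      · exact ⟨a, ha, fun _ => rfl⟩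
      · obtain ⟨t, ht⟩ := hne
        exact ⟨t, ht, fun h => absurd h ha⟩
    by_cases hsing : (D \ {t₀}).Nonempty
    · obtain ⟨t, htD, htt₀, ⟨g, hgD, htg⟩, hDt⟩ := hS.exists_removable hD ht₀ hsing hDc
      have hta : t ≠ a := fun h => htt₀ (h.trans (hat (h ▸ htD)).symm)
      have hsum : cut G bd D = cut G bd (D \ {t}) ∆ bd t := by
        rw [← hS.cut_singleton, ← hS.cut_symmDiff]
        congr 1
        ext x
        simp only [Set.mem_symmDiff, Set.mem_sdiff, Set.mem_singleton_iff]
        grind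
      have hcyc := hS.isCycleOf_cut hne hDc hD hD'
      have hcompl : (D \ {t})ᶜ = insert t Dᶜ := by
        ext x
        simp only [Set.mem_compl_iff, Set.mem_sdiff, Set.mem_singleton_iff, Set.mem_insert_iff]
        grind
      have h1 := ih (D \ {t}) (by rw [Set.ncard_sdiff_singleton_of_mem htD]; omega)
        ⟨t₀, ht₀, htt₀.symm⟩ (fun h => ho h.1) hDt
        (by rw [hcompl]; exact dualConnected_insert hD' ⟨g, hgD, htg⟩)
      rw [hsum] at hcyc ⊢
      exact .step h1 (hC t (fun h => ho (h ▸ htD)) hta) hcyc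
    · have hDt : D = {t₀} := by
        rw [Set.not_nonempty_iff_eq_empty, Set.sdiff_eq_empty] at hsing
        exact hsing.antisymm (Set.singleton_subset_iff.2 ht₀)
      subst hDt
      rw [hS.cut_singleton]
      by_cases ha : t₀ = a
      · subst ha
        -- The boundary of `a` is not assumed to be in `C`; it is reached in two steps from the
        -- modified member.
        have h1 : (bd t₀ ∆ bd b) ∆ bd b = bd t₀ := symmDiff_symmDiff_cancel_right _ _
        rw [← h1]
        exact .step (.base hab) (hC b hbo hba) (by rw [h1]; exact hS.cycle t₀)
      · exact .base (hC t₀ (fun h => ho h.symm) ha)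
  intro σ hσ
  refine IsCyclicSum.exists_partialSum ?_
  obtain ⟨D, rfl⟩ := hS.span σ hσ.subset_edgeSet hσ.isEven
  have h1 := hS.dualConnected_of_isCycleOf hσ
  have h2 := hS.dualConnected_of_isCycleOf (D := Dᶜ) (by rw [cut_compl]; exact hσ)
  have hne : D.Nonempty := by
    rw [Set.nonempty_iff_ne_empty]
    rintro rfl
    have := hσ.nonempty
    rw [cut_empty] at this
    exact Set.not_nonempty_empty this
  have hne' : Dᶜ.Nonempty := by
    rw [Set.nonempty_iff_ne_empty]
    intro h
    have := hσ.nonempty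
    rw [← cut_compl, h, cut_empty] at this
    exact Set.not_nonempty_empty this
  by_cases ho : o ∈ D
  · rw [← cut_compl]
    exact key _ Dᶜ rfl hne' (fun h => h ho) h2 (by rwa [compl_compl])
  · exact key _ D rfl hne ho h1 h2

end Dual

/-! ### The faces of the nested octahedra form a sphere. -/

section Octahedra

variable {n : ℕ}

theorem fin3_cases {i j m : Fin 3} (hij : i ≠ j) (him : i ≠ m) (hjm : j ≠ m) (c : Fin 3) :
    c = i ∨ c = j ∨ c = m := by
  revert i j m c; decide

theorem exists_third {i j : Fin 3} (hij : i ≠ j) : ∃ m, i ≠ m ∧ j ≠ m := by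
  revert i j; decide

/-- The triangle with vertices in layers `a`, `b`, `c`, one of each index, is a face of the
nested octahedra with outermost layer `N`. -/
def IsFaceTriple (N a b c : ℕ) : Prop :=
  a ≤ b + 1 ∧ b ≤ a + 1 ∧ a ≤ c + 1 ∧ c ≤ a + 1 ∧ b ≤ c + 1 ∧ c ≤ b + 1 ∧
    (a = b → b = c → a = 0 ∨ a = N)

/-- The triangle of `f` is a face, possibly the outer one. -/
def IsFace (f : Fin 3 → Fin (n + 2)) : Prop := IsFaceTriple (n + 1) (f 0) (f 1) (f 2)

/-- `IsFaceTriple` is symmetric in the three layers, so the vertices may be listed in any order. -/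
theorem isFace_iff {i j m : Fin 3} (hij : i ≠ j) (him : i ≠ m) (hjm : j ≠ m)
    (f : Fin 3 → Fin (n + 2)) : IsFace f ↔ IsFaceTriple (n + 1) (f i) (f j) (f m) := by
  unfold IsFace IsFaceTriple
  fin_cases i <;> fin_cases j <;> first | exact absurd rfl hij | skip
  all_goals fin_cases m <;> first | exact absurd rfl him | exact absurd rfl hjm | skip
  all_goals simp only [Fin.zero_eta, Fin.mk_one, Fin.reduceFinMk] <;> omega

theorem mem_triangle_iff {f : Fin 3 → Fin (n + 2)} {u v : Vert n} :
    s(u, v) ∈ triangle f ↔ u.2 ≠ v.2 ∧ f u.2 = u.1 ∧ f v.2 = v.1 := by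
  obtain ⟨k, i⟩ := u
  obtain ⟨l, j⟩ := v
  constructor
  · rintro ⟨a, b, hab, h⟩
    rw [Sym2.eq_iff] at h
    rcases h with ⟨h1, h2⟩ | ⟨h1, h2⟩ <;> cases h1 <;> cases h2
    · exact ⟨hab, rfl, rfl⟩
    · exact ⟨hab.symm, rfl, rfl⟩
  · rintro ⟨h, h1, h2⟩
    exact ⟨i, j, h, by simp only at h1 h2; rw [h1, h2]⟩

theorem triangle_eq {i j m : Fin 3} (hij : i ≠ j) (him : i ≠ m) (hjm : j ≠ m)
    (f : Fin 3 → Fin (n + 2)) : triangle f =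
      {s((f i, i), (f j, j)), s((f i, i), (f m, m)), s((f j, j), (f m, m))} := by
  ext e
  simp only [Set.mem_insert_iff, Set.mem_singleton_iff]
  constructor
  · rintro ⟨a, b, hab, rfl⟩
    rcases fin3_cases hij him hjm a with rfl | rfl | rfl <;>
      rcases fin3_cases hij him hjm b with rfl | rfl | rfl <;> simp_all [Sym2.eq_swap]
  · rintro (rfl | rfl | rfl) <;> rw [mem_triangle_iff] <;> simp [*]

theorem triangle_injective : Function.Injective (triangle (n := n)) := by
  intro f g h
  have key : ∀ i j : Fin 3, i ≠ j → g i = f i := by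
    intro i j hij
    have : s((f i, i), (f j, j)) ∈ triangle f := mem_triangle_iff.2 ⟨hij, rfl, rfl⟩
    rw [h] at this
    exact (mem_triangle_iff.1 this).2.1
  funext i
  obtain ⟨j, hj⟩ : ∃ j, i ≠ j := (exists_ne i).imp fun _ h => h.symm
  exact (key i j hj).symm

theorem nestedOctahedra_adj {u v : Vert n} : (nestedOctahedra n).Adj u v ↔
    u.2 ≠ v.2 ∧ u.1.val ≤ v.1.val + 1 ∧ v.1.val ≤ u.1.val + 1 := Iff.rfl

theorem IsFace.adj {f : Fin 3 → Fin (n + 2)} (hf : IsFace f) {i j : Fin 3} (hij : i ≠ j) :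
    (nestedOctahedra n).Adj (f i, i) (f j, j) := by
  obtain ⟨m, him, hjm⟩ := exists_third hij
  rw [isFace_iff hij him hjm] at hf
  exact ⟨hij, hf.1, hf.2.1⟩

theorem IsFace.isCycleOf {f : Fin 3 → Fin (n + 2)} (hf : IsFace f) :
    IsCycleOf (nestedOctahedra n) (triangle f) := by
  have h01 : (nestedOctahedra n).Adj (f 0, 0) (f 1, 1) := hf.adj (by decide)
  have h12 : (nestedOctahedra n).Adj (f 1, 1) (f 2, 2) := hf.adj (by decide)
  have h20 : (nestedOctahedra n).Adj (f 2, 2) (f 0, 0) := hf.adj (by decide)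
  refine ⟨_, .cons h01 (.cons h12 (.cons h20 .nil)), ?_, ?_⟩
  · rw [SimpleGraph.Walk.cons_isCycle_iff]
    simp
  · rw [triangle_eq (i := 0) (j := 1) (m := 2) (by decide) (by decide) (by decide)]
    ext e
    simp only [Set.mem_insert_iff, Set.mem_singleton_iff, Set.mem_ofPred_eq,
      SimpleGraph.Walk.edges_cons, SimpleGraph.Walk.edges_nil, List.mem_cons, List.not_mem_nil,
      or_false, Sym2.eq_swap (a := (f 2, (2 : Fin 3)))]
    tauto

/-- The faces of `G n`, the outer one included. -/
abbrev FaceIndex (n : ℕ) : Type := {f : Fin 3 → Fin (n + 2) // IsFace f}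

/-- The boundary of a face. -/
def bdry (f : FaceIndex n) : Set (Sym2 (Vert n)) := triangle f.1

/-- For an edge between two layers the third vertex lies in either of them. For an edge within a
layer it lies one layer below or above, where a missing layer at either end is replaced by the layer
itself (the innermost and the outer face). -/
theorem exists_third_layers {N k l : ℕ} (hN : 1 ≤ N) (hk : k ≤ N) (hl : l ≤ N) (h1 : k ≤ l + 1)
    (h2 : l ≤ k + 1) : ∃ p q, p ≤ N ∧ q ≤ N ∧ p ≠ q ∧
      ∀ r ≤ N, IsFaceTriple N k l r ↔ r = p ∨ r = q := by
  unfold IsFaceTriple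
  by_cases hkl : k = l
  · by_cases h0 : k = 0
    · exact ⟨0, 1, by omega, by omega, by omega, fun r hr => by omega⟩
    · by_cases hn : k = N
      · exact ⟨N - 1, N, by omega, by omega, by omega, fun r hr => by omega⟩
      · exact ⟨k - 1, k + 1, by omega, by omega, by omega, fun r hr => by omega⟩
  · exact ⟨k, l, hk, hl, hkl, fun r hr => by omega⟩

theorem exists_two_faces {e : Sym2 (Vert n)} (he : e ∈ (nestedOctahedra n).edgeSet) :
    ∃ f g : FaceIndex n, f ≠ g ∧ ∀ h, e ∈ bdry h ↔ h = f ∨ h = g := by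
  induction e with | _ u v
  obtain ⟨k, i⟩ := u
  obtain ⟨l, j⟩ := v
  obtain ⟨hij, h1, h2⟩ := nestedOctahedra_adj.1 he
  simp only at hij h1 h2
  obtain ⟨m, him, hjm⟩ := exists_third hij
  obtain ⟨p, q, hp, hq, hpq, hr⟩ := exists_third_layers (N := n + 1) (by omega)
    (Nat.lt_succ_iff.1 k.2) (Nat.lt_succ_iff.1 l.2) h1 h2
  let F : ℕ → Fin 3 → Fin (n + 2) := fun r c =>
    if c = i then k else if c = j then l else Fin.ofNat _ r
  have hFi : ∀ r, F r i = k := fun r => if_pos rfl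
  have hFj : ∀ r, F r j = l := fun r => by simp [F, hij.symm]
  have hFm : ∀ r ≤ n + 1, (F r m).val = r := fun r hr => by
    simp [F, him.symm, hjm.symm, Nat.mod_eq_of_lt (by omega : r < n + 2)]
  have hface : ∀ r ≤ n + 1, r = p ∨ r = q → IsFace (F r) := fun r hrn h => by
    rw [isFace_iff hij him hjm, hFi, hFj, hFm r hrn]
    exact (hr r hrn).2 h
  refine ⟨⟨F p, hface p hp (Or.inl rfl)⟩, ⟨F q, hface q hq (Or.inr rfl)⟩, fun h => hpq ?_,
    fun h => ?_⟩
  · rw [← hFm p hp, ← hFm q hq]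
    rw [Subtype.mk.injEq] at h
    rw [h]
  · obtain ⟨f, hf⟩ := h
    simp only [bdry, Subtype.mk.injEq]
    rw [mem_triangle_iff]
    constructor
    · rintro ⟨-, hfi, hfj⟩
      simp only at hfi hfj
      rw [isFace_iff hij him hjm, hfi, hfj, hr _ (Nat.lt_succ_iff.1 (f m).2)] at hf
      have hext : ∀ r ≤ n + 1, (f m).val = r → f = F r := by
        intro r hrn h
        funext c
        rcases fin3_cases hij him hjm c with rfl | rfl | rfl
        · rw [hFi, hfi]
        · rw [hFj, hfj]
        · exact Fin.ext (by rw [hFm r hrn, h])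
      exact hf.imp (hext p hp) (hext q hq)
    · rintro (rfl | rfl) <;> exact ⟨hij, hFi _, hFj _⟩

theorem isDoubleCover_bdry : IsDoubleCover (nestedOctahedra n) (bdry (n := n)) :=
  ⟨fun _ he => exists_two_faces he, fun f => f.2.isCycleOf⟩

/-- A weight on edges, which depends on the lower of the two layers. -/
def edgeWeight (n : ℕ) : Sym2 (Vert n) → ℕ :=
  Sym2.lift ⟨fun u v => 4 ^ min u.1.val v.1.val, fun _ _ => congrArg (4 ^ ·) (min_comm _ _)⟩

open Classical in
/-- The weight of a set of edges. -/
noncomputable def setWeight (τ : Set (Sym2 (Vert n))) : ℕ :=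
  ∑ e, if e ∈ τ then edgeWeight n e else 0

theorem setWeight_symmDiff (σ τ : Set (Sym2 (Vert n))) :
    setWeight (σ ∆ τ) + 2 * setWeight (σ ∩ τ) = setWeight σ + setWeight τ := by
  unfold setWeight
  rw [Finset.mul_sum, ← Finset.sum_add_distrib, ← Finset.sum_add_distrib]
  refine Finset.sum_congr rfl fun e _ => ?_
  by_cases h1 : e ∈ σ <;> by_cases h2 : e ∈ τ <;> simp [h1, h2, Set.mem_symmDiff] <;> omega

theorem setWeight_mono {σ τ : Set (Sym2 (Vert n))} (h : σ ⊆ τ) : setWeight σ ≤ setWeight τ := by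
  refine Finset.sum_le_sum fun e _ => ?_
  by_cases h1 : e ∈ σ
  · simp [h1, h h1]
  · simp [h1]

theorem setWeight_insert_le (e : Sym2 (Vert n)) (σ : Set (Sym2 (Vert n))) :
    setWeight (insert e σ) ≤ edgeWeight n e + setWeight σ := by
  classical
  unfold setWeight
  have : edgeWeight n e = ∑ x, if x = e then edgeWeight n x else 0 := by simp
  rw [this, ← Finset.sum_add_distrib]
  refine Finset.sum_le_sum fun x _ => ?_
  by_cases h1 : x = e <;> by_cases h2 : x ∈ σ <;> simp [h1, h2]

theorem setWeight_singleton (e : Sym2 (Vert n)) : setWeight {e} = edgeWeight n e := by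
  simp [setWeight]

theorem setWeight_pair {e e' : Sym2 (Vert n)} (h : e ≠ e') :
    setWeight {e, e'} = edgeWeight n e + edgeWeight n e' := by
  classical
  have h1 := setWeight_symmDiff {e} {e'}
  have h2 : ({e} : Set (Sym2 (Vert n))) ∩ {e'} = ∅ := by simpa using h.symm
  have h3 : ({e} : Set (Sym2 (Vert n))) ∆ {e'} = {e, e'} := by
    ext x; simp only [Set.mem_symmDiff, Set.mem_singleton_iff, Set.mem_insert_iff]; grind
  rw [h2, h3, setWeight_singleton, setWeight_singleton] at h1
  simpa [setWeight] using h1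

theorem setWeight_triangle_le {i j m : Fin 3} (hij : i ≠ j) (him : i ≠ m) (hjm : j ≠ m)
    (f : Fin 3 → Fin (n + 2)) : setWeight (triangle f) ≤
      4 ^ min (f i).val (f j).val + 4 ^ min (f i).val (f m).val +
        4 ^ min (f j).val (f m).val := by
  rw [triangle_eq hij him hjm]
  refine (setWeight_insert_le _ _).trans ?_
  rw [add_assoc]
  refine Nat.add_le_add le_rfl ((setWeight_insert_le _ _).trans ?_)
  rw [setWeight_singleton]
  exact le_rfl

/-- The symmetric difference with a face that has two thirds of its weight in the set decreases
the weight. -/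
theorem exists_face_setWeight_lt {τ : Set (Sym2 (Vert n))} (hτ : IsEven τ) {v u : Vert n}
    (hG : τ ⊆ (nestedOctahedra n).edgeSet) (huv : s(v, u) ∈ τ) (hv : v.1.val ≠ 0)
    (hmax : ∀ x y, s(x, y) ∈ τ → x.1.val ≤ v.1.val) :
    ∃ f, IsFace f ∧ setWeight (τ ∆ triangle f) < setWeight τ := by
  suffices h : ∃ f : Fin 3 → Fin (n + 2), IsFace f ∧
      setWeight (triangle f) < 2 * setWeight (τ ∩ triangle f) by
    obtain ⟨f, hf, h⟩ := h
    have := setWeight_symmDiff τ (triangle f)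
    exact ⟨f, hf, by omega⟩
  have hlayer : ∀ w, s(v, w) ∈ τ → w.1 = v.1 → ∃ f : Fin 3 → Fin (n + 2), IsFace f ∧
      setWeight (triangle f) < 2 * setWeight (τ ∩ triangle f) := by
    rintro ⟨l, j⟩ hw hl
    obtain ⟨k, i⟩ := v
    simp only at hl hv
    subst hl
    obtain ⟨hij, -, -⟩ := nestedOctahedra_adj.1 (hG hw)
    simp only at hij
    obtain ⟨m, him, hjm⟩ := exists_third hij
    obtain ⟨k', hk'⟩ := Nat.exists_eq_succ_of_ne_zero hv
    -- Complete the edge by a vertex one layer further in. With `q = 4 ^ k'` the triangle weighs at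
    -- most `4q + q + q`, less than twice the `4q` of the edge; any base above 2 would do.
    let f : Fin 3 → Fin (n + 2) := fun c => if c = m then ⟨k', by omega⟩ else l
    have hfi : f i = l := if_neg him
    have hfj : f j = l := if_neg hjm
    have hfm : (f m).val = k' := by simp [f]
    refine ⟨f, ?_, ?_⟩
    · rw [isFace_iff hij him hjm, hfi, hfj, hfm]
      unfold IsFaceTriple
      omega
    · have h1 := setWeight_triangle_le hij him hjm f
      have h2 : setWeight {s((l, i), (l, j))} ≤ setWeight (τ ∩ triangle f) := by
        refine setWeight_mono (Set.singleton_subset_iff.2 ⟨hw, ?_⟩)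
        exact mem_triangle_iff.2 ⟨hij, hfi, hfj⟩
      rw [setWeight_singleton] at h2
      simp only [edgeWeight, Sym2.lift_mk] at h2
      rw [hfi, hfj, hfm, hk'] at h1
      rw [hk'] at h2
      simp only [min_self, Nat.succ_eq_add_one, Nat.le_add_right, min_eq_right, pow_succ] at h1 h2
      have : 0 < 4 ^ k' := by positivity
      omega
  obtain ⟨w, hwu, hw⟩ := hτ.exists_ne huv
  by_cases hu1 : u.1 = v.1
  · exact hlayer u huv hu1
  by_cases hw1 : w.1 = v.1
  · exact hlayer w hw hw1
  have hu2 := hmax u v (by rwa [Sym2.eq_swap])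
  have hw2 := hmax w v (by rwa [Sym2.eq_swap])
  obtain ⟨k, i⟩ := v
  obtain ⟨l, j⟩ := u
  obtain ⟨l', m⟩ := w
  obtain ⟨hij, hlk, -⟩ := nestedOctahedra_adj.1 (hG huv)
  obtain ⟨him, hlk', -⟩ := nestedOctahedra_adj.1 (hG hw)
  simp only at *
  have hl : l.val + 1 = k.val := by omega
  have hl' : l' = l := by omega
  subst hl'
  have hjm : j ≠ m := fun h => hwu (by rw [h])
  -- Now two edges descend from the topmost vertex. They span a face with three edges of equal
  -- weight, two of which are in `τ`.
  let f : Fin 3 → Fin (n + 2) := fun c => if c = i then k else l'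
  have hfi : f i = k := if_pos rfl
  have hfj : f j = l' := if_neg hij.symm
  have hfm : f m = l' := if_neg him.symm
  refine ⟨f, ?_, ?_⟩
  · rw [isFace_iff hij him hjm, hfi, hfj, hfm]
    unfold IsFaceTriple
    omega
  · have h1 := setWeight_triangle_le hij him hjm f
    have h2 : setWeight {s((k, i), (l', j)), s((k, i), (l', m))} ≤ setWeight (τ ∩ triangle f) := by
      refine setWeight_mono ?_
      rintro x (rfl | rfl)
      · exact ⟨huv, mem_triangle_iff.2 ⟨hij, hfi, hfj⟩⟩
      · exact ⟨hw, mem_triangle_iff.2 ⟨him, hfi, hfm⟩⟩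
    rw [setWeight_pair (fun h => (Sym2.eq_iff.1 h).elim (fun h => hjm (congrArg Prod.snd h.2))
      fun h => him (congrArg Prod.snd h.1))] at h2
    simp only [edgeWeight, Sym2.lift_mk] at h2
    rw [hfi, hfj, hfm, ← hl] at h1
    rw [← hl] at h2
    simp only [min_self, Nat.le_add_right, min_eq_right] at h1 h2
    have : 0 < 4 ^ l'.val := by positivity
    omega

/-- Adding faces that lower the weight pushes an even set inwards until it is empty or lies in the
innermost triangle, where minimality of that cycle finishes. -/
theorem eq_cut_of_isEven {τ : Set (Sym2 (Vert n))} (hG : τ ⊆ (nestedOctahedra n).edgeSet)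
    (hτ : IsEven τ) : ∃ D, τ = cut (nestedOctahedra n) bdry D := by
  induction h : setWeight τ using Nat.strong_induction_on generalizing τ with
  | _ N ih =>
  rcases τ.eq_empty_or_nonempty with rfl | hne
  · exact ⟨∅, cut_empty.symm⟩
  obtain ⟨v, ⟨u, huv⟩, hmax⟩ : ∃ v : Vert n, (∃ u, s(v, u) ∈ τ) ∧
      ∀ x y, s(x, y) ∈ τ → x.1.val ≤ v.1.val := by
    obtain ⟨v, hv, hmax⟩ := Set.exists_max_image {v : Vert n | ∃ u, s(v, u) ∈ τ}
      (fun v => v.1.val) (Set.toFinite _) (by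
        obtain ⟨e, he⟩ := hne
        induction e with | _ a b
        exact ⟨a, b, he⟩)
    exact ⟨v, hv, fun x y hxy => hmax x ⟨y, hxy⟩⟩
  by_cases hv : v.1.val = 0
  · have h0 : IsFace (fun _ => 0 : Fin 3 → Fin (n + 2)) := by simp [IsFace, IsFaceTriple]
    refine ⟨{⟨_, h0⟩}, ?_⟩
    rw [isDoubleCover_bdry.cut_singleton]
    refine h0.isCycleOf.minimal hτ hne fun e he => ?_
    induction e with | _ x y
    rw [mem_triangle_iff]
    have h1 := hmax x y he
    have h2 := hmax y x (by rwa [Sym2.eq_swap])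
    refine ⟨(nestedOctahedra_adj.1 (hG he)).1, ?_, ?_⟩ <;> refine Fin.ext ?_ <;> simp <;> omega
  · obtain ⟨f, hf, hlt⟩ := exists_face_setWeight_lt hτ hG huv hv hmax
    obtain ⟨D, hD⟩ := ih _ (h ▸ hlt) (τ := τ ∆ triangle f)
      (fun e he => he.elim (fun h => hG h.1) fun h => hf.isCycleOf.subset_edgeSet h.1)
      (hτ.symmDiff hf.isCycleOf.isEven) rfl
    refine ⟨D ∆ {⟨f, hf⟩}, ?_⟩
    rw [isDoubleCover_bdry.cut_symmDiff, ← hD, isDoubleCover_bdry.cut_singleton]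
    exact (symmDiff_symmDiff_cancel_right _ _).symm

/-- Cross the edge opposite to a vertex in the highest layer of the face; the face on the other side
is further in. Repetition leads to the innermost face and makes the dual graph connected. -/
theorem IsFace.exists_lower {f : Fin 3 → Fin (n + 2)} (hf : IsFace f) (h0 : ∃ c, f c ≠ 0) :
    ∃ i, ∃ p : Fin (n + 2), p < f i ∧ IsFace (Function.update f i p) := by
  obtain ⟨i, -, hi⟩ := Finset.exists_max_image Finset.univ f Finset.univ_nonempty
  obtain ⟨j, hij⟩ : ∃ j, i ≠ j := (exists_ne i).imp fun _ h => h.symm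
  obtain ⟨m, him, hjm⟩ := exists_third hij
  have hj := hi j (Finset.mem_univ _)
  have hm := hi m (Finset.mem_univ _)
  have hpos : 0 < (f i).val := by
    obtain ⟨c, hc⟩ := h0
    have := hi c (Finset.mem_univ _)
    have : (f c).val ≠ 0 := fun h => hc (Fin.ext h)
    omega
  rw [isFace_iff hij him hjm] at hf
  have hlt := (f i).2
  by_cases hcase : IsFaceTriple (n + 1) ((f i).val - 1) (f j) (f m)
  · refine ⟨i, ⟨(f i).val - 1, by omega⟩, by rw [Fin.lt_def]; simp only; omega, ?_⟩
    rw [isFace_iff hij him hjm, Function.update_self, Function.update_of_ne hij.symm,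
      Function.update_of_ne him.symm]
    exact hcase
  -- A drop by two occurs when the opposite edge lies in a single layer `q` strictly between the
  -- ends and the vertex in layer `q + 1`: the triangle of layer `q` is not a face.
  · refine ⟨i, ⟨(f i).val - 2, by omega⟩, by rw [Fin.lt_def]; simp only; omega, ?_⟩
    rw [isFace_iff hij him hjm, Function.update_self, Function.update_of_ne hij.symm,
      Function.update_of_ne him.symm]
    unfold IsFaceTriple at *
    simp only
    omega

theorem dualConnected_bdry : DualConnected (bdry (n := n)) Set.univ := by
  intro A hA hne
  have hstep : ∀ f g : FaceIndex n, (bdry f ∩ bdry g).Nonempty → (f ∈ A ↔ g ∈ A) := fun f g h =>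
    ⟨fun hf => hA.2 f hf g trivial h, fun hg => hA.2 g hg f trivial (by rwa [Set.inter_comm])⟩
  have h0 : IsFace (fun _ => 0 : Fin 3 → Fin (n + 2)) := by simp [IsFace, IsFaceTriple]
  have key : ∀ s : ℕ, ∀ f : FaceIndex n, ∑ c, (f.1 c).val = s → (f ∈ A ↔ ⟨_, h0⟩ ∈ A) := by
    intro s
    induction s using Nat.strong_induction_on with
    | _ s ih =>
    rintro ⟨f, hf⟩ hs
    by_cases hc : ∃ c, f c ≠ 0
    · obtain ⟨i, p, hp, hf'⟩ := hf.exists_lower hc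
      obtain ⟨j, hij⟩ : ∃ j, i ≠ j := (exists_ne i).imp fun _ h => h.symm
      obtain ⟨m, him, hjm⟩ := exists_third hij
      rw [hstep ⟨f, hf⟩ ⟨_, hf'⟩ ⟨s((f j, j), (f m, m)), mem_triangle_iff.2 ⟨hjm, rfl, rfl⟩,
        mem_triangle_iff.2 ⟨hjm, Function.update_of_ne hij.symm _ _,
          Function.update_of_ne him.symm _ _⟩⟩]
      refine ih _ ?_ _ rfl
      rw [← hs]
      refine Finset.sum_lt_sum (fun c _ => ?_) ⟨i, Finset.mem_univ _, ?_⟩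
      · by_cases hci : c = i
        · subst hci
          simp only [Function.update_self]
          exact hp.le
        · simp only [Function.update_of_ne hci, le_refl]
      · simp only [Function.update_self]
        exact hp
    · push Not at hc
      have : f = fun _ => 0 := funext hc
      subst this
      rfl
  obtain ⟨f, hf⟩ := hne
  refine Set.eq_univ_of_forall fun g => ?_
  rw [key _ g rfl, ← key _ f rfl]
  exact hf

theorem isFaceSystem_bdry : IsFaceSystem (nestedOctahedra n) (bdry (n := n)) where
  toIsDoubleCover := isDoubleCover_bdry
  span _ hG hτ := eq_cut_of_isEven hG hτ
  conn := dualConnected_bdry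

end Octahedra

/-! ### Internal faces, arboreality and two-connectedness. -/

section Octahedra

variable {n : ℕ}

theorem mem_internalFaces {σ : Set (Sym2 (Vert n))} : σ ∈ internalFaces n ↔
    ∃ f : Fin 3 → Fin (n + 2), σ = triangle f ∧ IsFace f ∧ f ≠ fun _ => Fin.last (n + 1) := by
  constructor
  · rintro ⟨f, rfl, hf⟩
    refine ⟨f, rfl, ?_⟩
    rcases hf with h0 | ⟨⟨k, hk⟩, i, j, hij⟩
    · refine ⟨by simp [IsFace, IsFaceTriple, h0], fun h => ?_⟩
      have := congrFun h 0
      rw [h0] at this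
      simpa using congrArg Fin.val this
    · refine ⟨?_, fun h => hij (by rw [h])⟩
      have hv : ∀ c, (f c).val = k.val ∨ (f c).val = k.val + 1 := fun c =>
        (hk c).imp (fun h => by rw [h]; rfl) fun h => by rw [h]; rfl
      have hne : ¬ ((f 0).val = f 1 ∧ (f 1).val = f 2) := by
        rintro ⟨h1, h2⟩
        refine hij (Fin.ext ?_)
        fin_cases i <;> fin_cases j <;> simp <;> omega
      have h0 := hv 0
      have h1 := hv 1
      have h2 := hv 2
      unfold IsFace IsFaceTriple
      omega
  · rintro ⟨f, rfl, hf, hlast⟩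
    refine ⟨f, rfl, ?_⟩
    by_cases hc : ∀ i j, f i = f j
    · left
      have hf' := hf
      unfold IsFace IsFaceTriple at hf
      have h01 := congrArg Fin.val (hc 0 1)
      have h12 := congrArg Fin.val (hc 1 2)
      have h0 : (f 0).val = 0 := by
        by_contra h0
        refine hlast (funext fun i => ?_)
        rw [hc i 0]
        refine Fin.ext ?_
        simp only [Fin.val_last]
        omega
      intro i
      rw [hc i 0]
      exact Fin.ext h0
    · right
      push Not at hc
      obtain ⟨i, j, hij⟩ := hc
      refine ⟨?_, i, j, hij⟩
      wlog hlt : f i < f j generalizing i j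
      · exact this j i hij.symm (lt_of_le_of_ne (not_lt.1 hlt) hij.symm)
      have hij' : i ≠ j := fun h => hij (h ▸ rfl)
      obtain ⟨m, him, hjm⟩ := exists_third hij'
      rw [isFace_iff hij' him hjm] at hf
      unfold IsFaceTriple at hf
      refine ⟨⟨(f i).val, by omega⟩, fun c => ?_⟩
      simp only [Fin.ext_iff, Fin.val_castSucc, Fin.val_succ]
      rcases fin3_cases hij' him hjm c with rfl | rfl | rfl <;> omega

/-- A tree contains at most two edges of a triangle, and any two edges of a triangle share a vertex,
here `(f i, i)`. -/
theorem isFundamentalCycle_triangle_iff {T : SimpleGraph (Vert n)}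
    (hT : IsSpanningTree (nestedOctahedra n) T) {f : Fin 3 → Fin (n + 2)} (hf : IsFace f) :
    IsFundamentalCycle (nestedOctahedra n) T (triangle f) ↔ ∃ i j m, i ≠ j ∧ i ≠ m ∧ j ≠ m ∧
      T.Adj (f i, i) (f j, j) ∧ T.Adj (f i, i) (f m, m) := by
  rw [isFundamentalCycle_iff hT.2.isAcyclic hT.1]
  constructor
  · rintro ⟨-, e, he⟩
    have h1 : e ∈ triangle f \ T.edgeSet := by rw [he]; rfl
    obtain ⟨j, m, hjm, rfl⟩ := h1.1
    obtain ⟨i, hji, hmi⟩ := exists_third hjm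
    have key : ∀ c, i ≠ c → T.Adj (f i, i) (f c, c) := fun c hc => by
      by_contra hT'
      have : s((f i, i), (f c, c)) ∈ triangle f \ T.edgeSet :=
        ⟨mem_triangle_iff.2 ⟨hc, rfl, rfl⟩, hT'⟩
      rw [he, Set.mem_singleton_iff, Sym2.eq_iff] at this
      rcases this with ⟨h, -⟩ | ⟨h, -⟩
      · exact hji (congrArg Prod.snd h).symm
      · exact hmi (congrArg Prod.snd h).symm
    exact ⟨i, j, m, hji.symm, hmi.symm, hjm, key j hji.symm, key m hmi.symm⟩
  · rintro ⟨i, j, m, hij, him, hjm, h1, h2⟩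
    refine ⟨hf.isCycleOf, s((f j, j), (f m, m)), ?_⟩
    have h3 : ¬ triangle f ⊆ T.edgeSet := fun h =>
      not_isCycleOf_of_isAcyclic hT.2.isAcyclic (hf.isCycleOf.of_subset h)
    rw [triangle_eq hij him hjm] at h3 ⊢
    simp only [Set.insert_subset_iff, Set.singleton_subset_iff, SimpleGraph.mem_edgeSet, h1, h2,
      true_and] at h3
    ext e
    simp only [Set.mem_sdiff, Set.mem_insert_iff, Set.mem_singleton_iff]
    constructor
    · rintro ⟨rfl | rfl | rfl, h⟩
      · exact absurd h1 h
      · exact absurd h2 h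
      · rfl
    · rintro rfl
      exact ⟨Or.inr (Or.inr rfl), h3⟩

/-- Faces that have an even number of vertices in the larger of their layers, and the innermost
face. They partition the edges. -/
def evenFace : Option (Fin (n + 1) × Fin 3) → Fin 3 → Fin (n + 2)
  | none => fun _ => 0
  | some (k, i) => fun c => if c = i then k.castSucc else k.succ

theorem isFace_evenFace (o : Option (Fin (n + 1) × Fin 3)) : IsFace (evenFace o) := by
  rcases o with _ | ⟨k, i⟩
  · simp [IsFace, IsFaceTriple, evenFace]
  · obtain ⟨j, hij⟩ : ∃ j, i ≠ j := (exists_ne i).imp fun _ h => h.symm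
    obtain ⟨m, him, hjm⟩ := exists_third hij
    rw [isFace_iff hij him hjm]
    simp only [IsFaceTriple, evenFace, if_neg hij.symm, if_neg him.symm, if_true,
      Fin.val_castSucc, Fin.val_succ]
    omega

theorem evenFace_ne_last (o : Option (Fin (n + 1) × Fin 3)) :
    evenFace o ≠ fun _ => Fin.last (n + 1) := by
  rcases o with _ | ⟨k, i⟩
  · exact fun h => by simpa [evenFace] using congrArg Fin.val (congrFun h 0)
  · intro h
    have := congrArg Fin.val (congrFun h i)
    simp only [evenFace, if_true, Fin.val_castSucc, Fin.val_last] at this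
    omega

/-- `α` has just one vertex in its larger layer, so replacing it leaves the counting argument for
arboreality untouched. -/
theorem evenFace_ne_alpha (o : Option (Fin (n + 1) × Fin 3)) :
    evenFace o ≠ ![1, 0, 0] := by
  intro h
  have h0 := congrArg Fin.val (congrFun h 0)
  have h1 := congrArg Fin.val (congrFun h 1)
  have h2 := congrArg Fin.val (congrFun h 2)
  rcases o with _ | ⟨k, i⟩
  · simp [evenFace] at h0
  · by_cases hi : i = 1
    · subst hi
      simp [evenFace] at h2
    · simp [evenFace, Ne.symm hi] at h1

/-- An edge between two layers belongs to the even face at its inner end; an edge within a layer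
above `0` belongs to the one whose inner vertex has the third index. -/
theorem exists_mem_evenFace {e : Sym2 (Vert n)} (he : e ∈ (nestedOctahedra n).edgeSet) :
    ∃ o, e ∈ triangle (evenFace (n := n) o) := by
  induction e with | _ u v
  wlog hle : u.1 ≤ v.1 generalizing u v
  · obtain ⟨o, ho⟩ := this v u (by rwa [Sym2.eq_swap]) (le_of_not_ge hle)
    exact ⟨o, by rwa [Sym2.eq_swap]⟩
  obtain ⟨k, i⟩ := u
  obtain ⟨l, j⟩ := v
  obtain ⟨hij, h1, h2⟩ := nestedOctahedra_adj.1 he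
  simp only at hij h1 h2 hle
  have hk := k.2
  have hl := l.2
  rw [Fin.le_def] at hle
  simp only [mem_triangle_iff]
  rcases hle.lt_or_eq with hlt | heq
  · refine ⟨some (⟨k.val, by omega⟩, i), hij, ?_, ?_⟩
    · simp [evenFace]
    · refine Fin.ext ?_
      simp only [evenFace, if_neg hij.symm, Fin.val_succ]
      omega
  · by_cases h0 : k.val = 0
    · refine ⟨none, hij, ?_, ?_⟩ <;> simp only [evenFace, Fin.ext_iff, Fin.val_zero] <;> omega
    · obtain ⟨m, him, hjm⟩ := exists_third hij
      refine ⟨some (⟨k.val - 1, by omega⟩, m), hij, Fin.ext ?_, Fin.ext ?_⟩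
      · simp only [evenFace, if_neg him, Fin.val_succ]
        omega
      · simp only [evenFace, if_neg hjm, Fin.val_succ]
        omega

/-- Pigeonhole: `3n + 5` tree edges fall into `3n + 4` even faces. -/
theorem IsSpanningTree.exists_evenFace {T : SimpleGraph (Vert n)}
    (hT : IsSpanningTree (nestedOctahedra n) T) :
    ∃ o, IsFundamentalCycle (nestedOctahedra n) T (triangle (evenFace o)) := by
  classical
  have hcard := hT.2.card_edgeFinset
  choose! φ hφ using fun (e : Sym2 (Vert n)) he => exists_mem_evenFace (n := n) (e := e) he
  have hTG : ∀ e ∈ T.edgeFinset, e ∈ triangle (evenFace (φ e)) := fun e he =>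
    hφ e (SimpleGraph.edgeSet_mono hT.1 (SimpleGraph.mem_edgeFinset.1 he))
  obtain ⟨e, he, e', he', hne, heq⟩ := Finset.exists_ne_map_eq_of_card_lt_of_maps_to
    (s := T.edgeFinset) (t := Finset.univ) (f := φ) (by
      simp only [Finset.card_univ, Fintype.card_option, Fintype.card_prod, Fintype.card_fin]
        at hcard ⊢
      omega) (fun _ _ => Finset.mem_univ _)
  refine ⟨φ e, (isFundamentalCycle_triangle_iff hT (isFace_evenFace _)).2 ?_⟩
  have h1 := hTG e he
  have h2 := hTG e' he'
  rw [← heq] at h2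
  generalize evenFace (φ e) = f at h1 h2 ⊢
  obtain ⟨i, j, hij, rfl⟩ := h1
  obtain ⟨m, him, hjm⟩ := exists_third hij
  rw [triangle_eq hij him hjm] at h2
  rw [SimpleGraph.mem_edgeFinset, SimpleGraph.mem_edgeSet] at he
  rcases h2 with rfl | rfl | rfl
  · exact absurd rfl hne
  · rw [SimpleGraph.mem_edgeFinset, SimpleGraph.mem_edgeSet] at he'
    exact ⟨i, j, m, hij, him, hjm, he, he'⟩
  · rw [SimpleGraph.mem_edgeFinset, SimpleGraph.mem_edgeSet] at he'
    exact ⟨j, i, m, hij.symm, hjm, him, he.symm, he'⟩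

theorem mem_faceFamily {β : Set (Sym2 (Vert n))} {f : Fin 3 → Fin (n + 2)} (hf : IsFace f)
    (hlast : f ≠ fun _ => Fin.last (n + 1)) (hα : f ≠ ![1, 0, 0]) :
    triangle f ∈ faceFamily n β :=
  Or.inr ⟨mem_internalFaces.2 ⟨f, rfl, hf, hlast⟩, fun h => hα (triangle_injective h)⟩

theorem isArboreal_faceFamily (β : Set (Sym2 (Vert n))) :
    IsArboreal (nestedOctahedra n) (faceFamily n β) := by
  intro T hT
  obtain ⟨o, ho⟩ := hT.exists_evenFace
  exact ⟨_, mem_faceFamily (isFace_evenFace o) (evenFace_ne_last o) (evenFace_ne_alpha o), ho⟩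

theorem ne_last_of_eq_zero {f : Fin 3 → Fin (n + 2)} {c : Fin 3} (h : f c = 0) :
    f ≠ fun _ => Fin.last (n + 1) := by
  rintro rfl
  simpa using congrArg Fin.val h

theorem val_one_fin : ((1 : Fin (n + 2)).val) = 1 := rfl

theorem isFace_alpha : IsFace (![1, 0, 0] : Fin 3 → Fin (n + 2)) := by
  simp [IsFace, IsFaceTriple]

theorem isFace_rho : IsFace (![0, 1, 1] : Fin 3 → Fin (n + 2)) := by
  simp [IsFace, IsFaceTriple]

theorem isFace_zero : IsFace (![0, 0, 0] : Fin 3 → Fin (n + 2)) := by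
  simp [IsFace, IsFaceTriple]

theorem isFace_oneOneZero : IsFace (![1, 1, 0] : Fin 3 → Fin (n + 2)) := by
  simp [IsFace, IsFaceTriple]

theorem cyclicallySpans_faceFamily {b : Fin 3 → Fin (n + 2)} (hb : IsFace b)
    (hb0 : ∃ c, b c = 0) (hbα : b ≠ ![1, 0, 0]) :
    CyclicallySpans (nestedOctahedra n) (faceFamily n (triangle b)) := by
  have hlast : IsFace (fun _ => Fin.last (n + 1) : Fin 3 → Fin (n + 2)) := by
    simp [IsFace, IsFaceTriple]
  refine isFaceSystem_bdry.cyclicallySpans (o := ⟨_, hlast⟩) (a := ⟨_, isFace_alpha⟩)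
    (b := ⟨b, hb⟩) ?_ (Or.inl rfl) ?_ ?_
  · rintro ⟨f, hf⟩ h1 h2
    exact mem_faceFamily hf (fun h => h1 (Subtype.ext h)) fun h => h2 (Subtype.ext h)
  · intro h
    obtain ⟨c, hc⟩ := hb0
    exact ne_last_of_eq_zero hc (congrArg Subtype.val h)
  · exact fun h => hbα (congrArg Subtype.val h)

/-- In a nested octahedra graph, removing a set of at most one vertex leaves vertices in equal or
consecutive layers connected by a path of length at most two. -/
theorem exists_common_neighbor {v u w : Vert n} (hu : u.1.val ≤ w.1.val + 1)
    (hw : w.1.val ≤ u.1.val + 1) (huw : u.2 = w.2) :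
    ∃ x, x ≠ v ∧ (nestedOctahedra n).Adj u x ∧ (nestedOctahedra n).Adj x w := by
  obtain ⟨j, hj⟩ := exists_ne u.2
  obtain ⟨m, hm1, hm2⟩ := exists_third hj
  by_cases hv : v.2 = j
  · refine ⟨(u.1, m), fun h => hm1 (by rw [← h] at hv; exact hv.symm), ?_, ?_⟩ <;>
      rw [nestedOctahedra_adj]
    · exact ⟨hm2, by simp, by simp⟩
    · exact ⟨by rw [← huw]; exact hm2.symm, hu, hw⟩
  · refine ⟨(u.1, j), fun h => hv (by rw [← h]), ?_, ?_⟩ <;> rw [nestedOctahedra_adj]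
    · exact ⟨hj.symm, by simp, by simp⟩
    · exact ⟨by rw [← huw]; exact hj, hu, hw⟩

theorem reachable_of_le_succ (s : Set (Vert n)) (v : Vert n)
    (hs : ∀ x, x ≠ v → x ∈ s) {u w : s} (hu : u.1.1.val ≤ w.1.1.val + 1)
    (hw : w.1.1.val ≤ u.1.1.val + 1) : ((nestedOctahedra n).induce s).Reachable u w := by
  by_cases huw : u.1.2 = w.1.2
  · obtain ⟨x, hx, h1, h2⟩ := exists_common_neighbor (v := v) hu hw huw
    have h1' : ((nestedOctahedra n).induce s).Adj u ⟨x, hs x hx⟩ := h1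
    have h2' : ((nestedOctahedra n).induce s).Adj ⟨x, hs x hx⟩ w := h2
    exact h1'.reachable.trans h2'.reachable
  · have : ((nestedOctahedra n).induce s).Adj u w := nestedOctahedra_adj.2 ⟨huw, hu, hw⟩
    exact this.reachable

/-- The vertices of one index different from that of `v` form a spine through all layers that avoids
`v`, and every vertex reaches the spine in its own layer. Taking `s` to be everything or the
complement of `v` gives both halves of two-connectedness. -/
theorem connected_induce (s : Set (Vert n)) (v : Vert n) (hs : ∀ x, x ≠ v → x ∈ s) :
    ((nestedOctahedra n).induce s).Connected := by
  obtain ⟨j, hj⟩ := exists_ne v.2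
  let r : Fin (n + 2) → s := fun k => ⟨(k, j), hs _ fun h => hj (by rw [← h])⟩
  have hr : ∀ k : ℕ, ∀ hk : k < n + 2,
      ((nestedOctahedra n).induce s).Reachable (r 0) (r ⟨k, hk⟩) := by
    intro k
    induction k with
    | zero => exact fun _ => .refl _
    | succ k ih =>
      intro hk
      refine (ih (by omega)).trans (reachable_of_le_succ s v hs ?_ ?_)
      · simp only [r]
        omega
      · simp [r]
  have hall : ∀ u : s, ((nestedOctahedra n).induce s).Reachable (r 0) u := fun u =>
    (hr u.1.1.val u.1.1.2).trans (reachable_of_le_succ s v hs (by simp [r]) (by simp [r]))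
  exact (SimpleGraph.connected_iff _).2 ⟨fun u w => (hall u).symm.trans (hall w), ⟨r 0⟩⟩

theorem isTwoConnected_nestedOctahedra : IsTwoConnected (nestedOctahedra n) := by
  refine ⟨?_, ?_, fun v => connected_induce _ v fun x hx => hx⟩
  · simp
  · have := connected_induce (n := n) Set.univ (0, 0) fun _ _ => trivial
    exact (SimpleGraph.induceUnivIso _).connected_iff.1 this

end Octahedra

/-! ### The three trees, rooted at a vertex of `ρ`. -/

section Hubs

/-- A graph whose edges join each vertex other than the root to its parent is a tree, if some rank
decreases along the way. -/
theorem isTree_of_parent {V : Type*} [Finite V] {T : SimpleGraph V} (r : V) (p : V → V)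
    (rank : V → ℕ) (hadj : ∀ v, v ≠ r → T.Adj v (p v)) (hrank : ∀ v, v ≠ r → rank (p v) < rank v)
    (hcov : ∀ e ∈ T.edgeSet, ∃ v, v ≠ r ∧ e = s(v, p v)) : T.IsTree := by
  have hreach : ∀ N v, rank v = N → T.Reachable v r := by
    intro N
    induction N using Nat.strong_induction_on with
    | _ N ih =>
    intro v hv
    by_cases h : v = r
    · rw [h]
    · exact (hadj v h).reachable.trans (ih _ (hv ▸ hrank v h) _ rfl)
  have hconn : T.Connected :=
    (SimpleGraph.connected_iff _).2
      ⟨fun u v => (hreach _ u rfl).trans (hreach _ v rfl).symm, ⟨r⟩⟩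
  rw [SimpleGraph.isTree_iff_connected_and_card]
  refine ⟨hconn, le_antisymm ?_ hconn.card_vert_le_card_edgeSet_add_one⟩
  have h1 : T.edgeSet ⊆ (fun v => s(v, p v)) '' {r}ᶜ := fun e he => by
    obtain ⟨v, hv, rfl⟩ := hcov e he
    exact ⟨v, hv, rfl⟩
  have h2 := (Set.ncard_le_ncard h1 (Set.toFinite _)).trans (Set.ncard_image_le (Set.toFinite _))
  have h3 := Set.ncard_add_ncard_compl ({r} : Set V)
  rw [Set.ncard_singleton] at h3
  rw [Nat.card_coe_set_eq]
  omega

variable {n : ℕ}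

/-- The position of a vertex within the part of the spiral in its layer. -/
def spiralOffset (v : Vert n) : ℕ := (v.2.val + 2 * v.1.val) % 3

/-- The next vertex on the spiral, inwards. -/
def spiralParent (v : Vert n) : Vert n :=
  if spiralOffset v = 0 then (⟨v.1.val - 1, by omega⟩, Fin.ofNat 3 (v.1.val + 1))
  else if spiralOffset v = 1 then (v.1, Fin.ofNat 3 v.1.val)
  else (v.1, Fin.ofNat 3 (v.1.val + 1))

/-- The offset is the index minus the layer modulo 3. A layer is visited in the order of offsets 0,
1, 2, and offset 0 hangs on the vertex of offset 2 one layer further in. -/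
theorem mem_spiral_iff {e : Sym2 (Vert n)} :
    e ∈ spiral n ↔ ∃ v : Vert n, 2 ≤ v.1.val ∧ e = s(v, spiralParent v) := by
  constructor
  · rintro ⟨k, hk, h⟩
    have hk' : k.val ≠ 0 := fun h => hk (Fin.ext h)
    rcases h with rfl | rfl | rfl
    · refine ⟨(k.succ, Fin.ofNat 3 (k.val + 1)), by simp; omega, ?_⟩
      have h0 : spiralOffset (k.succ, Fin.ofNat 3 (k.val + 1)) = 0 := by
        simp [spiralOffset]; omega
      rw [spiralParent, if_pos h0, Sym2.eq_swap]
      rfl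
    · refine ⟨(k.succ, Fin.ofNat 3 (k.val + 2)), by simp; omega, ?_⟩
      have h0 : spiralOffset (k.succ, Fin.ofNat 3 (k.val + 2)) = 1 := by
        simp [spiralOffset]; omega
      rw [spiralParent, if_neg (by omega), if_pos h0, Sym2.eq_swap]
      rfl
    · refine ⟨(k.succ, Fin.ofNat 3 k.val), by simp; omega, ?_⟩
      have h0 : spiralOffset (k.succ, Fin.ofNat 3 k.val) = 2 := by
        simp [spiralOffset]; omega
      rw [spiralParent, if_neg (by omega), if_neg (by omega), Sym2.eq_swap]
      rfl
  · rintro ⟨⟨l, j⟩, hl, rfl⟩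
    simp only at hl
    have hl' := l.2
    obtain ⟨k, rfl⟩ : ∃ k : Fin (n + 1), l = k.succ :=
      ⟨⟨l.val - 1, by omega⟩, Fin.ext (by simp; omega)⟩
    rw [Fin.val_succ] at hl
    refine ⟨k, fun h => by simp [h] at hl, ?_⟩
    have hj := j.2
    have hjeq : ∀ t : ℕ, j.val = t % 3 → j = Fin.ofNat 3 t := fun t ht => Fin.ext ht
    by_cases h0 : spiralOffset (k.succ, j) = 0
    · left
      rw [spiralParent, if_pos h0, Sym2.eq_swap]
      simp only [spiralOffset, Fin.val_succ] at h0
      rw [hjeq (k.val + 1) (by omega)]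
      rfl
    · by_cases h1 : spiralOffset (k.succ, j) = 1
      · right; left
        rw [spiralParent, if_neg h0, if_pos h1, Sym2.eq_swap]
        simp only [spiralOffset, Fin.val_succ] at h1
        rw [hjeq (k.val + 2) (by omega)]
        rfl
      · right; right
        rw [spiralParent, if_neg h0, if_neg h1, Sym2.eq_swap]
        simp only [spiralOffset, Fin.val_succ] at h0 h1
        rw [hjeq k.val (by omega)]
        rfl

theorem spiralOffset_lt (v : Vert n) : spiralOffset v < 3 := Nat.mod_lt _ (by norm_num)

/-- The rank of a vertex in the tree with hub `h`. -/
noncomputable def hubRank (h v : Vert n) : ℕ := by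
  classical exact
  -- Ranks on the spiral are at least 6. Below it, the path `c`, `a`, `x` has ranks 4, 3, 2, and the
  -- vertices of `ρ` other than the hub have rank 1.
  if 2 ≤ v.1.val then 3 * v.1.val + spiralOffset v
  else if v = h then 0
  else if v.1 = 1 then (if v.2 = 0 then 2 else 1)
  else if v.2 = 0 then 1 else if v.2 = 1 then 4 else 3

/-- The parent of a vertex in the tree with hub `h`. -/
def hubParent (h v : Vert n) : Vert n :=
  if 2 ≤ v.1.val then spiralParent v
  else if v.1 = 1 then (if v.2 = 0 then (1, 2) else h)
  else if v.2 = 0 then h else if v.2 = 1 then (0, 2) else (1, 0)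

theorem eq_of_lt_two (v : Vert n) (hv : ¬ 2 ≤ v.1.val) :
    v = (0, 0) ∨ v = (0, 1) ∨ v = (0, 2) ∨ v = (1, 0) ∨ v = (1, 1) ∨ v = (1, 2) := by
  obtain ⟨k, i⟩ := v
  have hk : k = 0 ∨ k = 1 := by
    simp only at hv
    have : k.val = 0 ∨ k.val = 1 := by omega
    exact this.imp (fun h => Fin.ext h) fun h => Fin.ext (by rw [h, val_one_fin])
  fin_cases i <;> rcases hk with rfl | rfl <;> simp

theorem hubRank_spiralParent_lt {h : Vert n} (hh : h ≠ (1, 0)) (v : Vert n)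
    (hv : 2 ≤ v.1.val) : hubRank h (spiralParent v) < hubRank h v := by
  have hrv : hubRank h v = 3 * v.1.val + spiralOffset v := if_pos hv
  rw [hrv]
  obtain ⟨l, j⟩ := v
  simp only at hv
  have hj := j.2
  have hlt := spiralOffset_lt (l, j)
  unfold spiralParent
  split_ifs with h0 h1
  · by_cases hl : 2 ≤ l.val - 1
    · rw [hubRank, if_pos hl]
      simp only [spiralOffset, Fin.val_ofNat] at h0 ⊢
      omega
    -- The spiral starts at `x`.
    · have : ((⟨l.val - 1, by omega⟩, Fin.ofNat 3 (l.val + 1)) : Vert n) = (1, 0) := by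
        have : l.val = 2 := by omega
        refine Prod.ext (Fin.ext ?_) (Fin.ext ?_)
        · simp [this]
        · simp [this]
      simp only
      rw [this, hubRank, if_neg (by simp), if_neg hh.symm]
      simp
      omega
  · rw [hubRank, if_pos (by exact hv)]
    simp only [spiralOffset, Fin.val_ofNat] at h0 h1 ⊢
    omega
  · rw [hubRank, if_pos (by exact hv)]
    simp only [spiralOffset, Fin.val_ofNat] at h0 h1 ⊢
    omega

theorem spiralParent_ne (v : Vert n) (hv : 2 ≤ v.1.val) : spiralParent v ≠ v := fun h => by
  have := hubRank_spiralParent_lt (h := (0, 0)) (by simp) v hv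
  rw [h] at this
  exact lt_irrefl _ this

/-- The tree whose edges at `ρ` are those at the hub `h`. -/
def hubTree (h : Vert n) : SimpleGraph (Vert n) :=
  SimpleGraph.fromEdgeSet
    ({e | ∃ u, (u = (0, 0) ∨ u = (1, 1) ∨ u = (1, 2)) ∧ u ≠ h ∧ e = s(u, h)} ∪ innerPath n ∪
      spiral n)

theorem isTree_hubTree {h : Vert n} (hh : h = (0, 0) ∨ h = (1, 1) ∨ h = (1, 2)) :
    (hubTree h).IsTree := by
  have hx : h ≠ (1, 0) := by rcases hh with rfl | rfl | rfl <;> simp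
  have hc : h ≠ (0, 1) := by rcases hh with rfl | rfl | rfl <;> simp
  have ha : h ≠ (0, 2) := by rcases hh with rfl | rfl | rfl <;> simp
  have hlow : ¬ 2 ≤ h.1.val := by rcases hh with rfl | rfl | rfl <;> simp
  have h01 : ((0 : Fin (n + 2)) = 1) = False := by simp
  refine isTree_of_parent h (hubParent h) (hubRank h) (fun v hv => ?_) (fun v hv => ?_) ?_
  · rw [hubTree, SimpleGraph.fromEdgeSet_adj]
    by_cases h2 : 2 ≤ v.1.val
    · rw [hubParent, if_pos h2]
      exact ⟨Or.inr (mem_spiral_iff.2 ⟨v, h2, rfl⟩), (spiralParent_ne v h2).symm⟩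
    · rcases eq_of_lt_two v h2 with rfl | rfl | rfl | rfl | rfl | rfl
      · simp [hubParent, hv]
      · simp [hubParent, innerPath]
      · simp [hubParent, innerPath]
      · simp [hubParent, innerPath]
      · simp [hubParent, hv]
      · simp [hubParent, hv]
  · by_cases h2 : 2 ≤ v.1.val
    · rw [hubParent, if_pos h2]
      exact hubRank_spiralParent_lt hx v h2
    · rcases eq_of_lt_two v h2 with rfl | rfl | rfl | rfl | rfl | rfl
      · simp [hubParent, hubRank, hv, hlow]
      · simp [hubParent, hubRank, hc.symm, ha.symm]
      · simp [hubParent, hubRank, ha.symm, hx.symm]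
      · rcases hh with rfl | rfl | rfl <;> simp [hubParent, hubRank]
      · simp [hubParent, hubRank, hv, hlow]
      · simp [hubParent, hubRank, hv, hlow]
  · intro e he
    rw [hubTree, SimpleGraph.edgeSet_fromEdgeSet] at he
    rcases he.1 with (⟨u, hu, huh, rfl⟩ | hp) | hs
    · refine ⟨u, huh, ?_⟩
      rcases hu with rfl | rfl | rfl <;> simp [hubParent]
    · rcases hp with rfl | rfl | rfl
      · exact ⟨(0, 1), hc.symm, by simp [hubParent]⟩
      · exact ⟨(0, 2), ha.symm, by simp [hubParent]⟩
      · exact ⟨(1, 0), hx.symm, by simp [hubParent]⟩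
    · obtain ⟨v, hv, rfl⟩ := mem_spiral_iff.1 hs
      exact ⟨v, fun h' => hlow (h' ▸ hv), by rw [hubParent, if_pos hv]⟩

end Hubs

/-! ### Faces with two edges in the union of the trees. -/

section Hubs

variable {n : ℕ}

/-- The edges of the three trees, ordered away from the spiral's outer end. -/
def HubEdge (k i l j : ℕ) : Prop :=
  (2 ≤ k ∧ ((i + 2 * k) % 3 = 0 ∧ l + 1 = k ∧ j = (k + 1) % 3 ∨
    (i + 2 * k) % 3 = 1 ∧ l = k ∧ j = k % 3 ∨ (i + 2 * k) % 3 = 2 ∧ l = k ∧ j = (k + 1) % 3)) ∨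
  (k = 0 ∧ i = 1 ∧ l = 0 ∧ j = 2) ∨ (k = 0 ∧ i = 2 ∧ l = 1 ∧ j = 0) ∨
  (k = 1 ∧ i = 0 ∧ l = 1 ∧ j = 2) ∨ (k = 0 ∧ i = 0 ∧ l = 1 ∧ (j = 1 ∨ j = 2)) ∨
  (k = 1 ∧ i = 1 ∧ l = 1 ∧ j = 2)

/-- The edges in and next to the spiral, in terms of the layers of their ends and the offsets of
the ends relative to the layer of the first. -/
def SpiralEdge (k s l t : ℕ) : Prop :=
  (s = 0 ∧ t = 1 ∧ l + 1 = k ∧ 2 ≤ k) ∨ (s = 1 ∧ t = 0 ∧ l = k ∧ 2 ≤ k) ∨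
  (s = 2 ∧ t = 1 ∧ l = k ∧ 2 ≤ k) ∨ (s = 0 ∧ t = 1 ∧ l = k ∧ 2 ≤ k) ∨
  (s = 1 ∧ t = 2 ∧ l = k ∧ 2 ≤ k) ∨ (s = 2 ∧ t = 1 ∧ l = k + 1 ∧ 2 ≤ l)

/-- In offsets relative to the first end, the spiral looks the same at every layer, so the residues
modulo 3 disappear from the later case analysis. -/
theorem spiralEdge_of_hubEdge {k i l j : ℕ}
    (h : HubEdge k i l j ∨ HubEdge l j k i) :
    SpiralEdge k ((i + 2 * k) % 3) l ((j + 2 * k) % 3) ∨ (k ≤ 1 ∧ l ≤ 1) := by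
  unfold HubEdge at h
  unfold SpiralEdge
  rcases h with (⟨hk, h | h | h⟩ | h) | (⟨hk, h | h | h⟩ | h)
  · exact Or.inl (Or.inl (by omega))
  · exact Or.inl (Or.inr (Or.inl (by omega)))
  · exact Or.inl (Or.inr (Or.inr (Or.inl (by omega))))
  · exact Or.inr (by omega)
  · exact Or.inl (Or.inr (Or.inr (Or.inr (Or.inr (Or.inr (by omega))))))
  · exact Or.inl (Or.inr (Or.inr (Or.inr (Or.inl (by omega)))))
  · exact Or.inl (Or.inr (Or.inr (Or.inr (Or.inr (Or.inl (by omega))))))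
  · exact Or.inr (by omega)

/-- A finite check near the innermost octahedron. The layer `c` may be 2 because the spiral leaves
from `x`; the last two outcomes are `α` and `ρ`. -/
theorem eq_of_hubEdges_low {a b c i j m : ℕ} (ha : a < 2) (hb : b < 2) (hc : c < 3)
    (hj : j < 3) (hm : m < 3) (hjm : j ≠ m) (h1 : HubEdge a i b j ∨ HubEdge b j a i)
    (h2 : HubEdge a i c m ∨ HubEdge c m a i) (hcb : c ≤ b + 1) (him : i ≠ m) :
    (a = 1 ∧ b = 1 ∧ c = 1) ∨ (a = 1 - i ∧ b = 1 - j ∧ c = 1 - m) ∨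
      (a = min i 1 ∧ b = min j 1 ∧ c = min m 1) := by
  interval_cases a <;> interval_cases b <;> interval_cases c <;> simp [HubEdge] at h1 h2 ⊢ <;> omega

/-- Consecutive spiral edges that meet at offset 0 or 2 have other ends of equal index, so they span
no triangle. Those that meet at offset 1 span a whole layer, and such a layer is a face only if it
is the outermost. -/
theorem eq_of_spiralEdges {N a b c s t u : ℕ} (htu : t ≠ u)
    (hf : IsFaceTriple N a b c) (h1 : SpiralEdge a s b t) (h2 : SpiralEdge a s c u) :
    a = N ∧ b = N ∧ c = N := by
  unfold IsFaceTriple at hf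
  unfold SpiralEdge at h1 h2
  rcases h1 with h1 | h1 | h1 | h1 | h1 | h1 <;> rcases h2 with h2 | h2 | h2 | h2 | h2 | h2 <;>
    omega

theorem eq_of_hubEdges {N a b c i j m : ℕ} (hi : i < 3) (hj : j < 3) (hm : m < 3) (hij : i ≠ j)
    (him : i ≠ m) (hjm : j ≠ m) (hf : IsFaceTriple N a b c)
    (h1 : HubEdge a i b j ∨ HubEdge b j a i) (h2 : HubEdge a i c m ∨ HubEdge c m a i) :
    (a = N ∧ b = N ∧ c = N) ∨ (a = 1 - i ∧ b = 1 - j ∧ c = 1 - m) ∨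
      (a = min i 1 ∧ b = min j 1 ∧ c = min m 1) := by
  have hf' := hf
  unfold IsFaceTriple at hf'
  rcases spiralEdge_of_hubEdge h1 with h1' | h1'
  · rcases spiralEdge_of_hubEdge h2 with h2' | h2'
    · exact Or.inl (eq_of_spiralEdges (by omega) hf h1' h2')
    · rcases eq_of_hubEdges_low (by omega) (by omega) (by omega) hm hj hjm.symm h2 h1 (by omega) hij
        with h | h | h <;> omega
  · rcases eq_of_hubEdges_low (by omega) (by omega) (by omega) hj hm hjm h1 h2 (by omega) him with
      h | h | h <;> omega

theorem hubEdge_spiralParent (v : Vert n) (hv : 2 ≤ v.1.val) :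
    HubEdge v.1 v.2 (spiralParent v).1 (spiralParent v).2 := by
  left
  refine ⟨hv, ?_⟩
  have hlt := spiralOffset_lt v
  unfold spiralParent
  split_ifs with h0 h1
  · exact Or.inl ⟨h0, Nat.sub_add_cancel (by omega), rfl⟩
  · exact Or.inr (Or.inl ⟨h1, rfl, rfl⟩)
  · exact Or.inr (Or.inr ⟨by unfold spiralOffset at *; omega, rfl, rfl⟩)

/-- The union of the three trees. -/
def hubUnion (n : ℕ) : Set (Sym2 (Vert n)) := faceRho n ∪ innerPath n ∪ spiral n

theorem hubEdge_of_mem {u v : Vert n} (h : s(u, v) ∈ hubUnion n) :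
    HubEdge u.1 u.2 v.1 v.2 ∨ HubEdge v.1 v.2 u.1 u.2 := by
  have key : ∀ x y : Vert n, s(u, v) = s(x, y) → HubEdge x.1 x.2 y.1 y.2 →
      HubEdge u.1 u.2 v.1 v.2 ∨ HubEdge v.1 v.2 u.1 u.2 := by
    intro x y h hxy
    rcases Sym2.eq_iff.1 h with ⟨rfl, rfl⟩ | ⟨rfl, rfl⟩
    · exact Or.inl hxy
    · exact Or.inr hxy
  rcases h with (h | h | h | h) | h
  · rw [faceRho, triangle_eq (i := 0) (j := 1) (m := 2) (by decide) (by decide) (by decide)] at h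
    rcases h with h | h | h <;> refine key _ _ h ?_ <;> simp [HubEdge]
  · exact key _ _ h (by simp [HubEdge])
  · exact key _ _ h (by simp [HubEdge])
  · exact key _ _ h (by simp [HubEdge])
  · obtain ⟨x, hx, h⟩ := mem_spiral_iff.1 h
    exact key _ _ h (hubEdge_spiralParent x hx)

theorem alpha_apply (i : Fin 3) : ((![1, 0, 0] : Fin 3 → Fin (n + 2)) i).val = 1 - i.val := by
  fin_cases i <;> simp

theorem rho_apply (i : Fin 3) : ((![0, 1, 1] : Fin 3 → Fin (n + 2)) i).val = min i.val 1 := by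
  fin_cases i <;> simp

/-- A spanning tree contained in the union of the three trees has no fundamental cycle among the
internal faces other than `α` and `ρ`. -/
theorem eq_rho_of_isFundamentalCycle {T : SimpleGraph (Vert n)}
    (hT : IsSpanningTree (nestedOctahedra n) T) (hH : T.edgeSet ⊆ hubUnion n)
    {f : Fin 3 → Fin (n + 2)} (hf : IsFace f) (hlast : f ≠ fun _ => Fin.last (n + 1))
    (hα : f ≠ ![1, 0, 0])
    (h : IsFundamentalCycle (nestedOctahedra n) T (triangle f)) : f = ![0, 1, 1] := by
  obtain ⟨i, j, m, hij, him, hjm, h1, h2⟩ := (isFundamentalCycle_triangle_iff hT hf).1 h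
  have h1' := hubEdge_of_mem (hH h1)
  have h2' := hubEdge_of_mem (hH h2)
  rw [isFace_iff hij him hjm] at hf
  have hext : ∀ g : Fin 3 → Fin (n + 2), (f i).val = (g i).val → (f j).val = (g j).val →
      (f m).val = (g m).val → f = g := by
    intro g hi hj hm
    funext c
    rcases fin3_cases hij him hjm c with rfl | rfl | rfl <;> exact Fin.ext ‹_›
  have hv : ∀ {a b : Fin 3}, a ≠ b → a.val ≠ b.val := fun h h' => h (Fin.ext h')
  rcases eq_of_hubEdges i.2 j.2 m.2 (hv hij) (hv him) (hv hjm) hf h1' h2' with h | h | h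
  · exact absurd (hext (fun _ => Fin.last (n + 1)) h.1 h.2.1 h.2.2) hlast
  · refine absurd (hext _ ?_ ?_ ?_) hα <;> rw [alpha_apply]
    exacts [h.1, h.2.1, h.2.2]
  · refine hext _ ?_ ?_ ?_ <;> rw [rho_apply]
    exacts [h.1, h.2.1, h.2.2]

/-- The four-cycle has two edges outside the union: `xc`, and either `bc` or `xy` according to `β`.
-/
theorem not_isFundamentalCycle_alpha_symmDiff {T : SimpleGraph (Vert n)}
    (hT : IsSpanningTree (nestedOctahedra n) T) (hH : T.edgeSet ⊆ hubUnion n)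
    {β : Set (Sym2 (Vert n))} (hβ : β = triangle ![0, 0, 0] ∨ β = triangle ![1, 1, 0]) :
    ¬ IsFundamentalCycle (nestedOctahedra n) T (faceAlpha n ∆ β) := by
  intro h
  obtain ⟨-, e, he⟩ := (isFundamentalCycle_iff hT.2.isAcyclic hT.1).1 h
  have h1 : s(((1, 0) : Vert n), ((0, 1) : Vert n)) ∈ (faceAlpha n ∆ β) \ T.edgeSet := by
    refine ⟨Or.inl ⟨mem_triangle_iff.2 (by simp), ?_⟩, fun h => ?_⟩
    · rcases hβ with rfl | rfl <;> rw [mem_triangle_iff] <;> simp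
    · have := hubEdge_of_mem (hH h)
      simp [HubEdge] at this
  have h2 : ∃ e' ∈ (faceAlpha n ∆ β) \ T.edgeSet, e' ≠ s(((1, 0) : Vert n), ((0, 1) : Vert n)) := by
    rcases hβ with rfl | rfl
    · refine ⟨s((0, 0), (0, 1)), ⟨Or.inr ⟨mem_triangle_iff.2 (by simp), ?_⟩, fun h => ?_⟩, ?_⟩
      · rw [faceAlpha, mem_triangle_iff]
        simp
      · have := hubEdge_of_mem (hH h)
        simp [HubEdge] at this
      · simp
    · refine ⟨s((1, 0), (1, 1)), ⟨Or.inr ⟨mem_triangle_iff.2 (by simp), ?_⟩, fun h => ?_⟩, ?_⟩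
      · rw [faceAlpha, mem_triangle_iff]
        simp
      · have := hubEdge_of_mem (hH h)
        simp [HubEdge] at this
      · simp
  obtain ⟨e', he', hne⟩ := h2
  rw [he] at h1 he'
  exact hne (he'.trans h1.symm)

/-- One of the vertices of `ρ`. -/
def IsHub (h : Vert n) : Prop := h = (0, 0) ∨ h = (1, 1) ∨ h = (1, 2)

theorem mem_faceRho_iff {u v : Vert n} : s(u, v) ∈ faceRho n ↔ IsHub u ∧ IsHub v ∧ u ≠ v := by
  obtain ⟨k, i⟩ := u
  obtain ⟨l, j⟩ := v
  rw [faceRho, mem_triangle_iff]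
  simp only [IsHub]
  fin_cases i <;> fin_cases j <;>
    simp [eq_comm (a := (0 : Fin (n + 2))), eq_comm (a := (1 : Fin (n + 2)))] <;>
    exact fun h1 h2 => h1.trans h2.symm

theorem hubTree_edgeSet (h : Vert n) : (hubTree h).edgeSet =
    {e | ∃ u, IsHub u ∧ u ≠ h ∧ e = s(u, h)} ∪ innerPath n ∪ spiral n := by
  rw [hubTree, SimpleGraph.edgeSet_fromEdgeSet]
  refine sdiff_eq_left.2 (Set.disjoint_left.2 fun e he hd => ?_)
  rcases he with (⟨u, hu, huh, rfl⟩ | hp) | hs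
  · exact huh hd
  · rcases hp with rfl | rfl | rfl <;> simp at hd
  · obtain ⟨v, hv, rfl⟩ := mem_spiral_iff.1 hs
    exact spiralParent_ne v hv hd.symm

end Hubs

/-! ### The component formed by the three trees. -/

section Hubs

variable {n : ℕ}

theorem IsHub.isTree {h : Vert n} (hh : IsHub h) : (hubTree h).IsTree := isTree_hubTree hh

theorem hubTree_subset_hubUnion {h : Vert n} (hh : IsHub h) : (hubTree h).edgeSet ⊆ hubUnion n := by
  rw [hubTree_edgeSet, hubUnion]
  refine Set.union_subset_union_left _ (Set.union_subset_union_left _ ?_)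
  rintro e ⟨u, hu, huh, rfl⟩
  exact mem_faceRho_iff.2 ⟨hu, hh, huh⟩

theorem hubUnion_subset : hubUnion n ⊆ (nestedOctahedra n).edgeSet := by
  rintro e ((he | he) | ⟨k, hk, he⟩)
  · exact isFace_rho.isCycleOf.subset_edgeSet he
  · rcases he with rfl | rfl | rfl <;> rw [SimpleGraph.mem_edgeSet, nestedOctahedra_adj] <;> simp
  · rcases he with rfl | rfl | rfl <;> rw [SimpleGraph.mem_edgeSet, nestedOctahedra_adj] <;>
      simp only [Ne, Fin.ext_iff, Fin.val_ofNat, Fin.val_castSucc, Fin.val_succ] <;> omega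

theorem IsHub.isSpanningTree {h : Vert n} (hh : IsHub h) :
    IsSpanningTree (nestedOctahedra n) (hubTree h) :=
  ⟨SimpleGraph.edgeSet_subset_edgeSet.1 ((hubTree_subset_hubUnion hh).trans hubUnion_subset),
    hh.isTree⟩

theorem IsHub.exists_third {g h : Vert n} (hg : IsHub g) (hh : IsHub h) (hgh : g ≠ h) :
    ∃ l, IsHub l ∧ l ≠ g ∧ l ≠ h ∧ ∀ u, IsHub u → u = l ∨ u = g ∨ u = h := by
  unfold IsHub at *
  rcases hg with rfl | rfl | rfl <;> rcases hh with rfl | rfl | rfl <;>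
    first
    | exact absurd rfl hgh
    | exact ⟨(0, 0), by simp, by simp, by simp, by tauto⟩
    | exact ⟨(1, 1), by simp, by simp, by simp, by tauto⟩
    | exact ⟨(1, 2), by simp, by simp, by simp, by tauto⟩

theorem IsHub.exists_others {h : Vert n} (hh : IsHub h) :
    ∃ g l, IsHub g ∧ IsHub l ∧ g ≠ l ∧ g ≠ h ∧ l ≠ h ∧ ∀ u, IsHub u → u = h ∨ u = g ∨ u = l := by
  unfold IsHub at *
  rcases hh with rfl | rfl | rfl
  · exact ⟨(1, 1), (1, 2), by simp, by simp, by simp, by simp, by simp, by tauto⟩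
  · exact ⟨(0, 0), (1, 2), by simp, by simp, by simp, by simp, by simp, by tauto⟩
  · exact ⟨(0, 0), (1, 1), by simp, by simp, by simp, by simp, by simp, by tauto⟩

theorem faceRho_isCycleOf : IsCycleOf (nestedOctahedra n) (faceRho n) := isFace_rho.isCycleOf

/-- The edge of `ρ` opposite to the hub is the only edge of the union that the tree misses. -/
theorem IsHub.exists_opposite {h : Vert n} (hh : IsHub h) : ∃ e, e ∈ faceRho n ∧
    e ∉ (hubTree h).edgeSet ∧ hubUnion n ⊆ insert e (hubTree h).edgeSet := by
  obtain ⟨g, l, hg, hl, hgl, hgh, hlh, hall⟩ := hh.exists_others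
  have hsub : hubUnion n ⊆ insert s(g, l) (hubTree h).edgeSet := by
    rw [hubTree_edgeSet]
    rintro e ((he | he) | he)
    · induction e with | _ u v
      obtain ⟨hu, hv, huv⟩ := mem_faceRho_iff.1 he
      by_cases hvh : v = h
      · exact Or.inr (Or.inl (Or.inl ⟨u, hu, fun h' => huv (h'.trans hvh.symm), by rw [hvh]⟩))
      by_cases huh : u = h
      · refine Or.inr (Or.inl (Or.inl ⟨v, hv, hvh, by rw [huh, Sym2.eq_swap]⟩))
      · left
        rcases (hall u hu).resolve_left huh with rfl | rfl <;>
          rcases (hall v hv).resolve_left hvh with rfl | rfl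
        · exact absurd rfl huv
        · rfl
        · exact Sym2.eq_swap
        · exact absurd rfl huv
    · exact Or.inr (Or.inl (Or.inr he))
    · exact Or.inr (Or.inr he)
  have hmem : s(g, l) ∈ faceRho n := mem_faceRho_iff.2 ⟨hg, hl, hgl⟩
  refine ⟨s(g, l), hmem, fun h' => ?_, hsub⟩
  rw [Set.insert_eq_of_mem h'] at hsub
  exact not_isCycleOf_of_isAcyclic hh.isTree.isAcyclic
    (faceRho_isCycleOf.of_subset fun e he => hsub (Or.inl (Or.inl he)))

theorem IsHub.faceRho_isFundamentalCycle {h : Vert n} (hh : IsHub h) :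
    IsFundamentalCycle (nestedOctahedra n) (hubTree h) (faceRho n) := by
  rw [isFundamentalCycle_iff hh.isTree.isAcyclic hh.isSpanningTree.1]
  obtain ⟨e, he, heT, hsub⟩ := hh.exists_opposite
  refine ⟨faceRho_isCycleOf, e, ?_⟩
  exact faceRho_isCycleOf.sdiff_eq_singleton hh.isTree.isAcyclic
    (fun x hx => hsub (Or.inl (Or.inl hx))) heT

theorem faceRho_mem_faceFamily (β : Set (Sym2 (Vert n))) : faceRho n ∈ faceFamily n β := by
  refine mem_faceFamily isFace_rho (ne_last_of_eq_zero (c := 0) rfl) fun h => ?_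
  simpa using congrArg Fin.val (congrFun h 0)

theorem IsHub.isFundamentalCycle_iff {h : Vert n} (hh : IsHub h) {β : Set (Sym2 (Vert n))}
    (hβ : β = triangle ![0, 0, 0] ∨ β = triangle ![1, 1, 0]) {σ : Set (Sym2 (Vert n))}
    (hσ : σ ∈ faceFamily n β) :
    IsFundamentalCycle (nestedOctahedra n) (hubTree h) σ ↔ σ = faceRho n := by
  constructor
  · intro hf
    rcases hσ with rfl | ⟨hσ, hα⟩
    · exact absurd hf (not_isFundamentalCycle_alpha_symmDiff hh.isSpanningTree
        (hubTree_subset_hubUnion hh) hβ)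
    · obtain ⟨f, rfl, hface, hlast⟩ := mem_internalFaces.1 hσ
      rw [eq_rho_of_isFundamentalCycle hh.isSpanningTree (hubTree_subset_hubUnion hh) hface hlast
        (fun h' => hα (by rw [h']; rfl)) hf]
      rfl
  · rintro rfl
    exact hh.faceRho_isFundamentalCycle

/-- Every edge of `ρ` contains `g` or `h`, so a common tree would contain the whole cycle `ρ`. -/
theorem IsHub.ne_hubTree {g h : Vert n} (hg : IsHub g) (hh : IsHub h) (hgh : g ≠ h) :
    hubTree g ≠ hubTree h := by
  intro heq
  obtain ⟨l, hl, hlg, hlh, -⟩ := hg.exists_third hh hgh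
  obtain ⟨e, he, heT, hsub⟩ := hg.exists_opposite
  refine heT ?_
  have key : ∀ u v : Vert n, IsHub u → IsHub v → u ≠ v → (v = g ∨ v = h) →
      s(u, v) ∈ (hubTree g).edgeSet := by
    rintro u v hu hv huv (rfl | rfl)
    · rw [hubTree_edgeSet]
      exact Or.inl (Or.inl ⟨u, hu, huv, rfl⟩)
    · rw [heq, hubTree_edgeSet]
      exact Or.inl (Or.inl ⟨u, hu, huv, rfl⟩)
  obtain ⟨l', -, -, -, hall⟩ := hg.exists_third hh hgh
  induction e with | _ u v
  obtain ⟨hu, hv, huv⟩ := mem_faceRho_iff.1 he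
  rcases hall v hv with rfl | hv'
  · rcases hall u hu with rfl | hu'
    · exact absurd rfl huv
    · rw [Sym2.eq_swap]
      exact key v u hv hu huv.symm hu'
  · exact key u v hu hv huv hv'

/-- The union of the two trees is one of them plus a single edge of `ρ`, so its only cycle is `ρ`.
-/
theorem IsHub.adj {g h : Vert n} (hg : IsHub g) (hh : IsHub h) (hgh : g ≠ h)
    (β : Set (Sym2 (Vert n))) : (treeGraph (nestedOctahedra n) (faceFamily n β)).Adj
      ⟨hubTree g, hg.isSpanningTree⟩ ⟨hubTree h, hh.isSpanningTree⟩ := by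
  refine ⟨faceRho n, faceRho_mem_faceFamily β, ?_⟩
  obtain ⟨e, he, heT, hsub⟩ := hg.exists_opposite
  have hle : (hubTree g ⊔ hubTree h).edgeSet ⊆ insert e (hubTree g).edgeSet := by
    rw [SimpleGraph.edgeSet_sup]
    exact (Set.union_subset (hubTree_subset_hubUnion hg) (hubTree_subset_hubUnion hh)).trans hsub
  have hmem : e ∈ (hubTree h).edgeSet := by
    by_contra hne
    refine hg.ne_hubTree hh hgh (isTree_eq_of_le hh.isTree hg.isTree ?_).symm
    rw [← SimpleGraph.edgeSet_subset_edgeSet]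
    intro x hx
    refine (hsub (hubTree_subset_hubUnion hh hx)).resolve_left fun h' => hne (h' ▸ hx)
  have hρ : IsCycleOf (hubTree g ⊔ hubTree h) (faceRho n) := by
    refine faceRho_isCycleOf.of_subset fun x hx => ?_
    rw [SimpleGraph.edgeSet_sup]
    rcases hsub (Or.inl (Or.inl hx)) with rfl | hx
    · exact Or.inr hmem
    · exact Or.inl hx
  ext τ
  constructor
  · intro hτ
    exact IsCycleOf.unique_of_subset_insert hg.isTree.isAcyclic hτ hρ
      (hτ.subset_edgeSet.trans hle) (hρ.subset_edgeSet.trans hle) heT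
  · rintro rfl
    exact hρ

/-- A neighbour differs only inside `ρ`. It misses some edge `uv` of `ρ`, so it is contained in the
tree whose hub is the third vertex, and trees on the same vertices cannot be properly nested. -/
theorem IsHub.of_adj {h : Vert n} (hh : IsHub h) {β : Set (Sym2 (Vert n))}
    (hβ : β = triangle ![0, 0, 0] ∨ β = triangle ![1, 1, 0])
    {T S : SpanningTree (nestedOctahedra n)} (hT : T.1 = hubTree h)
    (hadj : (treeGraph (nestedOctahedra n) (faceFamily n β)).Adj T S) :
    ∃ g, IsHub g ∧ S.1 = hubTree g := by
  obtain ⟨σ, hσ, hfund, hTS, hST⟩ := treeGraph_adj_exchange hadj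
  rw [hT] at hfund hTS hST
  rw [hh.isFundamentalCycle_iff hβ hσ] at hfund
  subst hfund
  have hnot : ¬ faceRho n ⊆ S.1.edgeSet := fun hs =>
    not_isCycleOf_of_isAcyclic S.2.2.isAcyclic (faceRho_isCycleOf.of_subset hs)
  obtain ⟨e, he, heS⟩ := Set.not_subset.1 hnot
  induction e with | _ u v
  obtain ⟨hu, hv, huv⟩ := mem_faceRho_iff.1 he
  obtain ⟨g, hg, hgu, hgv, hall⟩ := hu.exists_third hv huv
  refine ⟨g, hg, isTree_eq_of_le S.2.2 hg.isTree ?_⟩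
  rw [← SimpleGraph.edgeSet_subset_edgeSet, hubTree_edgeSet]
  have hρ : ∀ x ∈ faceRho n, x ∈ S.1.edgeSet →
      x ∈ {e | ∃ u, IsHub u ∧ u ≠ g ∧ e = s(u, g)} ∪ innerPath n ∪ spiral n := by
    intro x hx hxS
    induction x with | _ a b
    obtain ⟨ha, hb, hab⟩ := mem_faceRho_iff.1 hx
    by_cases hbg : b = g
    · exact Or.inl (Or.inl ⟨a, ha, fun h' => hab (h'.trans hbg.symm), by rw [hbg]⟩)
    by_cases hag : a = g
    · exact Or.inl (Or.inl ⟨b, hb, hbg, by rw [hag, Sym2.eq_swap]⟩)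
    · exfalso
      rcases (hall a ha).resolve_left hag with rfl | rfl <;>
        rcases (hall b hb).resolve_left hbg with rfl | rfl
      · exact hab rfl
      · exact heS hxS
      · exact heS (by rwa [Sym2.eq_swap])
      · exact hab rfl
  intro x hx
  by_cases hxT : x ∈ (hubTree h).edgeSet
  · rcases hubTree_subset_hubUnion hh hxT with (hx' | hx') | hx'
    · exact hρ x hx' hx
    · exact Or.inl (Or.inr hx')
    · exact Or.inr hx'
  · exact hρ x (hST ⟨hx, hxT⟩) hx

theorem isHub_zero : IsHub ((0, 0) : Vert n) := Or.inl rfl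

theorem isHub_y : IsHub ((1, 1) : Vert n) := Or.inr (Or.inl rfl)

theorem isHub_z : IsHub ((1, 2) : Vert n) := Or.inr (Or.inr rfl)

theorem treeT_eq : treeT n = hubTree (0, 0) := by
  rw [treeT, hubTree]
  congr 3
  ext e
  constructor
  · rintro (rfl | rfl)
    · exact ⟨(1, 1), by simp, by simp, Sym2.eq_swap⟩
    · exact ⟨(1, 2), by simp, by simp, Sym2.eq_swap⟩
  · rintro ⟨u, rfl | rfl | rfl, hu, rfl⟩
    · exact absurd rfl hu
    · exact Or.inl Sym2.eq_swap
    · exact Or.inr Sym2.eq_swap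

theorem treeS_eq : treeS n = hubTree (1, 1) := by
  rw [treeS, hubTree]
  congr 3
  ext e
  constructor
  · rintro (rfl | rfl)
    · exact ⟨(0, 0), by simp, by simp, Sym2.eq_swap⟩
    · exact ⟨(1, 2), by simp, by simp, Sym2.eq_swap⟩
  · rintro ⟨u, rfl | rfl | rfl, hu, rfl⟩
    · exact Or.inl Sym2.eq_swap
    · exact absurd rfl hu
    · exact Or.inr Sym2.eq_swap

theorem treeR_eq : treeR n = hubTree (1, 2) := by
  rw [treeR, hubTree]
  congr 3
  ext e
  constructor
  · rintro (rfl | rfl)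
    · exact ⟨(0, 0), by simp, by simp, Sym2.eq_swap⟩
    · exact ⟨(1, 1), by simp, by simp, Sym2.eq_swap⟩
  · rintro ⟨u, rfl | rfl | rfl, hu, rfl⟩
    · exact Or.inl Sym2.eq_swap
    · exact Or.inr Sym2.eq_swap
    · exact absurd rfl hu

/-- The three trees form a component of the tree graph. -/
theorem hubTree_component {β : Set (Sym2 (Vert n))}
    (hβ : β = triangle ![0, 0, 0] ∨ β = triangle ![1, 1, 0]) :
    ((treeGraph (nestedOctahedra n) (faceFamily n β)).connectedComponentMk
      ⟨hubTree (0, 0), isHub_zero.isSpanningTree⟩).supp = {P | ∃ g, IsHub g ∧ P.1 = hubTree g} := by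
  ext P
  rw [SimpleGraph.ConnectedComponent.mem_supp_iff, SimpleGraph.ConnectedComponent.eq]
  constructor
  · rintro ⟨w⟩
    have key : ∀ {P Q : SpanningTree (nestedOctahedra n)},
        (treeGraph (nestedOctahedra n) (faceFamily n β)).Walk P Q →
        (∃ g, IsHub g ∧ Q.1 = hubTree g) → ∃ g, IsHub g ∧ P.1 = hubTree g := by
      intro P Q w
      induction w with
      | nil => exact id
      | cons had _ ih =>
        intro hQ
        obtain ⟨g, hg, hS⟩ := ih hQ
        exact hg.of_adj hβ hS had.symm
    exact key w ⟨_, isHub_zero, rfl⟩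
  · rintro ⟨g, hg, hP⟩
    by_cases h0 : g = (0, 0)
    · subst h0
      have : P = ⟨hubTree (0, 0), isHub_zero.isSpanningTree⟩ := Subtype.ext hP
      rw [this]
    · have : P = ⟨hubTree g, hg.isSpanningTree⟩ := Subtype.ext hP
      rw [this]
      exact (hg.adj isHub_zero h0 β).reachable

/-- Some spanning tree is not one of the three trees, since it misses an edge that they contain. -/
theorem exists_isSpanningTree_notMem : ∃ T : SpanningTree (nestedOctahedra n),
    ¬ ∃ g, IsHub g ∧ T.1 = hubTree g := by
  have hcyc : IsCycleOf (nestedOctahedra n) (faceAlpha n) := isFace_alpha.isCycleOf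
  have hmem : s(((0, 1) : Vert n), ((0, 2) : Vert n)) ∈ faceAlpha n := by
    rw [faceAlpha, mem_triangle_iff]
    simp
  have hbr : ¬ (nestedOctahedra n).IsBridge s(((0, 1) : Vert n), ((0, 2) : Vert n)) := by
    intro hb
    obtain ⟨v, w, hw, hwe⟩ := hcyc
    rw [hwe] at hmem
    exact hb.notMem_edges_of_isCycle hw hmem
  obtain ⟨T, hle, hT⟩ := ((isTwoConnected_nestedOctahedra (n := n)).2.1
    |>.connected_delete_edge_of_not_isBridge hbr).exists_isTree_le
  refine ⟨⟨T, hle.trans (SimpleGraph.deleteEdges_le _), hT⟩, ?_⟩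
  rintro ⟨g, hg, h⟩
  have h1 : s(((0, 1) : Vert n), ((0, 2) : Vert n)) ∈ (hubTree g).edgeSet := by
    rw [hubTree_edgeSet]
    exact Or.inl (Or.inr (Or.inl rfl))
  simp only at h
  rw [← h] at h1
  have h2 := SimpleGraph.edgeSet_mono hle h1
  rw [SimpleGraph.edgeSet_deleteEdges] at h2
  exact h2.2 rfl

end Hubs

/-! ### Coordinates between consecutive layers of the drawing. -/

section Shells

/-- The slope function whose sum is the gauge of the region between two consecutive layers. -/
noncomputable def shellGauge (y : ℝ) : ℝ := max y (-y / 4)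

theorem shellGauge_of_nonneg {y : ℝ} (h : 0 ≤ y) : shellGauge y = y := max_eq_left (by linarith)

theorem shellGauge_of_nonpos {y : ℝ} (h : y ≤ 0) : shellGauge y = -y / 4 :=
  max_eq_right (by linarith)

theorem shellGauge_nonneg (y : ℝ) : 0 ≤ shellGauge y := by
  rcases le_total 0 y with h | h
  · rw [shellGauge_of_nonneg h]; exact h
  · rw [shellGauge_of_nonpos h]; linarith

theorem shellGauge_add {y t : ℝ} (ht : 0 ≤ t) : shellGauge y - t / 4 ≤ shellGauge (y + t) := by
  refine sub_le_iff_le_add.2 (max_le ?_ ?_)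
  · linarith [le_max_left (y + t) (-(y + t) / 4), show shellGauge (y + t) = max _ _ from rfl]
  · linarith [le_max_right (y + t) (-(y + t) / 4), show shellGauge (y + t) = max _ _ from rfl]

/-- The weights `w` on the vertices `(f i, i)` are barycentric coordinates of a point in the part
of the plane between the layers `k` and `k + 1`. -/
structure IsShellWeight (k : ℕ) (f : Fin 3 → ℕ) (w : Fin 3 → ℝ) : Prop where
  nonneg : ∀ i, 0 ≤ w i
  sum : ∑ i, w i = 1
  layer : ∀ i, f i = k ∨ f i = k + 1
  inner : ∃ i, w i = 0 ∨ f i = k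

variable {k k' : ℕ} {f f' : Fin 3 → ℕ} {w w' : Fin 3 → ℝ}

theorem IsShellWeight.shellGauge_eq (h : IsShellWeight k f w) (i : Fin 3) :
    shellGauge (w i * (-4) ^ (f i) / (-4) ^ k) = w i := by
  have h4 : ((-4 : ℝ) ^ k) ≠ 0 := pow_ne_zero _ (by norm_num)
  have hw := h.nonneg i
  rcases h.layer i with hi | hi <;> rw [hi]
  · rw [mul_div_assoc, div_self h4, mul_one, shellGauge_of_nonneg hw]
  · rw [pow_succ, mul_comm ((-4 : ℝ) ^ k), ← mul_assoc, mul_div_assoc, div_self h4, mul_one,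
      shellGauge_of_nonpos (by linarith)]
    ring

/-- The gauge recovers the weights from the coordinates. A shift by `t > 0` lowers each weight by at
most `t / 4` and raises by `t` one whose coordinate is nonnegative, which exists by `inner`. So the
weights cannot sum to 1 before and after. -/
theorem IsShellWeight.not_shift (h : IsShellWeight k f w) (h' : IsShellWeight k f' w') {t : ℝ}
    (ht : 0 < t) : ¬ ∀ i, w i * (-4) ^ (f i) / (-4) ^ k = w' i * (-4) ^ (f' i) / (-4) ^ k + t := by
  intro heq
  have h4 : ((-4 : ℝ) ^ k) ≠ 0 := pow_ne_zero _ (by norm_num)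
  have hle : ∀ i, w' i - t / 4 ≤ w i := fun i => by
    have := shellGauge_add (y := w' i * (-4) ^ (f' i) / (-4) ^ k) ht.le
    rwa [← heq, h.shellGauge_eq, h'.shellGauge_eq] at this
  obtain ⟨i, hi⟩ := h'.inner
  have hi' : w i = w' i + t := by
    have h0 : 0 ≤ w' i * (-4) ^ (f' i) / (-4) ^ k := by
      rcases hi with hi | hi
      · simp [hi]
      · rw [hi, mul_div_assoc, div_self h4, mul_one]
        exact h'.nonneg i
    have h1 := h.shellGauge_eq i
    have h2 := h'.shellGauge_eq i
    rw [heq, shellGauge_of_nonneg (by linarith)] at h1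
    rw [shellGauge_of_nonneg h0] at h2
    linarith
  have hs := h.sum
  have hs' := h'.sum
  obtain ⟨j, hij⟩ : ∃ j, i ≠ j := (exists_ne i).imp fun _ h => h.symm
  obtain ⟨m, him, hjm⟩ := exists_third hij
  have hsum : ∀ g : Fin 3 → ℝ, ∑ c, g c = g i + g j + g m := by
    intro g
    have : (Finset.univ : Finset (Fin 3)) = {i, j, m} := by
      ext c
      simpa using fin3_cases hij him hjm c
    rw [this, Finset.sum_insert (by simp [hij, him]), Finset.sum_insert (by simp [hjm]),
      Finset.sum_singleton]
    ring
  rw [hsum] at hs hs'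
  linarith [hle j, hle m]

theorem IsShellWeight.unique (h : IsShellWeight k f w) (h' : IsShellWeight k f' w') {t : ℝ}
    (heq : ∀ i, w i * (-4) ^ (f i) = w' i * (-4) ^ (f' i) + t) :
    w = w' ∧ ∀ i, w i ≠ 0 → f i = f' i := by
  have h4 : ((-4 : ℝ) ^ k) ≠ 0 := pow_ne_zero _ (by norm_num)
  have ht : t / (-4) ^ k = 0 := by
    rcases lt_trichotomy (t / (-4) ^ k) 0 with hlt | h0 | hlt
    · exact absurd (fun i => by rw [heq i]; ring) (h'.not_shift h (neg_pos.2 hlt))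
    · exact h0
    · exact absurd (fun i => by rw [heq i]; ring) (h.not_shift h' hlt)
  have hw : w = w' := by
    funext i
    rw [← h.shellGauge_eq i, ← h'.shellGauge_eq i, heq, add_div, ht, add_zero]
  refine ⟨hw, fun i hi => ?_⟩
  have h1 := heq i
  rw [(div_eq_zero_iff.1 ht).resolve_right h4, add_zero, ← hw, mul_right_inj' hi] at h1
  have hk : ((-4 : ℝ)) ^ k ≠ (-4) ^ (k + 1) := by
    rw [pow_succ]
    intro h
    have : ((-4 : ℝ)) ^ k * (-5) = 0 := by linarith
    simp at this
  rcases h.layer i with h2 | h2 <;> rcases h'.layer i with h3 | h3 <;> rw [h2, h3] at h1 ⊢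
  · exact absurd h1 hk
  · exact absurd h1.symm hk

/-- A point between two layers lies in the triangle of the outer one. -/
theorem exists_outer_weight (h0 : ∀ i, 0 ≤ w i) (h1 : ∑ i, w i = 1)
    (hf : ∀ i, f i = k ∨ f i = k + 1) : ∃ (v : Fin 3 → ℝ) (t : ℝ), (∀ i, 0 ≤ v i) ∧ ∑ i, v i = 1 ∧
      (∀ i, w i * (-4) ^ (f i) = v i * (-4) ^ (k + 1) + t) ∧
      ((∀ i, f i = k) → ∀ i, 0 < v i) := by
  -- These are the coordinates in units of layer `k + 1`. They fall short of sum 1 by `5 / 4 * L`,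
  -- where `L` is the weight on layer `k`; spreading this equally keeps every entry nonnegative,
  -- since `z i ≥ -L / 4`.
  let z : Fin 3 → ℝ := fun i => if f i = k then -w i / 4 else w i
  let L : ℝ := ∑ i, if f i = k then w i else 0
  have hz : ∑ i, z i = 1 - 5 / 4 * L := by
    rw [← h1, Finset.mul_sum, ← Finset.sum_sub_distrib]
    refine Finset.sum_congr rfl fun i _ => ?_
    simp only [z]
    split_ifs <;> ring
  have hnn : ∀ i, 0 ≤ if f i = k then w i else 0 := fun i => by split_ifs; exacts [h0 i, le_rfl]
  have hL : ∀ i, f i = k → w i ≤ L := fun i hi => by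
    have := Finset.single_le_sum (f := fun i => if f i = k then w i else 0) (fun i _ => hnn i)
      (Finset.mem_univ i)
    simpa only [hi, if_true] using this
  have hL0 : 0 ≤ L := Finset.sum_nonneg fun i _ => hnn i
  refine ⟨fun i => z i + 5 / 12 * L, -(5 / 12 * L * (-4) ^ (k + 1)), fun i => ?_, ?_, fun i => ?_,
    fun hall i => ?_⟩
  · simp only [z]
    split_ifs with hi
    · linarith [hL i hi]
    · linarith [h0 i]
  · rw [Finset.sum_add_distrib, hz]
    simp
    ring
  · simp only [z]
    split_ifs with hi
    · rw [hi, pow_succ]; ring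
    · rw [(hf i).resolve_left hi]; ring
  · have hL1 : L = 1 := by
      rw [← h1]
      exact Finset.sum_congr rfl fun i _ => if_pos (hall i)
    have := hL i (hall i)
    simp only [z, if_pos (hall i)]
    linarith

/-- The point with coordinates `x` (modulo constants) lies in the triangle of layer `k`. -/
def InLayerTriangle (k : ℕ) (x : Fin 3 → ℝ) : Prop :=
  ∃ (v : Fin 3 → ℝ) (t : ℝ), (∀ i, 0 ≤ v i) ∧ ∑ i, v i = 1 ∧ ∀ i, x i = v i * (-4) ^ k + t

theorem InLayerTriangle.succ {x : Fin 3 → ℝ} (h : InLayerTriangle k x) :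
    ∃ (v : Fin 3 → ℝ) (t : ℝ), (∀ i, 0 < v i) ∧ ∑ i, v i = 1 ∧
      ∀ i, x i = v i * (-4) ^ (k + 1) + t := by
  obtain ⟨v, t, h0, h1, h2⟩ := h
  obtain ⟨v', t', -, h1', h2', hpos⟩ := exists_outer_weight (f := fun _ => k) (k := k) h0 h1
    fun _ => Or.inl rfl
  exact ⟨v', t' + t, hpos fun _ => rfl, h1', fun i => by rw [h2, h2']; ring⟩

theorem InLayerTriangle.mono {x : Fin 3 → ℝ} (h : InLayerTriangle k x) (hk : k ≤ k') :
    InLayerTriangle k' x := by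
  induction hk with
  | refl => exact h
  | step _ ih =>
    obtain ⟨v, t, h0, h⟩ := ih.succ
    exact ⟨v, t, fun i => (h0 i).le, h⟩

theorem isShellWeight_const (h0 : ∀ i, 0 ≤ w i) (h1 : ∑ i, w i = 1) :
    IsShellWeight k (fun _ => k) w := ⟨h0, h1, fun _ => Or.inl rfl, 0, Or.inr rfl⟩

/-- The point lies in the closed triangle of layer `k + 1`, hence in that of layer `k'`. Uniqueness
in shell `k'` puts it on the boundary of the latter. This forces `k' = k + 1`, and a boundary point
of that triangle also has weights in shell `k`, where uniqueness applies again. -/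
theorem IsShellWeight.unique_of_lt (h : IsShellWeight k f w) (h' : IsShellWeight k' f' w')
    (hout : ∃ i, w' i = 0 ∨ f' i = k' + 1) (hk : k < k') {t : ℝ}
    (heq : ∀ i, w i * (-4) ^ (f i) = w' i * (-4) ^ (f' i) + t) :
    w = w' ∧ ∀ i, w i ≠ 0 → f i = f' i := by
  obtain ⟨v, s, hv0, hv1, hv, -⟩ := exists_outer_weight h.nonneg h.sum h.layer
  have hin : InLayerTriangle (k + 1) (fun i => w i * (-4) ^ (f i)) := ⟨v, s, hv0, hv1, hv⟩
  have key : ∀ (u : Fin 3 → ℝ) (r : ℝ), (∀ i, 0 ≤ u i) → ∑ i, u i = 1 →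
      (∀ i, w i * (-4) ^ (f i) = u i * (-4) ^ k' + r) →
      u = w' ∧ (∃ i, u i = 0) ∧ ∀ i, u i ≠ 0 → k' = f' i := by
    intro u r hu0 hu1 hu
    have huniq := (isShellWeight_const hu0 hu1).unique h' (t := t - r)
      fun i => by linarith [hu i, heq i]
    refine ⟨huniq.1, ?_, huniq.2⟩
    obtain ⟨i, hi⟩ := hout
    refine ⟨i, ?_⟩
    rw [huniq.1]
    by_contra hne
    have := huniq.2 i (by rw [huniq.1]; exact hne)
    rcases hi with hi | hi
    · exact hne hi
    · omega
  rcases Nat.lt_or_ge (k + 1) k' with hlt | hge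
  · obtain ⟨j, rfl⟩ := Nat.exists_eq_add_of_lt hlt
    obtain ⟨u, r, hu0, hu1, hu⟩ := (hin.mono (k' := k + 1 + j) (by omega)).succ
    obtain ⟨-, ⟨i, hi⟩, -⟩ := key u r (fun i => (hu0 i).le) hu1 hu
    exact absurd hi (hu0 i).ne'
  · obtain rfl : k' = k + 1 := by omega
    obtain ⟨rfl, ⟨i, hi⟩, hf'⟩ := key v s hv0 hv1 hv
    have hconst : IsShellWeight k (fun _ => k + 1) v :=
      ⟨hv0, hv1, fun _ => Or.inr rfl, i, Or.inl hi⟩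
    obtain ⟨rfl, hfk⟩ := h.unique hconst hv
    exact ⟨rfl, fun i hi => (hfk i hi).trans (hf' i hi)⟩

/-- The weights of a point of the plane are unique, even across shells, when the triangles of the
single layers other than the innermost are disregarded. -/
theorem IsShellWeight.unique_of_proper (h : IsShellWeight k f w) (h' : IsShellWeight k' f' w')
    (hout : k = 0 ∨ ∃ i, w i = 0 ∨ f i = k + 1) (hout' : k' = 0 ∨ ∃ i, w' i = 0 ∨ f' i = k' + 1)
    {t : ℝ} (heq : ∀ i, w i * (-4) ^ (f i) = w' i * (-4) ^ (f' i) + t) :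
    w = w' ∧ ∀ i, w i ≠ 0 → f i = f' i := by
  rcases lt_trichotomy k k' with hlt | rfl | hlt
  · exact h.unique_of_lt h' (hout'.resolve_left (by omega)) hlt heq
  · exact h.unique h' heq
  · obtain ⟨h1, h2⟩ := h'.unique_of_lt h (hout.resolve_left (by omega)) hlt (t := -t)
      fun i => by rw [heq]; ring
    exact ⟨h1.symm, fun i hi => (h2 i (by rwa [h1])).symm⟩

/-- Every point of the triangle of layer `N` lies in the innermost triangle or between two
consecutive layers. -/
theorem InLayerTriangle.exists_isShellWeight {N : ℕ} {x : Fin 3 → ℝ} (h : InLayerTriangle N x) :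
    ∃ (k : ℕ) (f : Fin 3 → ℕ) (w : Fin 3 → ℝ) (t : ℝ), (∀ i, f i ≤ N) ∧ IsShellWeight k f w ∧
      ((∀ i, f i = 0) ∨ ((∃ i, f i = k) ∧ ∃ i, f i = k + 1)) ∧
      ∀ i, x i = w i * (-4) ^ (f i) + t := by
  classical
  -- Take the smallest layer triangle containing the point. If it is that of layer `j + 1`, the
  -- point must lie in shell `j`.
  have hex : ∃ k, InLayerTriangle k x := ⟨N, h⟩
  have hk := Nat.find_spec hex
  have hkN := Nat.find_min' hex h
  rcases hkk : Nat.find hex with _ | j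
  · rw [hkk] at hk
    obtain ⟨v, t, h0, h1, h2⟩ := hk
    exact ⟨0, fun _ => 0, v, t, fun _ => Nat.zero_le _, isShellWeight_const h0 h1,
      Or.inl fun _ => rfl, h2⟩
  have hmin : ¬ InLayerTriangle j x := Nat.find_min hex (by omega)
  rw [hkk] at hk hkN
  obtain ⟨v, t, h0, h1, h2⟩ := hk
  obtain ⟨i₀, -, hi₀⟩ := Finset.exists_min_image Finset.univ v Finset.univ_nonempty
  have hle1 : ∀ i, v i ≤ 1 := fun i => by
    rw [← h1]
    exact Finset.single_le_sum (fun i _ => h0 i) (Finset.mem_univ i)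
  -- The coordinates are known only up to a constant; the right representative is the one whose
  -- gauges sum to 1. At `s = 4 * v i₀` the sum is `1 - 3 * v i₀`, and at `s = 5` each term is at
  -- least 1. The sign of a coordinate then tells its layer.
  let φ : ℝ → ℝ := fun s => ∑ i, shellGauge (-4 * v i + s)
  have hcont : Continuous φ := by
    unfold φ shellGauge
    fun_prop
  have hlo : φ (4 * v i₀) ≤ 1 := by
    have : φ (4 * v i₀) = ∑ i, (v i - v i₀) := Finset.sum_congr rfl fun i hi => by
      rw [shellGauge_of_nonpos (by linarith [hi₀ i hi])]
      ring
    rw [this, Finset.sum_sub_distrib, h1]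
    simp
    exact h0 i₀
  have hhi : 1 ≤ φ 5 := by
    have hge : ∀ i ∈ Finset.univ, 1 ≤ shellGauge (-4 * v i + 5) := fun i _ => by
      rw [shellGauge_of_nonneg (by linarith [hle1 i])]
      linarith [hle1 i]
    have := Finset.sum_le_sum hge
    simp only [Finset.sum_const, Finset.card_univ, Fintype.card_fin] at this
    refine le_trans ?_ this
    norm_num
  obtain ⟨s, ⟨hs1, -⟩, hs⟩ := intermediate_value_Icc (by linarith [hle1 i₀] : 4 * v i₀ ≤ 5)
    hcont.continuousOn ⟨hlo, hhi⟩
  have hterm : ∀ i, x i = shellGauge (-4 * v i + s) *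
      (-4) ^ (if 0 ≤ -4 * v i + s then j else j + 1) + (t - s * (-4) ^ j) := by
    intro i
    rw [h2]
    split_ifs with hi
    · rw [shellGauge_of_nonneg hi, pow_succ]; ring
    · rw [shellGauge_of_nonpos (by linarith), pow_succ]; ring
  have hlow : (if 0 ≤ -4 * v i₀ + s then j else j + 1) = j := if_pos (by linarith)
  refine ⟨j, fun i => if 0 ≤ -4 * v i + s then j else j + 1, fun i => shellGauge (-4 * v i + s),
    t - s * (-4) ^ j, fun i => ?_, ⟨fun i => shellGauge_nonneg _, hs, fun i => ?_, i₀, Or.inr hlow⟩,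
    Or.inr ⟨⟨i₀, hlow⟩, ?_⟩, hterm⟩
  · beta_reduce
    split_ifs <;> omega
  · split_ifs <;> simp
  · by_contra! hno
    refine hmin ⟨fun i => shellGauge (-4 * v i + s), t - s * (-4) ^ j,
      fun i => shellGauge_nonneg _, hs, fun i => ?_⟩
    rw [hterm i]
    have := hno i
    split_ifs at this ⊢ with hi
    · rfl
    · exact absurd rfl this

end Shells

/-! ### Triangles in an affine plane: frontier, complement, components. -/

section Triangles

variable {E : Type*} [NormedAddCommGroup E] [NormedSpace ℝ E] (b : AffineBasis (Fin 3) ℝ E)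

theorem sum_fin3 {M : Type*} [AddCommMonoid M] {i j m : Fin 3} (hij : i ≠ j) (him : i ≠ m)
    (hjm : j ≠ m) (g : Fin 3 → M) : ∑ c, g c = g i + (g j + g m) := by
  have : (Finset.univ : Finset (Fin 3)) = {i, j, m} := by
    ext c
    simpa using fin3_cases hij him hjm c
  rw [this, Finset.sum_insert (by simp [hij, him]), Finset.sum_insert (by simp [hjm]),
    Finset.sum_singleton]

theorem coord_sum_smul {w : Fin 3 → ℝ} (hw : ∑ i, w i = 1) (i : Fin 3) :
    b.coord i (∑ c, w c • b c) = w i := by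
  rw [← Finset.affineCombination_eq_linear_combination _ _ _ hw]
  exact b.coord_apply_combination_of_mem (Finset.mem_univ i) hw

theorem isClosed_triangleHull : IsClosed (convexHull ℝ (Set.range b)) :=
  ((Set.finite_range b).isCompact_convexHull ℝ).isClosed

theorem mem_frontier_triangleHull [FiniteDimensional ℝ E] {q : E} :
    q ∈ frontier (convexHull ℝ (Set.range b)) ↔ ∃ i j, i ≠ j ∧ q ∈ segment ℝ (b i) (b j) := by
  rw [(isClosed_triangleHull b).frontier_eq, b.interior_convexHull, b.convexHull_eq_nonneg_coord]
  simp only [Set.mem_sdiff, Set.mem_ofPred_eq, not_forall, not_lt]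
  constructor
  · rintro ⟨h0, m, hm⟩
    have hm0 : b.coord m q = 0 := le_antisymm hm (h0 m)
    obtain ⟨i, him⟩ := exists_ne m
    obtain ⟨j, hij, hmj⟩ : ∃ j, i ≠ j ∧ m ≠ j := exists_third him
    refine ⟨i, j, hij, b.coord i q, b.coord j q, h0 i, h0 j, ?_, ?_⟩
    · have := b.sum_coord_apply_eq_one q
      rw [sum_fin3 hij him hmj.symm, hm0, add_zero] at this
      exact this
    · have := b.linear_combination_coord_eq_self q
      rw [sum_fin3 hij him hmj.symm, hm0, zero_smul, add_zero] at this
      exact this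
  · rintro ⟨i, j, hij, s, t, hs, ht, hst, rfl⟩
    obtain ⟨m, him, hjm⟩ := exists_third hij
    let w : Fin 3 → ℝ := fun c => if c = i then s else if c = j then t else 0
    have hi : w i = s := if_pos rfl
    have hj : w j = t := by simp [w, hij.symm]
    have hm : w m = 0 := by simp [w, him.symm, hjm.symm]
    have hw1 : ∑ c, w c = 1 := by rw [sum_fin3 hij him hjm, hi, hj, hm, add_zero, hst]
    have hw : s • b i + t • b j = ∑ c, w c • b c := by
      rw [sum_fin3 hij him hjm, hi, hj, hm, zero_smul, add_zero]
    rw [hw]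
    refine ⟨fun c => ?_, m, ?_⟩ <;> rw [coord_sum_smul b hw1]
    · rcases fin3_cases hij him hjm c with rfl | rfl | rfl
      · rwa [hi]
      · rwa [hj]
      · rw [hm]
    · rw [hm]

theorem nonempty_interior_triangleHull : (interior (convexHull ℝ (Set.range b))).Nonempty :=
  ⟨_, b.centroid_mem_interior_convexHull⟩

theorem frontier_interior_triangleHull :
    frontier (interior (convexHull ℝ (Set.range b))) = frontier (convexHull ℝ (Set.range b)) := by
  rw [frontier, frontier, interior_interior,
    (convex_convexHull ℝ _).closure_interior_eq_closure_of_nonempty_interior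
      (nonempty_interior_triangleHull b)]

/-- The complement is the union of three open half-planes, one for each negative coordinate. The
points with coordinates `(-1, -1, 3)` and `(-1, 3, -1)` link them. -/
theorem isPreconnected_compl_triangleHull :
    IsPreconnected (convexHull ℝ (Set.range b))ᶜ := by
  let H : Fin 3 → Set E := fun i => b.coord i ⁻¹' Set.Iio 0
  have hH : ∀ i, IsPreconnected (H i) := fun i =>
    ((convex_Iio (𝕜 := ℝ) (0 : ℝ)).affine_preimage (b.coord i)).isPreconnected
  have hunion : (convexHull ℝ (Set.range b))ᶜ = H 0 ∪ H 1 ∪ H 2 := by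
    rw [b.convexHull_eq_nonneg_coord]
    ext q
    simp only [Set.mem_compl_iff, Set.mem_ofPred_eq, not_forall, not_le, Fin.exists_fin_succ,
      Set.mem_union]
    simp [H, or_assoc]
  have hpt : ∀ w : Fin 3 → ℝ, ∑ i, w i = 1 → ∀ i, w i < 0 → (∑ c, w c • b c) ∈ H i := by
    intro w hw i hi
    rw [Set.mem_preimage, coord_sum_smul b hw]
    exact hi
  rw [hunion]
  have h1 : ∑ i, (![-1, -1, 3] : Fin 3 → ℝ) i = 1 := by
    rw [Fin.sum_univ_three]
    change (-1 : ℝ) + -1 + 3 = 1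
    norm_num
  have h2 : ∑ i, (![-1, 3, -1] : Fin 3 → ℝ) i = 1 := by
    rw [Fin.sum_univ_three]
    change (-1 : ℝ) + 3 + -1 = 1
    norm_num
  refine IsPreconnected.union _ (Or.inl (hpt _ h2 0 (by simp))) (hpt _ h2 2 (by simp)) ?_ (hH 2)
  exact IsPreconnected.union _ (hpt _ h1 0 (by simp)) (hpt _ h1 1 (by simp)) (hH 0) (hH 1)

theorem not_isBounded_compl_triangleHull [Nontrivial E] :
    ¬ Bornology.IsBounded (convexHull ℝ (Set.range b))ᶜ := by
  intro h
  have h2 := ((Set.finite_range b).isCompact_convexHull ℝ).isBounded.union h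
  rw [Set.union_compl_self] at h2
  exact NormedSpace.unbounded_univ ℝ E h2

/-- An open connected set that avoids a set containing its frontier is a component of the
complement. -/
theorem connectedComponentIn_eq_of_frontier_subset {X : Type*} [TopologicalSpace X] {U S : Set X}
    (hU : IsOpen U) (hc : IsPreconnected U) (hd : U ⊆ Sᶜ) (hf : frontier U ⊆ S) {p : X}
    (hp : p ∈ U) : connectedComponentIn Sᶜ p = U := by
  refine (IsPreconnected.subset_of_closure_inter_subset isPreconnected_connectedComponentIn hU
    ⟨p, mem_connectedComponentIn (hd hp), hp⟩ ?_).antisymm (hc.subset_connectedComponentIn hp hd)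
  rintro x ⟨hx, hxc⟩
  by_contra hxU
  refine connectedComponentIn_subset _ _ hxc (hf ?_)
  rw [frontier, hU.interior_eq]
  exact ⟨hx, hxU⟩

end Triangles

/-! ### The straight-line drawing and its faces. -/

section Drawing

/-- The point of the plane with homogeneous coordinates `x`, which matter modulo constants. -/
noncomputable def planePoint : (Fin 3 → ℝ) →ₗ[ℝ] EuclideanSpace ℝ (Fin 2) where
  toFun x := !₂[x 0 - x 2, x 1 - x 2]
  map_add' x y := by
    ext i
    fin_cases i <;> simp <;> ring
  map_smul' a x := by
    ext i
    fin_cases i <;> simp <;> ring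

theorem planePoint_eq_iff {x y : Fin 3 → ℝ} :
    planePoint x = planePoint y ↔ ∃ t, ∀ i, x i = y i + t := by
  constructor
  · intro h
    have h0 : x 0 - x 2 = y 0 - y 2 := congrArg (fun p : EuclideanSpace ℝ (Fin 2) => p 0) h
    have h1 : x 1 - x 2 = y 1 - y 2 := congrArg (fun p : EuclideanSpace ℝ (Fin 2) => p 1) h
    refine ⟨x 2 - y 2, fun i => ?_⟩
    fin_cases i <;> simp <;> linarith
  · rintro ⟨t, ht⟩
    ext i
    fin_cases i <;> simp [planePoint, ht]

theorem planePoint_surjective : Function.Surjective planePoint := fun p => by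
  refine ⟨![p 0, p 1, 0], ?_⟩
  ext i
  fin_cases i <;> simp [planePoint]

variable {n : ℕ}

/-- The position of a vertex in the drawing. -/
noncomputable def position (v : Vert n) : EuclideanSpace ℝ (Fin 2) :=
  -- The sign makes `(k, i)` and `(k + 1, i)` opposite. With factor -2 the vertices of a layer would
  -- be the midpoints of the sides of the next one; -4 leaves room.
  planePoint (Pi.single v.2 ((-4) ^ v.1.val))

theorem sum_smul_position (f : Fin 3 → Fin (n + 2)) (w : Fin 3 → ℝ) :
    ∑ c, w c • position (f c, c) = planePoint fun c => w c * (-4) ^ (f c).val := by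
  simp only [position]
  rw [← funext fun c => map_smul planePoint (w c) _, ← map_sum]
  congr 1
  funext i
  simp [Finset.sum_apply, Pi.single_apply]

/-- The point `q` is the combination with weights `w` of the vertices `(f i, i)`, and lies between
the layers `k` and `k + 1`, or in the innermost triangle. -/
structure Represents (k : ℕ) (f : Fin 3 → Fin (n + 2)) (w : Fin 3 → ℝ)
    (q : EuclideanSpace ℝ (Fin 2)) : Prop where
  weight : IsShellWeight k (fun i => (f i).val) w
  proper : k = 0 ∨ ∃ i, w i = 0 ∨ (f i).val = k + 1
  eq : q = ∑ c, w c • position (f c, c)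

theorem Represents.unique {k k' : ℕ} {f f' : Fin 3 → Fin (n + 2)} {w w' : Fin 3 → ℝ}
    {q : EuclideanSpace ℝ (Fin 2)} (h : Represents k f w q) (h' : Represents k' f' w' q) :
    w = w' ∧ ∀ i, w i ≠ 0 → f i = f' i := by
  have heq := h.eq.symm.trans h'.eq
  rw [sum_smul_position, sum_smul_position, planePoint_eq_iff] at heq
  obtain ⟨t, ht⟩ := heq
  obtain ⟨h1, h2⟩ := h.weight.unique_of_proper h'.weight h.proper h'.proper ht
  exact ⟨h1, fun i hi => Fin.ext (h2 i hi)⟩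

/-- The third vertex gets weight 0 and the smaller of the two layers, so points on edges fall under
the same uniqueness statement as points in faces. -/
theorem exists_represents_edge {u v : Vert n} (huv : (nestedOctahedra n).Adj u v) {s t : ℝ}
    (hs : 0 ≤ s) (ht : 0 ≤ t) (hst : s + t = 1) :
    ∃ k f w, Represents k f w (s • position u + t • position v) ∧ f u.2 = u.1 ∧ f v.2 = v.1 ∧
      w u.2 = s ∧ w v.2 = t ∧ ∀ c, c ≠ u.2 → c ≠ v.2 → w c = 0 := by
  obtain ⟨hij, h1, h2⟩ := nestedOctahedra_adj.1 huv
  obtain ⟨m, him, hjm⟩ := exists_third hij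
  let f : Fin 3 → Fin (n + 2) := fun c =>
    if c = u.2 then u.1 else if c = v.2 then v.1 else min u.1 v.1
  let w : Fin 3 → ℝ := fun c => if c = u.2 then s else if c = v.2 then t else 0
  have hfi : f u.2 = u.1 := if_pos rfl
  have hfj : f v.2 = v.1 := by simp [f, hij.symm]
  have hfm : f m = min u.1 v.1 := by simp [f, him.symm, hjm.symm]
  have hwi : w u.2 = s := if_pos rfl
  have hwj : w v.2 = t := by simp [w, hij.symm]
  have hw0 : ∀ c, c ≠ u.2 → c ≠ v.2 → w c = 0 := fun c hc hc' => by simp [w, hc, hc']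
  have hwm : w m = 0 := hw0 m him.symm hjm.symm
  refine ⟨(min u.1 v.1).val, f, w, ⟨⟨fun c => ?_, ?_, fun c => ?_, m, Or.inl hwm⟩,
    Or.inr ⟨m, Or.inl hwm⟩, ?_⟩, hfi, hfj, hwi, hwj, hw0⟩
  · rcases fin3_cases hij him hjm c with rfl | rfl | rfl
    · rwa [hwi]
    · rwa [hwj]
    · rw [hwm]
  · rw [sum_fin3 hij him hjm, hwi, hwj, hwm, add_zero, hst]
  · have hmin : (min u.1 v.1).val = min u.1.val v.1.val := by
      rcases le_total u.1 v.1 with h | h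
      · rw [min_eq_left h, min_eq_left (by exact h)]
      · rw [min_eq_right h, min_eq_right (by exact h)]
    rcases fin3_cases hij him hjm c with rfl | rfl | rfl
    · rw [hfi, hmin]; omega
    · rw [hfj, hmin]; omega
    · rw [hfm]; omega
  · rw [sum_fin3 hij him hjm, hwi, hwj, hwm, zero_smul, add_zero, hfi, hfj]

/-- An internal face. -/
def IsInternal (f : Fin 3 → Fin (n + 2)) : Prop := IsFace f ∧ f ≠ fun _ => Fin.last (n + 1)

theorem triangle_mem_internalFaces_iff {f : Fin 3 → Fin (n + 2)} :
    triangle f ∈ internalFaces n ↔ IsInternal f := by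
  rw [mem_internalFaces]
  constructor
  · rintro ⟨g, hg, h⟩
    rw [triangle_injective hg]
    exact h
  · exact fun h => ⟨f, rfl, h⟩

theorem IsInternal.exists_represents {f : Fin 3 → Fin (n + 2)} (hf : IsInternal f)
    {w : Fin 3 → ℝ} (h0 : ∀ i, 0 ≤ w i) (h1 : ∑ i, w i = 1) :
    ∃ k, Represents k f w (∑ c, w c • position (f c, c)) := by
  obtain ⟨g, hg, h⟩ := triangle_mem_internalFaces_iff.2 hf
  rw [← triangle_injective hg] at h
  rcases h with h | ⟨⟨k, hk⟩, i, j, hij⟩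
  · exact ⟨0, ⟨h0, h1, fun i => Or.inl (by simp [h]), 0, Or.inr (by simp [h])⟩, Or.inl rfl, rfl⟩
  · have hkv : ∀ i, (f i).val = k.val ∨ (f i).val = k.val + 1 := fun i =>
      (hk i).imp (fun h => by rw [h]; rfl) fun h => by rw [h]; rfl
    have hij' : (f i).val ≠ (f j).val := fun h => hij (Fin.ext h)
    refine ⟨k, ⟨h0, h1, hkv, ?_⟩, Or.inr ?_, rfl⟩
    · rcases hkv i with hi | hi
      · exact ⟨i, Or.inr hi⟩
      · exact ⟨j, Or.inr ((hkv j).resolve_right fun h => hij' (by rw [hi, h]))⟩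
    · rcases hkv i with hi | hi
      · exact ⟨j, Or.inr ((hkv j).resolve_left fun h => hij' (by rw [hi, h]))⟩
      · exact ⟨i, Or.inr hi⟩

theorem exists_adj (w : Vert n) : ∃ v, (nestedOctahedra n).Adj w v := by
  obtain ⟨j, hj⟩ := exists_ne w.2
  exact ⟨(w.1, j), nestedOctahedra_adj.2 ⟨hj.symm, by simp, by simp⟩⟩

theorem exists_represents_position (u : Vert n) : ∃ k f w, Represents k f w (position u) ∧
    f u.2 = u.1 ∧ w u.2 = 1 ∧ ∀ c, c ≠ u.2 → w c = 0 := by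
  obtain ⟨v, huv⟩ := exists_adj u
  obtain ⟨k, f, w, hr, hfu, -, hwu, hwv, hw⟩ := exists_represents_edge huv zero_le_one le_rfl
    (add_zero 1)
  rw [one_smul, zero_smul, add_zero] at hr
  refine ⟨k, f, w, hr, hfu, hwu, fun c hc => ?_⟩
  by_cases h : c = v.2
  · rw [h, hwv]
  · exact hw c hc h

theorem edge_eq_of_represents {u v u' v' : Vert n} {f f' : Fin 3 → Fin (n + 2)} {w w' : Fin 3 → ℝ}
    (huv : u.2 ≠ v.2) (hww : w = w') (hff : ∀ i, w i ≠ 0 → f i = f' i)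
    (hf : f u.2 = u.1 ∧ f v.2 = v.1) (hf' : f' u'.2 = u'.1 ∧ f' v'.2 = v'.1) (hwu : w u.2 ≠ 0)
    (hwv : w v.2 ≠ 0) (hw' : ∀ c, c ≠ u'.2 → c ≠ v'.2 → w' c = 0) : s(u, v) = s(u', v') := by
  have key : ∀ x : Vert n, f x.2 = x.1 → w x.2 ≠ 0 → x = u' ∨ x = v' := by
    intro x hx hwx
    have hfx := hff _ hwx
    rw [hx] at hfx
    by_cases h1 : x.2 = u'.2
    · rw [h1, hf'.1] at hfx
      exact Or.inl (Prod.ext hfx h1)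
    by_cases h2 : x.2 = v'.2
    · rw [h2, hf'.2] at hfx
      exact Or.inr (Prod.ext hfx h2)
    · exact absurd (hw' _ h1 h2) (hww ▸ hwx)
  rcases key u hf.1 hwu with rfl | rfl <;> rcases key v hf.2 hwv with rfl | rfl
  · exact absurd rfl huv
  · rfl
  · exact Sym2.eq_swap
  · exact absurd rfl huv

/-- The straight-line drawing of the nested octahedra. -/
noncomputable def drawing (n : ℕ) : PlaneDrawing (nestedOctahedra n) where
  pos := position
  pos_injective u v h := by
    obtain ⟨k, f, w, hr, hf, hw, -⟩ := exists_represents_position u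
    obtain ⟨k', f', w', hr', hf', -, hw'⟩ := exists_represents_position v
    rw [h] at hr
    obtain ⟨rfl, hff⟩ := hr.unique hr'
    have h2 : u.2 = v.2 := by
      by_contra hne
      rw [hw' _ hne] at hw
      exact zero_ne_one hw
    have h1 := hff u.2 (by rw [hw]; exact one_ne_zero)
    rw [hf, h2, hf'] at h1
    exact Prod.ext h1 h2
  vertex_off_edge u v x huv := by
    rintro ⟨s, t, hs, ht, hst, heq⟩
    obtain ⟨k, f, w, hr, -, -, hwu, hwv, -⟩ := exists_represents_edge huv hs.le ht.le hst
    obtain ⟨k', f', w', hr', -, -, hw'⟩ := exists_represents_position x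
    rw [heq] at hr
    obtain ⟨rfl, -⟩ := hr.unique hr'
    have hu : u.2 = x.2 := by
      by_contra hne
      rw [hw' _ hne] at hwu
      exact hs.ne hwu
    have hv : v.2 = x.2 := by
      by_contra hne
      rw [hw' _ hne] at hwv
      exact ht.ne hwv
    exact (nestedOctahedra_adj.1 huv).1 (hu.trans hv.symm)
  edges_disjoint u v u' v' huv huv' hne := by
    rw [Set.disjoint_left]
    rintro q ⟨s, t, hs, ht, hst, heq⟩ ⟨s', t', hs', ht', hst', heq'⟩
    obtain ⟨k, f, w, hr, hf, hf2, hwu, hwv, -⟩ := exists_represents_edge huv hs.le ht.le hst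
    obtain ⟨k', f', w', hr', hf', hf2', -, -, hw'⟩ :=
      exists_represents_edge huv' hs'.le ht'.le hst'
    rw [heq] at hr
    rw [heq'] at hr'
    obtain ⟨hww, hff⟩ := hr.unique hr'
    exact hne (edge_eq_of_represents (nestedOctahedra_adj.1 huv).1 hww hff ⟨hf, hf2⟩ ⟨hf', hf2'⟩
      (by rw [hwu]; exact hs.ne') (by rw [hwv]; exact ht.ne') hw')

/-- In a relation each weight is `τ` or `-τ / 4` for one common `τ`, and no three of these numbers
sum to 0 unless `τ = 0`. -/
theorem affineIndependent_position {f : Fin 3 → Fin (n + 2)} (hf : IsFace f) :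
    AffineIndependent ℝ fun c => position (f c, c) := by
  rw [affineIndependent_iff_of_fintype]
  intro w hw hsum
  rw [Finset.weightedVSub_eq_linear_combination _ hw, sum_smul_position,
    ← map_zero planePoint, planePoint_eq_iff] at hsum
  obtain ⟨t, ht⟩ := hsum
  simp only [Pi.zero_apply, zero_add] at ht
  have hk : ∃ k, ∀ i, (f i).val = k ∨ (f i).val = k + 1 := by
    obtain ⟨i, -, hi⟩ := Finset.exists_min_image Finset.univ f Finset.univ_nonempty
    refine ⟨(f i).val, fun j => ?_⟩
    have h1 : (f i).val ≤ (f j).val := hi j (Finset.mem_univ j)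
    by_cases hij : i = j
    · rw [hij]; exact Or.inl rfl
    · have := hf.adj hij
      have h2 := (nestedOctahedra_adj.1 this).2.2
      simp only at h2
      omega
  obtain ⟨k, hk⟩ := hk
  have h4 : ((-4 : ℝ) ^ k) ≠ 0 := pow_ne_zero _ (by norm_num)
  have hwi : ∀ i, w i = t / (-4) ^ k ∨ w i = -(t / (-4) ^ k) / 4 := by
    intro i
    have := ht i
    rcases hk i with h | h <;> rw [h] at this
    · left; field_simp; exact this
    · right; rw [pow_succ] at this; field_simp; linarith
  have hs : t / (-4) ^ k = 0 := by
    rw [Fin.sum_univ_three] at hw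
    rcases hwi 0 with h0 | h0 <;> rcases hwi 1 with h1 | h1 <;> rcases hwi 2 with h2 | h2 <;>
      linarith
  intro i
  rcases hwi i with h | h <;> rw [h, hs] <;> simp

/-- The vertices of a face as an affine basis of the plane. -/
noncomputable def faceBasis (f : Fin 3 → Fin (n + 2)) (hf : IsFace f) :
    AffineBasis (Fin 3) ℝ (EuclideanSpace ℝ (Fin 2)) where
  toFun c := position (f c, c)
  ind' := affineIndependent_position hf
  tot' := by
    rw [(affineIndependent_position hf).affineSpan_eq_top_iff_card_eq_finrank_add_one]
    simp

theorem faceBasis_apply {f : Fin 3 → Fin (n + 2)} (hf : IsFace f) (c : Fin 3) :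
    faceBasis f hf c = position (f c, c) := rfl

/-- The closed triangle of a face. -/
noncomputable def faceHull (f : Fin 3 → Fin (n + 2)) (hf : IsFace f) :
    Set (EuclideanSpace ℝ (Fin 2)) := convexHull ℝ (Set.range (faceBasis f hf))

theorem mem_carrier_iff {σ : Set (Sym2 (Vert n))} {q : EuclideanSpace ℝ (Fin 2)} :
    q ∈ (drawing n).carrier σ ↔
      ∃ u v, s(u, v) ∈ σ ∧ q ∈ segment ℝ (position u) (position v) := by
  have key : ∀ u v : Vert n, convexHull ℝ ((drawing n).pos '' {x | x ∈ s(u, v)}) =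
      segment ℝ (position u) (position v) := by
    intro u v
    have : {x | x ∈ s(u, v)} = {u, v} := by ext x; simp
    rw [this, Set.image_pair, convexHull_pair]
    rfl
  simp only [PlaneDrawing.carrier, Set.mem_iUnion]
  constructor
  · rintro ⟨e, he, hq⟩
    induction e with | _ u v
    rw [key] at hq
    exact ⟨u, v, he, hq⟩
  · rintro ⟨u, v, he, hq⟩
    exact ⟨s(u, v), he, by rwa [key]⟩

theorem mem_support_iff {q : EuclideanSpace ℝ (Fin 2)} : q ∈ (drawing n).support ↔
    ∃ u v, (nestedOctahedra n).Adj u v ∧ q ∈ segment ℝ (position u) (position v) := by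
  rw [PlaneDrawing.support, Set.mem_union, mem_carrier_iff]
  constructor
  · rintro (⟨u, rfl⟩ | h)
    · obtain ⟨v, huv⟩ := exists_adj u
      exact ⟨u, v, huv, left_mem_segment _ _ _⟩
    · exact h
  · exact Or.inr

theorem carrier_subset_support {σ : Set (Sym2 (Vert n))} (hσ : σ ⊆ (nestedOctahedra n).edgeSet) :
    (drawing n).carrier σ ⊆ (drawing n).support := fun q hq => by
  obtain ⟨u, v, h, hq⟩ := mem_carrier_iff.1 hq
  exact mem_support_iff.2 ⟨u, v, hσ h, hq⟩

/-- The midpoint of a drawn edge lies on no other edge. -/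
theorem subset_of_carrier_subset {σ τ : Set (Sym2 (Vert n))}
    (hσ : σ ⊆ (nestedOctahedra n).edgeSet) (hτ : τ ⊆ (nestedOctahedra n).edgeSet)
    (h : (drawing n).carrier σ ⊆ (drawing n).carrier τ) : σ ⊆ τ := by
  intro e he
  induction e with | _ u v
  have hq : (1 / 2 : ℝ) • position u + (1 / 2 : ℝ) • position v ∈ (drawing n).carrier σ :=
    mem_carrier_iff.2 ⟨u, v, he, 1 / 2, 1 / 2, by norm_num, by norm_num, by norm_num, rfl⟩
  obtain ⟨u', v', he', s, t, hs, ht, hst, heq⟩ := mem_carrier_iff.1 (h hq)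
  obtain ⟨k, f, w, hr, hf, hf2, hwu, hwv, -⟩ := exists_represents_edge (hσ he)
    (s := 1 / 2) (t := 1 / 2) (by norm_num) (by norm_num) (by norm_num)
  obtain ⟨k', f', w', hr', hf', hf2', -, -, hw'⟩ := exists_represents_edge (hτ he') hs ht hst
  rw [heq] at hr'
  obtain ⟨hww, hff⟩ := hr.unique hr'
  rw [edge_eq_of_represents (nestedOctahedra_adj.1 (hσ he)).1 hww hff ⟨hf, hf2⟩ ⟨hf', hf2'⟩
    (by rw [hwu]; norm_num) (by rw [hwv]; norm_num) hw']
  exact he'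

theorem carrier_injOn {σ τ : Set (Sym2 (Vert n))}
    (hσ : σ ⊆ (nestedOctahedra n).edgeSet) (hτ : τ ⊆ (nestedOctahedra n).edgeSet)
    (h : (drawing n).carrier σ = (drawing n).carrier τ) : σ = τ :=
  (subset_of_carrier_subset hσ hτ h.subset).antisymm (subset_of_carrier_subset hτ hσ h.superset)

theorem frontier_faceHull {f : Fin 3 → Fin (n + 2)} (hf : IsFace f) :
    frontier (faceHull f hf) = (drawing n).carrier (triangle f) := by
  ext q
  rw [faceHull, mem_frontier_triangleHull, mem_carrier_iff]
  constructor
  · rintro ⟨i, j, hij, hq⟩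
    exact ⟨(f i, i), (f j, j), mem_triangle_iff.2 ⟨hij, rfl, rfl⟩, hq⟩
  · rintro ⟨⟨a, i⟩, ⟨b, j⟩, h, hq⟩
    obtain ⟨hij, h1, h2⟩ := mem_triangle_iff.1 h
    simp only at hij h1 h2
    subst h1 h2
    exact ⟨i, j, hij, hq⟩

theorem interior_faceHull {f : Fin 3 → Fin (n + 2)} (hf : IsFace f) :
    interior (faceHull f hf) = {q | ∀ i, 0 < (faceBasis f hf).coord i q} :=
  (faceBasis f hf).interior_convexHull

/-- Interior points have three positive weights, points on edges have a zero weight, and the weights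
are unique. -/
theorem IsInternal.interior_subset {f : Fin 3 → Fin (n + 2)} (hf : IsInternal f) :
    interior (faceHull f hf.1) ⊆ (drawing n).supportᶜ := by
  intro q hq hs
  rw [interior_faceHull] at hq
  have h1 := (faceBasis f hf.1).sum_coord_apply_eq_one q
  have h2 := (faceBasis f hf.1).linear_combination_coord_eq_self q
  obtain ⟨k, hr⟩ := hf.exists_represents (w := fun i => (faceBasis f hf.1).coord i q)
    (fun i => (hq i).le) h1
  simp only [faceBasis_apply] at h2
  rw [h2] at hr
  obtain ⟨u, v, huv, s, t, hs, ht, hst, heq⟩ := mem_support_iff.1 hs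
  obtain ⟨k', f', w', hr', -, -, -, -, hw'⟩ := exists_represents_edge huv hs ht hst
  rw [heq] at hr'
  obtain ⟨rfl, -⟩ := hr.unique hr'
  obtain ⟨m, hm1, hm2⟩ := exists_third (nestedOctahedra_adj.1 huv).1
  exact (hq m).ne' (hw' m hm1.symm hm2.symm)

theorem isFace_last : IsFace (fun _ => Fin.last (n + 1) : Fin 3 → Fin (n + 2)) := by
  simp [IsFace, IsFaceTriple]

/-- The closed triangle of the outermost layer. -/
noncomputable def outerHull (n : ℕ) : Set (EuclideanSpace ℝ (Fin 2)) :=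
  faceHull (fun _ => Fin.last (n + 1)) isFace_last

theorem mem_outerHull_iff {x : Fin 3 → ℝ} :
    planePoint x ∈ outerHull n ↔ InLayerTriangle (n + 1) x := by
  rw [outerHull, faceHull, AffineBasis.convexHull_eq_nonneg_coord]
  set b := faceBasis (n := n) (fun _ => Fin.last (n + 1)) isFace_last with hb
  have hsum : ∀ v : Fin 3 → ℝ, ∑ c, v c • b c = planePoint fun c => v c * (-4) ^ (n + 1) :=
    fun v => sum_smul_position _ v
  constructor
  · intro h
    have h2 := b.linear_combination_coord_eq_self (planePoint x)
    rw [hsum] at h2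
    obtain ⟨t, ht⟩ := planePoint_eq_iff.1 h2.symm
    exact ⟨fun i => b.coord i (planePoint x), t, h, b.sum_coord_apply_eq_one _, ht⟩
  · rintro ⟨v, t, h0, h1, h2⟩
    intro i
    rw [planePoint_eq_iff.2 ⟨t, h2⟩, ← hsum, coord_sum_smul b h1]
    exact h0 i

theorem position_mem_outerHull (v : Vert n) : position v ∈ outerHull n := by
  rw [position, mem_outerHull_iff]
  refine InLayerTriangle.mono (k := v.1.val) ⟨Pi.single v.2 1, 0, fun i => ?_, ?_, fun i => ?_⟩
    (by omega)
  · by_cases h : i = v.2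
    · subst h; simp
    · simp [h]
  · simp
  · by_cases h : i = v.2
    · subst h; simp
    · simp [h]

theorem convex_outerHull : Convex ℝ (outerHull n) := convex_convexHull ℝ _

theorem support_subset_outerHull : (drawing n).support ⊆ outerHull n := fun q hq => by
  obtain ⟨u, v, -, hq⟩ := mem_support_iff.1 hq
  exact convex_outerHull.segment_subset (position_mem_outerHull u) (position_mem_outerHull v) hq

/-- The drawn faces cover the triangle of the outermost layer. -/
theorem exists_mem_interior_faceHull {q : EuclideanSpace ℝ (Fin 2)} (hq : q ∈ outerHull n)
    (hs : q ∉ (drawing n).support) :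
    ∃ (f : Fin 3 → Fin (n + 2)) (hf : IsInternal f), q ∈ interior (faceHull f hf.1) := by
  obtain ⟨x, rfl⟩ := planePoint_surjective q
  obtain ⟨k, f, w, t, hfN, hW, hcase, hx⟩ := (mem_outerHull_iff.1 hq).exists_isShellWeight
  let F : Fin 3 → Fin (n + 2) := fun c => ⟨f c, by have := hfN c; omega⟩
  have heq : planePoint x = ∑ c, w c • position (F c, c) := by
    rw [sum_smul_position, planePoint_eq_iff]
    exact ⟨t, hx⟩
  by_cases hpos : ∀ i, 0 < w i
  · have hF : IsInternal F := by
      rw [← triangle_mem_internalFaces_iff]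
      refine ⟨F, rfl, ?_⟩
      rcases hcase with h0 | ⟨⟨i, hi⟩, j, hj⟩
      · exact Or.inl fun i => Fin.ext (h0 i)
      · have := hfN j
        refine Or.inr ⟨⟨⟨k, by omega⟩, fun c => ?_⟩, i, j, fun h => ?_⟩
        · exact (hW.layer c).imp (fun h => Fin.ext h) fun h => Fin.ext h
        · have := congrArg Fin.val h
          simp only [F] at this
          omega
    refine ⟨F, hF, ?_⟩
    rw [interior_faceHull]
    intro i
    rw [heq]
    have := coord_sum_smul (faceBasis F hF.1) hW.sum i
    simp only [faceBasis_apply] at this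
    rw [this]
    exact hpos i
  · exfalso
    push Not at hpos
    obtain ⟨m, hm⟩ := hpos
    have hm0 : w m = 0 := le_antisymm hm (hW.nonneg m)
    obtain ⟨i, him⟩ := exists_ne m
    obtain ⟨j, hij, hmj⟩ := exists_third him
    refine hs (mem_support_iff.2 ⟨(F i, i), (F j, j), nestedOctahedra_adj.2 ⟨hij, ?_, ?_⟩, w i, w j,
      hW.nonneg i, hW.nonneg j, ?_, ?_⟩)
    · have h1 := hW.layer i
      have h2 := hW.layer j
      simp only [F]
      omega
    · have h1 := hW.layer i
      have h2 := hW.layer j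
      simp only [F]
      omega
    · have := hW.sum
      rwa [sum_fin3 hij him hmj.symm, hm0, add_zero] at this
    · rw [heq, sum_fin3 hij him hmj.symm, hm0, zero_smul, add_zero]

theorem frontier_interior_faceHull {f : Fin 3 → Fin (n + 2)} (hf : IsFace f) :
    frontier (interior (faceHull f hf)) = (drawing n).carrier (triangle f) := by
  rw [← frontier_faceHull hf]
  exact frontier_interior_triangleHull _

theorem IsInternal.connectedComponentIn_eq {f : Fin 3 → Fin (n + 2)} (hf : IsInternal f)
    {p : EuclideanSpace ℝ (Fin 2)} (hp : p ∈ interior (faceHull f hf.1)) :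
    connectedComponentIn (drawing n).supportᶜ p = interior (faceHull f hf.1) := by
  refine connectedComponentIn_eq_of_frontier_subset isOpen_interior
    (convex_convexHull ℝ _).interior.isPreconnected hf.interior_subset ?_ hp
  exact (frontier_interior_faceHull hf.1).trans_subset
    (carrier_subset_support hf.1.isCycleOf.subset_edgeSet)

theorem connectedComponentIn_compl_outerHull {p : EuclideanSpace ℝ (Fin 2)}
    (hp : p ∉ outerHull n) : connectedComponentIn (drawing n).supportᶜ p = (outerHull n)ᶜ := by
  refine connectedComponentIn_eq_of_frontier_subset (isClosed_triangleHull _).isOpen_compl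
    (isPreconnected_compl_triangleHull _) (Set.compl_subset_compl.2 support_subset_outerHull) ?_ hp
  rw [frontier_compl]
  exact (frontier_faceHull isFace_last).trans_subset
    (carrier_subset_support isFace_last.isCycleOf.subset_edgeSet)

theorem drawing_isFace_cases {F : Set (EuclideanSpace ℝ (Fin 2))} (hF : (drawing n).IsFace F) :
    (∃ (f : Fin 3 → Fin (n + 2)) (hf : IsInternal f), F = interior (faceHull f hf.1)) ∨
      F = (outerHull n)ᶜ := by
  obtain ⟨p, hp, rfl⟩ := hF
  by_cases h : p ∈ outerHull n
  · obtain ⟨f, hf, hpf⟩ := exists_mem_interior_faceHull h hp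
    exact Or.inl ⟨f, hf, hf.connectedComponentIn_eq hpf⟩
  · exact Or.inr (connectedComponentIn_compl_outerHull h)

theorem IsInternal.isFace_interior {f : Fin 3 → Fin (n + 2)} (hf : IsInternal f) :
    (drawing n).IsFace (interior (faceHull f hf.1)) := by
  obtain ⟨p, hp⟩ := nonempty_interior_triangleHull (faceBasis f hf.1)
  exact ⟨p, hf.interior_subset hp, (hf.connectedComponentIn_eq hp).symm⟩

theorem not_isBounded_compl_outerHull : ¬ Bornology.IsBounded (outerHull n)ᶜ :=
  not_isBounded_compl_triangleHull _

theorem isFace_compl_outerHull : (drawing n).IsFace (outerHull n)ᶜ := by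
  have hne : (outerHull n)ᶜ.Nonempty := by
    rw [Set.nonempty_iff_ne_empty]
    intro h
    refine not_isBounded_compl_outerHull (n := n) ?_
    rw [h]
    exact Bornology.isBounded_empty
  obtain ⟨p, hp⟩ := hne
  exact ⟨p, fun h => hp (support_subset_outerHull h),
    (connectedComponentIn_compl_outerHull hp).symm⟩

theorem frontier_compl_outerHull :
    frontier (outerHull n)ᶜ = (drawing n).carrier (outerFace n) := by
  rw [frontier_compl]
  exact frontier_faceHull isFace_last

theorem isBounded_interior_faceHull {f : Fin 3 → Fin (n + 2)} (hf : IsFace f) :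
    Bornology.IsBounded (interior (faceHull f hf)) :=
  (((Set.finite_range _).isCompact_convexHull ℝ).isBounded).subset interior_subset

theorem triangle_ncard (f : Fin 3 → Fin (n + 2)) : (triangle f).ncard = 3 := by
  rw [triangle_eq (i := 0) (j := 1) (m := 2) (by decide) (by decide) (by decide),
    Set.ncard_eq_three]
  exact ⟨_, _, _, by simp, by simp, by simp, rfl⟩

theorem drawing_isTriangulated : (drawing n).IsTriangulated := by
  intro F hF
  rcases drawing_isFace_cases hF with ⟨f, hf, rfl⟩ | rfl
  · exact ⟨_, hf.1.isCycleOf, triangle_ncard f, frontier_interior_faceHull hf.1⟩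
  · exact ⟨_, isFace_last.isCycleOf, triangle_ncard _, frontier_compl_outerHull⟩

theorem drawing_internalFaceCycles : (drawing n).internalFaceCycles = internalFaces n := by
  ext σ
  constructor
  · rintro ⟨hσ, F, hF, hb, hfr⟩
    rcases drawing_isFace_cases hF with ⟨f, hf, rfl⟩ | rfl
    · rw [frontier_interior_faceHull] at hfr
      rw [carrier_injOn hσ.subset_edgeSet hf.1.isCycleOf.subset_edgeSet hfr.symm]
      exact triangle_mem_internalFaces_iff.2 hf
    · exact absurd hb not_isBounded_compl_outerHull
  · intro hσ
    obtain ⟨f, rfl, hf, hlast⟩ := mem_internalFaces.1 hσ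
    exact ⟨hf.isCycleOf, _, IsInternal.isFace_interior ⟨hf, hlast⟩, isBounded_interior_faceHull hf,
      frontier_interior_faceHull hf⟩

theorem drawing_outerFaceCycles : (drawing n).outerFaceCycles = {outerFace n} := by
  ext σ
  constructor
  · rintro ⟨hσ, F, hF, hb, hfr⟩
    rcases drawing_isFace_cases hF with ⟨f, hf, rfl⟩ | rfl
    · exact absurd (isBounded_interior_faceHull hf.1) hb
    · rw [frontier_compl_outerHull] at hfr
      exact carrier_injOn hσ.subset_edgeSet isFace_last.isCycleOf.subset_edgeSet hfr.symm
  · rintro rfl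
    exact ⟨isFace_last.isCycleOf, _, isFace_compl_outerHull, not_isBounded_compl_outerHull,
      frontier_compl_outerHull⟩

end Drawing

/-! ### Two triangles with a common edge. -/

section TwoTriangles

variable {V : Type*} {x u v w : V}

/-- The triangle on three vertices. -/
def triangleOn (x u v : V) : Set (Sym2 V) := {s(x, u), s(x, v), s(u, v)}

theorem triangleOn_inter (hxu : x ≠ u) (hxv : x ≠ v) (hxw : x ≠ w) :
    triangleOn x u v ∩ triangleOn w u v = {s(u, v)} := by
  ext e
  simp only [triangleOn, Set.mem_inter_iff, Set.mem_insert_iff, Set.mem_singleton_iff]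
  constructor
  · rintro ⟨rfl | rfl | rfl, h⟩
    · simp [hxu, hxv, hxw] at h
    · simp [hxu, hxv, hxw] at h
    · rfl
  · exact fun h => ⟨.inr (.inr h), .inr (.inr h)⟩

theorem triangleOn_symmDiff (hxu : x ≠ u) (hxv : x ≠ v) (hwu : w ≠ u) (hwv : w ≠ v)
    (hxw : x ≠ w) :
    triangleOn x u v ∆ triangleOn w u v = {s(x, u), s(u, w), s(w, v), s(v, x)} := by
  ext e
  simp only [triangleOn, Set.mem_symmDiff, Set.mem_insert_iff, Set.mem_singleton_iff]
  constructor
  · rintro (⟨rfl | rfl | rfl, h⟩ | ⟨rfl | rfl | rfl, h⟩)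
    · simp
    · simp [Sym2.eq_swap]
    · simp at h
    · simp [Sym2.eq_swap]
    · simp
    · simp at h
  · rintro (rfl | rfl | rfl | rfl)
    · left; simp [hxu, hxv, hxw]
    · right; simp [hwu, hwv, hxw.symm, Sym2.eq_swap]
    · right; simp [hwu, hwv, hxw.symm]
    · left; simp [hxu, hxv, hxw, Sym2.eq_swap]

theorem isCycleOf_triangleOn_symmDiff {G : SimpleGraph V} (hxu : G.Adj x u) (hxv : G.Adj x v)
    (hwu : G.Adj w u) (hwv : G.Adj w v) (hxw : x ≠ w) (huv : u ≠ v) :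
    IsCycleOf G (triangleOn x u v ∆ triangleOn w u v) := by
  rw [triangleOn_symmDiff hxu.ne hxv.ne hwu.ne hwv.ne hxw]
  refine ⟨_, .cons hxu (.cons hwu.symm (.cons hwv (.cons hxv.symm .nil))), ?_, ?_⟩
  · rw [SimpleGraph.Walk.cons_isCycle_iff]
    have := hxu.ne
    have := hxv.ne
    have := hwu.ne
    have := hwv.ne
    simp [SimpleGraph.Walk.cons_isPath_iff, *, Ne.symm, Ne.symm hxw]
  · ext e
    simp

end TwoTriangles

/-! ### The modified family: its members, cyclic spanning, and the disconnected tree graph. -/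

section Octahedra

variable {n : ℕ}

/-- The common edge `uv` is `ca` for `β = abc` and `xa` for `β = xya`. -/
theorem exists_faceAlpha_eq {β : Set (Sym2 (Vert n))}
    (hβ : β = triangle ![0, 0, 0] ∨ β = triangle ![1, 1, 0]) :
    ∃ x u v w, faceAlpha n = triangleOn x u v ∧ β = triangleOn w u v ∧
      (nestedOctahedra n).Adj x u ∧ (nestedOctahedra n).Adj x v ∧
      (nestedOctahedra n).Adj w u ∧ (nestedOctahedra n).Adj w v ∧ x ≠ w ∧ u ≠ v := by
  rcases hβ with rfl | rfl
  · refine ⟨(1, 0), (0, 1), (0, 2), (0, 0),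
      triangle_eq (i := 0) (j := 1) (m := 2) (by decide) (by decide) (by decide) _,
      triangle_eq (i := 0) (j := 1) (m := 2) (by decide) (by decide) (by decide) _, ?_⟩
    simp [nestedOctahedra_adj]
  · refine ⟨(0, 1), (1, 0), (0, 2), (1, 1),
      triangle_eq (i := 1) (j := 0) (m := 2) (by decide) (by decide) (by decide) _,
      triangle_eq (i := 1) (j := 0) (m := 2) (by decide) (by decide) (by decide) _, ?_⟩
    simp [nestedOctahedra_adj]

theorem mem_internalFaces_of_eq_zero {f : Fin 3 → Fin (n + 2)} (hf : IsFace f) {c : Fin 3}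
    (hc : f c = 0) : triangle f ∈ internalFaces n :=
  mem_internalFaces.2 ⟨f, rfl, hf, ne_last_of_eq_zero hc⟩

theorem isCycleOf_of_mem_faceFamily {β σ : Set (Sym2 (Vert n))}
    (hβ : β = triangle ![0, 0, 0] ∨ β = triangle ![1, 1, 0]) (hσ : σ ∈ faceFamily n β) :
    IsCycleOf (nestedOctahedra n) σ := by
  rcases hσ with rfl | ⟨hσ, -⟩
  · obtain ⟨x, u, v, w, h, rfl, hxu, hxv, hwu, hwv, hxw, huv⟩ := exists_faceAlpha_eq hβ
    rw [h]
    exact isCycleOf_triangleOn_symmDiff hxu hxv hwu hwv hxw huv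
  · obtain ⟨f, rfl, hf, -⟩ := mem_internalFaces.1 hσ
    exact hf.isCycleOf

theorem not_connected_treeGraph {β : Set (Sym2 (Vert n))}
    (hβ : β = triangle ![0, 0, 0] ∨ β = triangle ![1, 1, 0]) :
    ¬ (treeGraph (nestedOctahedra n) (faceFamily n β)).Connected := by
  intro hc
  obtain ⟨P, hP⟩ := exists_isSpanningTree_notMem (n := n)
  refine hP ((Set.ext_iff.1 (hubTree_component hβ) P).1 ?_)
  rw [SimpleGraph.ConnectedComponent.mem_supp_iff, SimpleGraph.ConnectedComponent.eq]
  exact hc.preconnected _ _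

theorem mem_internalFaces_of_eq_or {β : Set (Sym2 (Vert n))}
    (hβ : β = triangle ![0, 0, 0] ∨ β = triangle ![1, 1, 0]) : β ∈ internalFaces n := by
  rcases hβ with rfl | rfl
  · exact mem_internalFaces_of_eq_zero isFace_zero (c := 0) rfl
  · exact mem_internalFaces_of_eq_zero isFace_oneOneZero (c := 2) rfl

theorem cyclicallySpans_faceFamily_beta {β : Set (Sym2 (Vert n))}
    (hβ : β = triangle ![0, 0, 0] ∨ β = triangle ![1, 1, 0]) :
    CyclicallySpans (nestedOctahedra n) (faceFamily n β) := by
  rcases hβ with rfl | rfl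
  · exact cyclicallySpans_faceFamily isFace_zero ⟨0, rfl⟩ fun h => by simpa using congrFun h 0
  · exact cyclicallySpans_faceFamily isFace_oneOneZero ⟨2, rfl⟩
      fun h => by simpa using congrFun h 1

theorem ncard_faceAlpha_inter {β : Set (Sym2 (Vert n))}
    (hβ : β = triangle ![0, 0, 0] ∨ β = triangle ![1, 1, 0]) :
    (faceAlpha n ∩ β).ncard = 1 := by
  obtain ⟨x, u, v, w, h, rfl, hxu, hxv, -, -, hxw, -⟩ := exists_faceAlpha_eq hβ
  rw [h, triangleOn_inter hxu.ne hxv.ne hxw, Set.ncard_singleton]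

end Octahedra

end TreeGraphs

theorem mainTheorem3 (n : ℕ) :
    Nat.card (Vert n) = 3 * (n + 2) ∧
    IsTwoConnected (nestedOctahedra n) ∧
    (∃ D : PlaneDrawing (nestedOctahedra n), D.IsTriangulated ∧
      D.internalFaceCycles = internalFaces n ∧ D.outerFaceCycles = {outerFace n}) ∧
    ∀ β : Set (Sym2 (Vert n)), β = triangle ![0, 0, 0] ∨ β = triangle ![1, 1, 0] →
      faceAlpha n ∈ internalFaces n ∧ β ∈ internalFaces n ∧ (faceAlpha n ∩ β).ncard = 1 ∧
      (∀ σ ∈ faceFamily n β, IsCycleOf (nestedOctahedra n) σ) ∧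
      IsArboreal (nestedOctahedra n) (faceFamily n β) ∧
      CyclicallySpans (nestedOctahedra n) (faceFamily n β) ∧
      ¬ (treeGraph (nestedOctahedra n) (faceFamily n β)).Connected ∧
      ∃ T S R : SpanningTree (nestedOctahedra n),
        T.1 = treeT n ∧ S.1 = treeS n ∧ R.1 = treeR n ∧ T ≠ S ∧ T ≠ R ∧ S ≠ R ∧
        (∃ K : (treeGraph (nestedOctahedra n) (faceFamily n β)).ConnectedComponent,
          K.supp = {T, S, R}) ∧
        ∀ P ∈ ({T, S, R} : Set (SpanningTree (nestedOctahedra n))), ∀ σ ∈ faceFamily n β,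
          IsFundamentalCycle (nestedOctahedra n) P.1 σ ↔ σ = faceRho n := by
  refine ⟨by simp [Nat.mul_comm], isTwoConnected_nestedOctahedra,
    ⟨drawing n, drawing_isTriangulated, drawing_internalFaceCycles, drawing_outerFaceCycles⟩,
    fun β hβ => ⟨mem_internalFaces_of_eq_zero isFace_alpha (c := 1) rfl,
      mem_internalFaces_of_eq_or hβ, ncard_faceAlpha_inter hβ, fun σ hσ => isCycleOf_of_mem_faceFamily hβ hσ,
      isArboreal_faceFamily β, cyclicallySpans_faceFamily_beta hβ, not_connected_treeGraph hβ,
      ⟨_, isHub_zero.isSpanningTree⟩, ⟨_, isHub_y.isSpanningTree⟩, ⟨_, isHub_z.isSpanningTree⟩,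
      treeT_eq.symm, treeS_eq.symm, treeR_eq.symm, ?_, ?_, ?_,
      ⟨_, (hubTree_component hβ).trans ?_⟩, ?_⟩⟩
  · exact fun h => isHub_zero.ne_hubTree isHub_y (by simp) (congrArg Subtype.val h)
  · exact fun h => isHub_zero.ne_hubTree isHub_z (by simp) (congrArg Subtype.val h)
  · exact fun h => isHub_y.ne_hubTree isHub_z (by simp) (congrArg Subtype.val h)
  · ext P
    simp only [Set.mem_insert_iff, Set.mem_singleton_iff, Subtype.ext_iff]
    constructor
    · rintro ⟨g, rfl | rfl | rfl, h⟩
      exacts [.inl h, .inr (.inl h), .inr (.inr h)]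
    · rintro (h | h | h)
      exacts [⟨_, isHub_zero, h⟩, ⟨_, isHub_y, h⟩, ⟨_, isHub_z, h⟩]
  · rintro P (rfl | rfl | rfl) σ hσ
    exacts [isHub_zero.isFundamentalCycle_iff hβ hσ, isHub_y.isFundamentalCycle_iff hβ hσ,
      isHub_z.isFundamentalCycle_iff hβ hσ]
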